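/- Let $M$ be a smooth manifold of dimension $n+1\ge 2$, let $g$ be a pseudo-Riemannian metric on $M$ of signature $(2p-1,2q)$ (with $p\ge 1$, $q\ge 0$), with Levi-Civita connection $\nabla$, and let $k$ be a vector field such that $(M,g,k)$ is Sasaki–Einstein: $k$ is a Killing field of $g$ with $g_{ab}k^ak^b=1$ and $\nabla_a\nabla_bk^c=-g_{ab}k^c+\delta^c{}_a k_b$, and $\mathrm{Ric}=\lambda g$ for some constant $\lambda$. Let $[\nabla]$ be the projective class of $\nabla$, i.e. the set of torsion-free affine connections $\nabla'$ of the form $\nabla'_a\xi^b=\nabla_a\xi^b+\Upsilon_a\xi^b+\delta^b{}_a\Upsilon_c\xi^c$ with a $1$-form $\Upsilon$. For $w\in\mathbb R$ let $\mathcal E(w)=\big((\Lambda^{n+1}TM)^{\otimes 2}\big)^{w/(2n+4)}$. The projective tractor bundle $\mathcal T$ is the dual of the bundle $J^1\mathcal E(1)$ of $1$-jets of sections of $\mathcal E(1)$; it has rank $n+2$. Any $\nabla'\in[\nabla]$ determines a splitting $\mathcal T\cong TM\otimes\mathcal E(-1)\oplus\mathcal E(-1)$, in which the normal tractor connection is $$\nabla^{\mathcal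 T}_a(\nu^b,\rho)=(\nabla'_a\nu^b+\rho\,\delta^b{}_a,\ \nabla'_a\rho-\mathsf P_{ab}\nu^b),\qquad \mathsf P_{ab}=\tfrac1{n(n+2)}\big[(n+1)\mathrm{Ric}_{ab}+\mathrm{Ric}_{ba}\big],$$ where $\mathrm{Ric}$ is the Ricci tensor of $\nabla'$. Then there are, on $\mathcal T$, a smooth complex structure $\mathbb J$ and a smooth metric $h\in\Gamma(S^2\mathcal T^*)$ of signature $(2p,2q)$ which is Hermitian, $h(\mathbb J\,\cdot,\mathbb J\,\cdot)=h(\cdot,\cdot)$, such that $\mathbb J$ and $h$ are parallel for the tractor connection $\nabla^{\mathcal T}$ (formed with any $\nabla'\in[\nabla]$). If $M$ is simply connected, then there is moreover a parallel tractor complex volume form, i.e. a smooth nowhere vanishing $\nabla^{\mathcal T}$-parallel section of $\Lambda^{p+q}_{\mathbb C}(\mathcal T,\mathbb J)^*$. In all cases the restricted holonomy of the tractor connection lies in $\mathrm{SU}(p,q)$: at every $x\in M$, the parallel transport for $\nabla^{\mathcal T}$ along any null-homotopic piecewise $C^1$ loop at $x$ lies in the special unitary group $\mathrm{SU}(\mathcal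 T_x,\mathbb J_x,h_x)\cong\mathrm{SU}(p,q)$. -/

import Mathlib

open Bundle Module
open scoped Manifold ContDiff Topology

set_option linter.unusedSectionVars false

namespace ProjTractor

/-! ### The projective tractor bundle of a smooth manifold

`M` is a smooth manifold modelled on the finite-dimensional space `E`; its dimension is written
`n + 1`, so that `n + 2 = finrank ℝ E + 1`. -/

section TractorBundle

variable {E : Type*} [NormedAddCommGroup E] [NormedSpace ℝ E] [FiniteDimensional ℝ E]
variable {M : Type*} [TopologicalSpace M] [ChartedSpace E M] [IsManifold 𝓘(ℝ, E) ∞ M]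

/-- The Jacobian at `x` of the change from the chart `i` to the chart `j`. -/
noncomputable def tangentChange (i j : atlas E M) (x : M) : E →L[ℝ] E :=
  (tangentBundleCore 𝓘(ℝ, E) M).coordChange i j x

/-- The density bundle `ℰ(w) = ((Λⁿ⁺¹ TM)^{⊗2})^{w/(2n+4)}` has the transition functions
`|det (tangentChange i j)| ^ (w / (n + 2)) = exp (w * densityLog i j)`. -/
noncomputable def densityLog (i j : atlas E M) (x : M) : ℝ :=
  Real.log |(tangentChange i j x).det| / ((finrank ℝ E : ℝ) + 1)

/-- The differential of `densityLog i j` in the coordinates of the chart `i`. -/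
noncomputable def densityLogDeriv (i j : atlas E M) (x : M) : E →L[ℝ] ℝ :=
  fderiv ℝ (fun y : E ↦ densityLog i j (i.1.symm y)) (i.1 x)

/-- The transition functions of the tractor bundle `𝒯 = (J¹ℰ(1))*`. In a chart, the `1`-jet of a
density `σ` of weight `1` has the coordinates `(σ, dσ)`, and `(ν, ρ) : E × ℝ` denotes the linear
form `(σ, dσ) ↦ σ * ρ + dσ ν` on these jets (see `tractorCoordChange_jet`). -/
noncomputable def tractorCoordChange (i j : atlas E M) (x : M) : (E × ℝ) →L[ℝ] (E × ℝ) :=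
  Real.exp (-densityLog i j x) •
    ((tangentChange i j x ∘L ContinuousLinearMap.fst ℝ E ℝ).prod
      (ContinuousLinearMap.snd ℝ E ℝ - densityLogDeriv i j x ∘L ContinuousLinearMap.fst ℝ E ℝ))

theorem tangentChange_self (i : atlas E M) (x : M) (hi : x ∈ i.1.source) :
    tangentChange i i x = ContinuousLinearMap.id ℝ E := by
  ext v; exact (tangentBundleCore 𝓘(ℝ, E) M).coordChange_self i x hi v

theorem tangentChange_comp (i j k : atlas E M) (x : M) (hi : x ∈ i.1.source)
    (hj : x ∈ j.1.source) (hk : x ∈ k.1.source) :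
    tangentChange j k x ∘L tangentChange i j x = tangentChange i k x :=
  (tangentBundleCore 𝓘(ℝ, E) M).coordChange_linear_comp i j k x ⟨⟨hi, hj⟩, hk⟩

theorem tangentChange_det_comp (i j k : atlas E M) (x : M) (hi : x ∈ i.1.source)
    (hj : x ∈ j.1.source) (hk : x ∈ k.1.source) :
    (tangentChange j k x).det * (tangentChange i j x).det = (tangentChange i k x).det := by
  rw [← tangentChange_comp i j k x hi hj hk]
  exact (LinearMap.det_comp _ _).symm

theorem tangentChange_det_self (i : atlas E M) (x : M) (hi : x ∈ i.1.source) :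
    (tangentChange i i x).det = 1 := by
  rw [tangentChange_self i x hi]; exact LinearMap.det_id

theorem tangentChange_det_ne (i j : atlas E M) (x : M) (hi : x ∈ i.1.source)
    (hj : x ∈ j.1.source) : (tangentChange i j x).det ≠ 0 := by
  have h := tangentChange_det_comp i j i x hi hj hi
  rw [tangentChange_det_self i x hi] at h
  exact right_ne_zero_of_mul_eq_one h

theorem densityLog_self (i : atlas E M) (x : M) (hi : x ∈ i.1.source) :
    densityLog i i x = 0 := by
  rw [densityLog, tangentChange_det_self i x hi]; simp

theorem densityLog_comp (i j k : atlas E M) (x : M) (hi : x ∈ i.1.source) (hj : x ∈ j.1.source)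
    (hk : x ∈ k.1.source) : densityLog i k x = densityLog i j x + densityLog j k x := by
  rw [densityLog, ← tangentChange_det_comp i j k x hi hj hk, abs_mul,
    Real.log_mul (abs_ne_zero.2 (tangentChange_det_ne j k x hj hk))
      (abs_ne_zero.2 (tangentChange_det_ne i j x hi hj)), densityLog, densityLog]
  ring

theorem contDiff_clm_det : ContDiff ℝ ∞ (fun A : E →L[ℝ] E ↦ A.det) := by
  have : (fun A : E →L[ℝ] E ↦ A.det) = fun A ↦ ∑ σ : Equiv.Perm (Fin (finrank ℝ E)),
      (Equiv.Perm.sign σ : ℤ) • ∏ l, (finBasis ℝ E).coord (σ l) (A (finBasis ℝ E l)) := by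
    ext A
    rw [ContinuousLinearMap.det, ← LinearMap.det_toMatrix (finBasis ℝ E), Matrix.det_apply]
    simp [LinearMap.toMatrix_apply, Units.smul_def]
  rw [this]
  refine ContDiff.sum fun σ _ ↦ ?_
  refine ContDiff.const_smul _ (contDiff_prod fun l _ ↦ ?_)
  exact ((LinearMap.toContinuousLinearMap ((finBasis ℝ E).coord (σ l))).contDiff).comp
    (ContinuousLinearMap.apply ℝ E (finBasis ℝ E l)).contDiff

theorem contMDiffOn_tangentChange (i j : atlas E M) :
    ContMDiffOn 𝓘(ℝ, E) 𝓘(ℝ, E →L[ℝ] E) ∞ (fun x ↦ tangentChange i j x)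
      (i.1.source ∩ j.1.source) := by
  have h : IsManifold 𝓘(ℝ, E) (∞ + 1) M := by simpa using (inferInstance : IsManifold 𝓘(ℝ, E) ∞ M)
  exact (tangentBundleCore.isContMDiff (I := 𝓘(ℝ, E)) (M := M) (n := ∞)).1 i j

theorem contMDiffOn_densityLog (i j : atlas E M) :
    ContMDiffOn 𝓘(ℝ, E) 𝓘(ℝ, ℝ) ∞ (fun x ↦ densityLog i j x) (i.1.source ∩ j.1.source) := by
  have h1 : ContDiffOn ℝ ∞ (fun A : E →L[ℝ] E ↦ Real.log |A.det| / ((finrank ℝ E : ℝ) + 1))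
      {A | A.det ≠ 0} := by
    simp only [Real.log_abs]
    exact (contDiff_clm_det.contDiffOn.log fun A hA ↦ hA).div_const _
  exact h1.contMDiffOn.comp (contMDiffOn_tangentChange i j) fun x hx ↦
    tangentChange_det_ne i j x hx.1 hx.2

theorem isOpen_chartOverlap (i j : atlas E M) : IsOpen (i.1.target ∩ i.1.symm ⁻¹' j.1.source) :=
  i.1.symm.isOpen_inter_preimage j.1.open_source

theorem contDiffOn_densityLog (i j : atlas E M) :
    ContDiffOn ℝ ∞ (fun y : E ↦ densityLog i j (i.1.symm y))
      (i.1.target ∩ i.1.symm ⁻¹' j.1.source) := by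
  have h := (contMDiffOn_densityLog i j).comp
    ((contMDiffOn_symm_of_mem_maximalAtlas (I := 𝓘(ℝ, E)) (n := ∞)
      (IsManifold.subset_maximalAtlas i.2)).mono Set.inter_subset_left)
      (t := i.1.source ∩ j.1.source) (s := i.1.target ∩ i.1.symm ⁻¹' j.1.source)
      (fun y hy ↦ ⟨i.1.map_target hy.1, hy.2⟩)
  exact h.contDiffOn

theorem contMDiffOn_densityLogDeriv (i j : atlas E M) :
    ContMDiffOn 𝓘(ℝ, E) 𝓘(ℝ, E →L[ℝ] ℝ) ∞ (fun x ↦ densityLogDeriv i j x)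
      (i.1.source ∩ j.1.source) := by
  have h := (contDiffOn_densityLog i j).fderiv_of_isOpen (m := ∞) (isOpen_chartOverlap i j)
    (by simp)
  exact h.contMDiffOn.comp ((contMDiffOn_of_mem_maximalAtlas (I := 𝓘(ℝ, E)) (n := ∞)
      (IsManifold.subset_maximalAtlas i.2)).mono Set.inter_subset_left)
      (fun x hx ↦ ⟨i.1.map_source hx.1, by simpa [i.1.left_inv hx.1] using hx.2⟩)

theorem densityLogDeriv_self (i : atlas E M) (x : M) (hi : x ∈ i.1.source) :
    densityLogDeriv i i x = 0 := by
  have : (fun y : E ↦ densityLog i i (i.1.symm y)) =ᶠ[𝓝 (i.1 x)] fun _ ↦ 0 := by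
    filter_upwards [i.1.open_target.mem_nhds (i.1.map_source hi)] with y hy
    exact densityLog_self i _ (i.1.map_target hy)
  rw [densityLogDeriv, this.fderiv_eq]; simp

theorem hasFDerivAt_chartChange (i j : atlas E M) (x : M) (hi : x ∈ i.1.source)
    (hj : x ∈ j.1.source) :
    HasFDerivAt (fun y : E ↦ j.1 (i.1.symm y)) (tangentChange i j x) (i.1 x) := by
  have h := (𝓘(ℝ, E)).contDiffWithinAt_extendCoordChange' (n := ∞)
    (IsManifold.subset_maximalAtlas i.2) (IsManifold.subset_maximalAtlas j.2) hi hj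
  have h2 := (h.differentiableWithinAt (by simp)).hasFDerivWithinAt
  exact h2.hasFDerivAt (by simp)

theorem densityLogDeriv_comp (i j k : atlas E M) (x : M) (hi : x ∈ i.1.source)
    (hj : x ∈ j.1.source) (hk : x ∈ k.1.source) :
    densityLogDeriv i k x = densityLogDeriv i j x +
      densityLogDeriv j k x ∘L tangentChange i j x := by
  have hxi : i.1 x ∈ i.1.target := i.1.map_source hi
  have hij : i.1 x ∈ i.1.target ∩ i.1.symm ⁻¹' j.1.source :=
    ⟨hxi, by simpa [i.1.left_inv hi] using hj⟩
  have hik : i.1 x ∈ i.1.target ∩ i.1.symm ⁻¹' k.1.source :=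
    ⟨hxi, by simpa [i.1.left_inv hi] using hk⟩
  have hjk : j.1 x ∈ j.1.target ∩ j.1.symm ⁻¹' k.1.source :=
    ⟨j.1.map_source hj, by simpa [j.1.left_inv hj] using hk⟩
  have d1 : DifferentiableAt ℝ (fun y : E ↦ densityLog i j (i.1.symm y)) (i.1 x) :=
    ((contDiffOn_densityLog i j).contDiffAt
      ((isOpen_chartOverlap i j).mem_nhds hij)).differentiableAt (by simp)
  have d2 : DifferentiableAt ℝ (fun y : E ↦ densityLog j k (j.1.symm y)) (j.1 x) :=
    ((contDiffOn_densityLog j k).contDiffAt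
      ((isOpen_chartOverlap j k).mem_nhds hjk)).differentiableAt (by simp)
  have hc : j.1 (i.1.symm (i.1 x)) = j.1 x := by rw [i.1.left_inv hi]
  have d3 := hasFDerivAt_chartChange i j x hi hj
  have d2' : DifferentiableAt ℝ (fun y : E ↦ densityLog j k (j.1.symm y))
    ((fun y : E ↦ j.1 (i.1.symm y)) (i.1 x)) := by simpa only [hc] using d2
  have key : (fun y : E ↦ densityLog i k (i.1.symm y)) =ᶠ[𝓝 (i.1 x)]
      fun y ↦ densityLog i j (i.1.symm y) +
        (fun z : E ↦ densityLog j k (j.1.symm z)) (j.1 (i.1.symm y)) := by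
    filter_upwards [(isOpen_chartOverlap i j).mem_nhds hij,
      (isOpen_chartOverlap i k).mem_nhds hik] with y hy hy'
    simp only [j.1.left_inv hy.2]
    exact densityLog_comp i j k _ (i.1.map_target hy.1) hy.2 hy'.2
  have h4 := d1.hasFDerivAt.add (d2'.hasFDerivAt.comp (i.1 x) d3)
  rw [densityLogDeriv, key.fderiv_eq]
  refine (h4.fderiv).trans ?_
  simp only [hc]
  rfl

theorem contMDiffOn_tractorCoordChange (i j : atlas E M) :
    ContMDiffOn 𝓘(ℝ, E) 𝓘(ℝ, (E × ℝ) →L[ℝ] (E × ℝ)) ∞ (tractorCoordChange i j)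
      (i.1.source ∩ j.1.source) := by
  have h : ContDiff ℝ ∞ (fun p : ℝ × (E →L[ℝ] E) × (E →L[ℝ] ℝ) ↦
      Real.exp (-p.1) • ((p.2.1 ∘L ContinuousLinearMap.fst ℝ E ℝ).prod
        (ContinuousLinearMap.snd ℝ E ℝ - p.2.2 ∘L ContinuousLinearMap.fst ℝ E ℝ))) := by
    have e1 : (fun p : ℝ × (E →L[ℝ] E) × (E →L[ℝ] ℝ) ↦
      Real.exp (-p.1) • ((p.2.1 ∘L ContinuousLinearMap.fst ℝ E ℝ).prod
        (ContinuousLinearMap.snd ℝ E ℝ - p.2.2 ∘L ContinuousLinearMap.fst ℝ E ℝ))) =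
      fun p ↦ Real.exp (-p.1) •
        (ContinuousLinearMap.inl ℝ E ℝ ∘L (p.2.1 ∘L ContinuousLinearMap.fst ℝ E ℝ) +
        ContinuousLinearMap.inr ℝ E ℝ ∘L
          (ContinuousLinearMap.snd ℝ E ℝ - p.2.2 ∘L ContinuousLinearMap.fst ℝ E ℝ)) := by
      ext p v <;> simp
    rw [e1]
    fun_prop
  exact h.contMDiff.comp_contMDiffOn ((contMDiffOn_densityLog i j).prodMk_space
    ((contMDiffOn_tangentChange i j).prodMk_space (contMDiffOn_densityLogDeriv i j)))

/-- The projective tractor bundle, as a vector bundle core: the dual of the bundle of `1`-jets of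
densities of weight `1`. -/
noncomputable def tractorCore (E : Type*) [NormedAddCommGroup E] [NormedSpace ℝ E]
    [FiniteDimensional ℝ E] (M : Type*) [TopologicalSpace M] [ChartedSpace E M]
    [IsManifold 𝓘(ℝ, E) ∞ M] : VectorBundleCore ℝ M (E × ℝ) (atlas E M) where
  baseSet i := i.1.source
  isOpen_baseSet i := i.1.open_source
  indexAt := achart E
  mem_baseSet_at := mem_chart_source E
  coordChange := tractorCoordChange
  coordChange_self i x hx v := by
    simp [tractorCoordChange, densityLog_self i x hx, densityLogDeriv_self i x hx,
      tangentChange_self i x hx]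
  continuousOn_coordChange i j := (contMDiffOn_tractorCoordChange i j).continuousOn
  coordChange_comp := by
    rintro i j k x ⟨⟨hi, hj⟩, hk⟩ v
    have h1 : ∀ w, tangentChange j k x (tangentChange i j x w) = tangentChange i k x w := fun w ↦
      (tangentBundleCore 𝓘(ℝ, E) M).coordChange_comp i j k x ⟨⟨hi, hj⟩, hk⟩ w
    simp only [tractorCoordChange, densityLog_comp i j k x hi hj hk,
      densityLogDeriv_comp i j k x hi hj hk, neg_add, Real.exp_add]
    ext
    · simp [h1, smul_smul, mul_comm]
    · simp
      ring

/-- The projective tractor bundle `𝒯`, of rank `n + 2`. -/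
noncomputable abbrev Tractor (E : Type*) [NormedAddCommGroup E] [NormedSpace ℝ E]
    [FiniteDimensional ℝ E] {M : Type*} [TopologicalSpace M] [ChartedSpace E M]
    [IsManifold 𝓘(ℝ, E) ∞ M] : M → Type _ := (tractorCore E M).Fiber

instance : (tractorCore E M).IsContMDiff 𝓘(ℝ, E) ∞ := ⟨contMDiffOn_tractorCoordChange⟩

/-- The transition functions of the tractor bundle are dual to those of the `1`-jets of densities of
weight `1`: if `f`, `f'` represent the same density in the charts `i`, `j`, then the pairing of its
`1`-jet with a tractor at `x` is the same in both charts. -/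
theorem tractorCoordChange_jet (i j : atlas E M) (x : M) (hi : x ∈ i.1.source)
    (hj : x ∈ j.1.source) (f f' : E → ℝ) (hf' : DifferentiableAt ℝ f' (j.1 x))
    (h : ∀ᶠ y in 𝓝 (i.1 x), f' (j.1 (i.1.symm y)) = Real.exp (densityLog i j (i.1.symm y)) * f y)
    (v : E × ℝ) :
    f' (j.1 x) * (tractorCoordChange i j x v).2 +
      fderiv ℝ f' (j.1 x) (tractorCoordChange i j x v).1 =
    f (i.1 x) * v.2 + fderiv ℝ f (i.1 x) v.1 := by
  have hij : i.1 x ∈ i.1.target ∩ i.1.symm ⁻¹' j.1.source :=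
    ⟨i.1.map_source hi, by simpa [i.1.left_inv hi] using hj⟩
  have d1 := (((contDiffOn_densityLog i j).contDiffAt
      ((isOpen_chartOverlap i j).mem_nhds hij)).differentiableAt (by simp)).hasFDerivAt
  have hc : j.1 (i.1.symm (i.1 x)) = j.1 x := by rw [i.1.left_inv hi]
  have d3 := hasFDerivAt_chartChange i j x hi hj
  have hf2 : DifferentiableAt ℝ f' ((fun y : E ↦ j.1 (i.1.symm y)) (i.1 x)) := by
    simpa only [hc] using hf'
  have d4 := hf2.hasFDerivAt.comp (i.1 x) d3
  have key : f =ᶠ[𝓝 (i.1 x)] fun y ↦ Real.exp (-densityLog i j (i.1.symm y)) *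
      (f' ∘ fun y : E ↦ j.1 (i.1.symm y)) y := by
    filter_upwards [h] with y hy
    rw [Function.comp_apply, hy, ← mul_assoc, ← Real.exp_add]; simp
  have d5 := d1.neg.exp.mul d4
  have d6 : fderiv ℝ (fun y ↦ Real.exp (-densityLog i j (i.1.symm y)) *
      (f' ∘ fun y : E ↦ j.1 (i.1.symm y)) y) (i.1 x) = _ := d5.fderiv
  rw [key.fderiv_eq, key.self_of_nhds, d6]
  simp [tractorCoordChange, i.1.left_inv hi, densityLogDeriv]
  ring

end TractorBundle

/-! ### Affine connections, curvature, projective equivalence -/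

section Affine

variable {E : Type*} [NormedAddCommGroup E] [NormedSpace ℝ E] [FiniteDimensional ℝ E]
variable {M : Type*} [TopologicalSpace M] [ChartedSpace E M] [IsManifold 𝓘(ℝ, E) ∞ M]

/-- The tangent space of `M` at `x`. -/
abbrev Tan (E : Type*) [NormedAddCommGroup E] [NormedSpace ℝ E] {M : Type*} [TopologicalSpace M]
    [ChartedSpace E M] (x : M) : Type _ := TangentSpace 𝓘(ℝ, E) x

variable (E M) in
/-- Linear connections on the tangent bundle; `nabla Y x v` is `∇_v Y` at `x`. -/
abbrev Connection : Type _ :=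
  CovariantDerivative 𝓘(ℝ, E) E (TangentSpace 𝓘(ℝ, E) : M → Type _)

/-- The vector field `X` is differentiable at `x`. -/
def DiffFieldAt (X : ∀ x : M, Tan E x) (x : M) : Prop :=
  MDifferentiableAt 𝓘(ℝ, E) (𝓘(ℝ, E).prod 𝓘(ℝ, E))
    (fun y ↦ (TotalSpace.mk' E y (X y) : TangentBundle 𝓘(ℝ, E) M)) x

/-- The vector field `X` is smooth. -/
def SmoothField (X : ∀ x : M, Tan E x) : Prop :=
  ContMDiff 𝓘(ℝ, E) (𝓘(ℝ, E).prod 𝓘(ℝ, E)) ∞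
    (fun y ↦ (TotalSpace.mk' E y (X y) : TangentBundle 𝓘(ℝ, E) M))

/-- A torsion-free affine connection: a smooth connection on `TM` with
`∇_X Y - ∇_Y X = [X, Y]`. -/
structure IsTorsionFreeAffine (nabla : Connection E M) : Prop where
  smooth : CovariantDerivative.ContMDiffCovariantDerivative nabla ∞
  torsion_free : ∀ (X Y : ∀ x : M, Tan E x) (x : M), DiffFieldAt X x → DiffFieldAt Y x →
    nabla Y x (X x) - nabla X x (Y x) = VectorField.mlieBracket 𝓘(ℝ, E) X Y x

/-- The projective class `[∇]` of a torsion-free affine connection: all torsion-free affine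
connections `∇'` for which there is a smooth `1`-form `Υ` such that
`∇'_v Y = ∇_v Y + Υ(v) Y + Υ(Y) v`. -/
def projectiveClass (nabla : Connection E M) : Set (Connection E M) :=
  {nabla' | IsTorsionFreeAffine nabla' ∧ ∃ U : ∀ x : M, Tan E x →ₗ[ℝ] ℝ,
    (∀ Y : ∀ x : M, Tan E x, SmoothField Y →
      ContMDiff 𝓘(ℝ, E) 𝓘(ℝ, ℝ) ∞ (fun x ↦ U x (Y x))) ∧
    ∀ (Y : ∀ x : M, Tan E x) (x : M), DiffFieldAt Y x → ∀ v : Tan E x,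
      nabla' Y x v = nabla Y x v + U x v • Y x + U x (Y x) • v}

/-- `R(X, Y) Z = ∇_X ∇_Y Z - ∇_Y ∇_X Z - ∇_[X,Y] Z` at `x`, for vector fields. -/
noncomputable def curvatureField (nabla : Connection E M) (X Y Z : ∀ x : M, Tan E x) (x : M) :
    Tan E x :=
  nabla (fun y ↦ nabla Z y (Y y)) x (X x) - nabla (fun y ↦ nabla Z y (X y)) x (Y x) -
    nabla Z x (VectorField.mlieBracket 𝓘(ℝ, E) X Y x)

/-- The curvature tensor `R(u, v) w` at `x`, computed with local extensions of the vectors. -/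
noncomputable def curvature (nabla : Connection E M) (x : M) (u v w : Tan E x) : Tan E x :=
  curvatureField nabla (FiberBundle.extend E u) (FiberBundle.extend E v) (FiberBundle.extend E w) x

/-- The Ricci tensor `Ric(v, w)`, the trace of `u ↦ R(u, v) w`. -/
noncomputable def ricci (nabla : Connection E M) (x : M) (v w : Tan E x) : ℝ :=
  letI b : Basis (Fin (finrank ℝ E)) ℝ (Tan E x) := finBasis ℝ E
  ∑ i, b.coord i (curvature nabla x (b i) v w)

/-- The projective Schouten tensor `P(v, w) = ((n + 1) Ric(v, w) + Ric(w, v)) / (n (n + 2))`. -/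
noncomputable def schouten (nabla : Connection E M) (x : M) (v w : Tan E x) : ℝ :=
  ((finrank ℝ E : ℝ) * ricci nabla x v w + ricci nabla x w v) /
    (((finrank ℝ E : ℝ) - 1) * ((finrank ℝ E : ℝ) + 1))

/-- The second covariant derivative `v^a w^b ∇_a ∇_b k` of a vector field `k` at `x`. -/
noncomputable def secondDeriv (nabla : Connection E M) (k : ∀ x : M, Tan E x) (x : M)
    (v w : Tan E x) : Tan E x :=
  nabla (fun y ↦ nabla k y (FiberBundle.extend E w y)) x v -
    nabla k x (nabla (FiberBundle.extend E w) x v)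

end Affine

/-! ### The tractor connection -/

section TractorConnection

variable {E : Type*} [NormedAddCommGroup E] [NormedSpace ℝ E] [FiniteDimensional ℝ E]
variable {M : Type*} [TopologicalSpace M] [ChartedSpace E M] [IsManifold 𝓘(ℝ, E) ∞ M]

/-- The section `s` of the tractor bundle is smooth. -/
def SmoothTractor (s : ∀ x : M, Tractor E x) : Prop :=
  ContMDiff 𝓘(ℝ, E) (𝓘(ℝ, E).prod 𝓘(ℝ, E × ℝ)) ∞
    (fun y ↦ (TotalSpace.mk' (E × ℝ) y (s y) : TotalSpace (E × ℝ) (Tractor E : M → Type _)))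

/-- The connection form at `y` that `∇` induces on `ℰ(1)`, with respect to the coordinate density
of the chart at `x`: `1 / (n + 2)` times the trace of the connection form of `∇` in the coordinate
frame. On `ℰ(w)`, `∇_v σ = dσ(v) + w * densityForm(v) * σ`. -/
noncomputable def densityForm (nabla : Connection E M) (x y : M) : Tan E y →ₗ[ℝ] ℝ :=
  ((finrank ℝ E : ℝ) + 1)⁻¹ • ∑ i,
    (finBasis ℝ E).coord i ∘ₗ
      ((trivializationAt E (TangentSpace 𝓘(ℝ, E)) x).linearMapAt ℝ y) ∘ₗ
        (nabla (fun z ↦ (trivializationAt E (TangentSpace 𝓘(ℝ, E)) x).symm z (finBasis ℝ E i)) y :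
          Tan E y →ₗ[ℝ] Tan E y)

/-- The coordinates `(ν, ρ)` of a tractor section in the chart at `x`. -/
noncomputable def tractorCoord (s : ∀ x : M, Tractor E x) (x y : M) : E × ℝ :=
  (trivializationAt (E × ℝ) (Tractor E : M → Type _) x (TotalSpace.mk' (E × ℝ) y (s y))).2

/-- The projecting part `ν` of a tractor section, a section of `TM ⊗ ℰ(-1)`, as a vector field near
`x`; here `ℰ(-1)` is trivialised by the coordinate density of the chart at `x`. -/
noncomputable def topPart (s : ∀ x : M, Tractor E x) (x y : M) : Tan E y :=
  (trivializationAt E (TangentSpace 𝓘(ℝ, E)) x).symm y (tractorCoord s x y).1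

/-- The component of a tractor section in `ℰ(-1)` in the splitting `𝒯 ≅ (TM ⊗ ℰ(-1)) ⊕ ℰ(-1)` which
is determined by `∇`; here `ℰ(-1)` is trivialised by the coordinate density of the chart at `x`. -/
noncomputable def bottomPart (nabla : Connection E M) (s : ∀ x : M, Tractor E x) (x y : M) : ℝ :=
  (tractorCoord s x y).2 - densityForm nabla x y (topPart s x y)

/-- The normal tractor connection `∇^𝒯_v s` at `x`. In the splitting determined by `∇` it is
`∇^𝒯_v (ν, ρ) = (∇_v ν + ρ v, ∇_v ρ - P(v, ν))`, with `∇` coupled to `ℰ(-1)`. -/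
noncomputable def tractorDeriv (nabla : Connection E M) (s : ∀ x : M, Tractor E x) (x : M)
    (v : Tan E x) : Tractor E x :=
  letI a : Tan E x := nabla (topPart s x) x v - densityForm nabla x x v • topPart s x x
    + bottomPart nabla s x x • v
  letI b : ℝ := mvfderiv 𝓘(ℝ, E) (bottomPart nabla s x) x v
    - densityForm nabla x x v * bottomPart nabla s x x - schouten nabla x v (topPart s x x)
  (trivializationAt (E × ℝ) (Tractor E : M → Type _) x).symm x
    ((trivializationAt E (TangentSpace 𝓘(ℝ, E)) x).linearMapAt ℝ x a, b + densityForm nabla x x a)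

end TractorConnection

/-! ### Metrics and Sasaki-Einstein structures -/

section Metric

/-- The bilinear form `B` on a real vector space has signature `(r, s)`: there is a basis in which
it is diagonal with `r` entries `1` and `s` entries `-1`. -/
def HasSignature {V : Type*} [AddCommGroup V] [Module ℝ V] (B : V → V → ℝ) (r s : ℕ) : Prop :=
  ∃ b : Basis (Fin r ⊕ Fin s) ℝ V, ∀ i j,
    B (b i) (b j) = if i = j then Sum.elim (fun _ ↦ 1) (fun _ ↦ -1) i else 0

/-- A smooth pseudo-Riemannian metric. -/
structure PseudoRiemannianMetric (E : Type*) [NormedAddCommGroup E] [NormedSpace ℝ E]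
    (M : Type*) [TopologicalSpace M] [ChartedSpace E M] [IsManifold 𝓘(ℝ, E) ∞ M] where
  inner : ∀ x : M, Tan E x →L[ℝ] Tan E x →L[ℝ] ℝ
  symm : ∀ (x : M) (v w : Tan E x), inner x v w = inner x w v
  nondegenerate : ∀ (x : M) (v : Tan E x), (∀ w, inner x v w = 0) → v = 0
  smooth : ContMDiff 𝓘(ℝ, E) (𝓘(ℝ, E).prod 𝓘(ℝ, E →L[ℝ] E →L[ℝ] ℝ)) ∞
    (fun x ↦ TotalSpace.mk' (E →L[ℝ] E →L[ℝ] ℝ)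
      (E := fun x : M ↦ Tan E x →L[ℝ] Tan E x →L[ℝ] ℝ) x (inner x))

variable {E : Type*} [NormedAddCommGroup E] [NormedSpace ℝ E] [FiniteDimensional ℝ E]
variable {M : Type*} [TopologicalSpace M] [ChartedSpace E M] [IsManifold 𝓘(ℝ, E) ∞ M]

/-- `∇` is the Levi-Civita connection of `g`: torsion-free, and
`v(g(Y, Z)) = g(∇_v Y, Z) + g(Y, ∇_v Z)`. -/
structure IsLeviCivita (g : PseudoRiemannianMetric E M) (nabla : Connection E M) : Prop extends
    IsTorsionFreeAffine nabla where
  metric : ∀ (Y Z : ∀ x : M, Tan E x) (x : M), DiffFieldAt Y x → DiffFieldAt Z x →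
    ∀ v : Tan E x, mvfderiv 𝓘(ℝ, E) (fun y ↦ g.inner y (Y y) (Z y)) x v =
      g.inner x (nabla Y x v) (Z x) + g.inner x (Y x) (nabla Z x v)

/-- `k` is a Killing field of `g`: it is smooth and the Lie derivative of `g` along `k` vanishes. -/
def IsKilling (g : PseudoRiemannianMetric E M) (k : ∀ x : M, Tan E x) : Prop :=
  SmoothField k ∧ ∀ (Y Z : ∀ x : M, Tan E x) (x : M), DiffFieldAt Y x → DiffFieldAt Z x →
    mvfderiv 𝓘(ℝ, E) (fun y ↦ g.inner y (Y y) (Z y)) x (k x) =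
      g.inner x (VectorField.mlieBracket 𝓘(ℝ, E) k Y x) (Z x) +
      g.inner x (Y x) (VectorField.mlieBracket 𝓘(ℝ, E) k Z x)

/-- `(M, g, k)` is a Sasaki manifold, `∇` being the Levi-Civita connection of `g`: `k` is a Killing
field of unit length and `∇_a ∇_b k^c = - g_ab k^c + δ^c_a k_b`. -/
structure IsSasaki (g : PseudoRiemannianMetric E M) (nabla : Connection E M) (k : ∀ x : M, Tan E x) :
    Prop where
  killing : IsKilling g k
  unit : ∀ x, g.inner x (k x) (k x) = 1
  second_deriv : ∀ (x : M) (v w : Tan E x),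
    secondDeriv nabla k x v w = - g.inner x v w • k x + g.inner x (k x) w • v

/-- `g` is an Einstein metric, `∇` being its Levi-Civita connection. -/
def IsEinstein (g : PseudoRiemannianMetric E M) (nabla : Connection E M) : Prop :=
  ∃ c : ℝ, ∀ (x : M) (v w : Tan E x), ricci nabla x v w = c * g.inner x v w

end Metric

/-! ### Parallel tractor fields and holonomy -/

section Parallel

variable {E : Type*} [NormedAddCommGroup E] [NormedSpace ℝ E] [FiniteDimensional ℝ E]
variable {M : Type*} [TopologicalSpace M] [ChartedSpace E M] [IsManifold 𝓘(ℝ, E) ∞ M]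

/-- The field `J` of endomorphisms of the tractor bundle is smooth. -/
def SmoothEnd (J : ∀ x : M, Tractor E x →ₗ[ℝ] Tractor E x) : Prop :=
  ∀ s : ∀ x : M, Tractor E x, SmoothTractor s → SmoothTractor (fun x ↦ J x (s x))

/-- The field `h` of bilinear forms on the tractor bundle is smooth. -/
def SmoothBilin (h : ∀ x : M, Tractor E x →ₗ[ℝ] Tractor E x →ₗ[ℝ] ℝ) : Prop :=
  ∀ s t : ∀ x : M, Tractor E x, SmoothTractor s → SmoothTractor t →
    ContMDiff 𝓘(ℝ, E) 𝓘(ℝ, ℝ) ∞ (fun x ↦ h x (s x) (t x))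

/-- The field `Ψ` of complex-valued `m`-forms on the tractor bundle is smooth. -/
def SmoothForm {m : ℕ} (Ψ : ∀ x : M, Tractor E x [⋀^Fin m]→ₗ[ℝ] ℂ) : Prop :=
  ∀ s : Fin m → ∀ x : M, Tractor E x, (∀ i, SmoothTractor (s i)) →
    ContMDiff 𝓘(ℝ, E) 𝓘(ℝ, ℂ) ∞ (fun x ↦ Ψ x (fun i ↦ s i x))

/-- `J` is parallel for the tractor connection of `∇`. -/
def ParallelEnd (nabla : Connection E M) (J : ∀ x : M, Tractor E x →ₗ[ℝ] Tractor E x) : Prop :=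
  ∀ s : ∀ x : M, Tractor E x, SmoothTractor s → ∀ (x : M) (v : Tan E x),
    tractorDeriv nabla (fun y ↦ J y (s y)) x v = J x (tractorDeriv nabla s x v)

/-- `h` is parallel for the tractor connection of `∇`. -/
def ParallelBilin (nabla : Connection E M)
    (h : ∀ x : M, Tractor E x →ₗ[ℝ] Tractor E x →ₗ[ℝ] ℝ) : Prop :=
  ∀ s t : ∀ x : M, Tractor E x, SmoothTractor s → SmoothTractor t → ∀ (x : M) (v : Tan E x),
    mvfderiv 𝓘(ℝ, E) (fun y ↦ h y (s y) (t y)) x v =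
      h x (tractorDeriv nabla s x v) (t x) + h x (s x) (tractorDeriv nabla t x v)

/-- `Ψ` is parallel for the tractor connection of `∇`. -/
def ParallelForm (nabla : Connection E M) {m : ℕ}
    (Ψ : ∀ x : M, Tractor E x [⋀^Fin m]→ₗ[ℝ] ℂ) : Prop :=
  ∀ s : Fin m → ∀ x : M, Tractor E x, (∀ i, SmoothTractor (s i)) → ∀ (x : M) (v : Tan E x),
    mvfderiv 𝓘(ℝ, E) (fun y ↦ Ψ y (fun i ↦ s i y)) x v =
      ∑ i, Ψ x (Function.update (fun j ↦ s j x) i (tractorDeriv nabla (s i) x v))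

/-- The complex-valued `m`-form `Ψ` on the real vector space `V` with complex structure `J` is
complex multilinear. -/
def IsComplexForm {V : Type*} [AddCommGroup V] [Module ℝ V] (J : V →ₗ[ℝ] V) {m : ℕ}
    (Ψ : V [⋀^Fin m]→ₗ[ℝ] ℂ) : Prop :=
  ∀ (u : Fin m → V) (i : Fin m), Ψ (Function.update u i (J (u i))) = Complex.I * Ψ u

/-- `(h, J)` is a smooth Hermitian structure of signature `(2p, 2q)` on the tractor bundle: `J` is a
complex structure and `h` is a symmetric bilinear form of signature `(2p, 2q)` with
`h(J·, J·) = h`. -/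
structure IsHermitianStructure (p q : ℕ) (J : ∀ x : M, Tractor E x →ₗ[ℝ] Tractor E x)
    (h : ∀ x : M, Tractor E x →ₗ[ℝ] Tractor E x →ₗ[ℝ] ℝ) : Prop where
  smooth_J : SmoothEnd J
  smooth_h : SmoothBilin h
  J_sq : ∀ (x : M) (u : Tractor E x), J x (J x u) = -u
  symm : ∀ (x : M) (u w : Tractor E x), h x u w = h x w u
  signature : ∀ x : M, HasSignature (fun u w ↦ h x u w) (2 * p) (2 * q)
  hermitian : ∀ (x : M) (u w : Tractor E x), h x (J x u) (J x w) = h x u w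

/-- `Ψ` is a complex volume form on `(𝒯, J)`, where `𝒯` has complex rank `m`: a smooth nowhere
vanishing section of the complex line bundle of complex `m`-forms on `(𝒯, J)`. -/
structure IsComplexVolumeForm (J : ∀ x : M, Tractor E x →ₗ[ℝ] Tractor E x) {m : ℕ}
    (Ψ : ∀ x : M, Tractor E x [⋀^Fin m]→ₗ[ℝ] ℂ) : Prop where
  smooth : SmoothForm Ψ
  complex : ∀ x, IsComplexForm (J x) (Ψ x)
  ne_zero : ∀ x, Ψ x ≠ 0

/-- The curve `c` is continuous on `[0, 1]` and `C¹` on every closed subinterval whose interior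
contains no point of `S`. -/
def PiecewiseC1 (E : Type*) [NormedAddCommGroup E] [NormedSpace ℝ E] {M : Type*}
    [TopologicalSpace M] [ChartedSpace E M] (S : Finset ℝ) (c : ℝ → M) : Prop :=
  ContinuousOn c (Set.Icc 0 1) ∧ ∀ a b : ℝ, 0 ≤ a → a < b → b ≤ 1 → (∀ t ∈ S, t ∉ Set.Ioo a b) →
    ContMDiffOn 𝓘(ℝ, ℝ) 𝓘(ℝ, E) 1 c (Set.Icc a b)

/-- `V` is a parallel section of the tractor bundle along its base curve `c`: in the bundle chart at
`c t`, the derivative of `V` at `t` is `- A(c' t) (V t)`, where `A` is the connection form, so that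
`A(v) u` is the covariant derivative in the direction `v` of the section which is constant equal to
`u` in that bundle chart. This is required at all times in `(0, 1)` outside the finite set `S`, and
`V` is continuous. -/
def IsParallelAlong (nabla : Connection E M) (S : Finset ℝ)
    (V : ℝ → TotalSpace (E × ℝ) (Tractor E : M → Type _)) : Prop :=
  ContinuousOn V (Set.Icc 0 1) ∧ ∀ t ∈ Set.Ioo (0 : ℝ) 1, t ∉ S →
    HasDerivAt (fun r ↦ (trivializationAt (E × ℝ) (Tractor E : M → Type _) (V t).proj (V r)).2)
      (-(trivializationAt (E × ℝ) (Tractor E : M → Type _) (V t).proj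
        (TotalSpace.mk' (E × ℝ) (V t).proj
          (tractorDeriv nabla (FiberBundle.extend (E × ℝ) (V t).2) (V t).proj
            (mfderiv 𝓘(ℝ, ℝ) 𝓘(ℝ, E) (fun r ↦ (V r).proj) t (1 : ℝ))))).2) t

/-- The restricted holonomy group at `x` of the tractor connection of `∇`: the parallel transports
along all null-homotopic piecewise `C¹` loops at `x`. -/
def restrictedHolonomy (nabla : Connection E M) (x : M) :
    Set (Tractor E x →ₗ[ℝ] Tractor E x) :=
  {A | ∃ (c : Path x x) (S : Finset ℝ), c.Homotopic (Path.refl x) ∧ PiecewiseC1 E S c.extend ∧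
    ∀ u : Tractor E x, ∃ V : ℝ → TotalSpace (E × ℝ) (Tractor E : M → Type _),
      (∀ t, (V t).proj = c.extend t) ∧ IsParallelAlong nabla S V ∧
      V 0 = TotalSpace.mk' (E × ℝ) x u ∧ V 1 = TotalSpace.mk' (E × ℝ) x (A u)}

/-- `A` lies in the special unitary group of the vector space `V` with complex structure `J` and
Hermitian form `h`, of complex dimension `m`: it is complex linear, it preserves `h`, and it has
complex determinant `1`, that is, `A` acts as the identity on the complex `m`-forms. -/
structure IsSpecialUnitary {V : Type*} [AddCommGroup V] [Module ℝ V] (m : ℕ) (J : V →ₗ[ℝ] V)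
    (h : V →ₗ[ℝ] V →ₗ[ℝ] ℝ) (A : V →ₗ[ℝ] V) : Prop where
  complex_linear : ∀ u, A (J u) = J (A u)
  unitary : ∀ u w, h (A u) (A w) = h u w
  det_eq_one : ∀ Ψ : V [⋀^Fin m]→ₗ[ℝ] ℂ, IsComplexForm J Ψ →
    ∀ u : Fin m → V, Ψ (fun i ↦ A (u i)) = Ψ u

end Parallel

end ProjTractor

open ProjTractor

set_option synthInstance.maxHeartbeats 200000

/-! Write N = n + 1 for the dimension of M. The metric density |det g|^(-1/(2(N+1))) has weight 1
and is parallel for the Levi-Civita connection ∇, because d log |det g| = 2 tr Γ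
(`hasFDerivAt_gramLog`). It trivialises ℰ(-1), so the splitting of 𝒯 given by ∇ becomes 𝒯 ≅ TM ⊕ ℝ
(`split`). The Ricci identity and the Sasaki equation give R(u,v)k = g(k,v)u - g(k,u)v, hence
Ric(k,k) = N - 1. This fixes the Einstein constant as N - 1, so P = g (`schouten_eq_metric`). The
tractor connection is therefore (X, f) ↦ (∇_v X + f v, v f - g(v,X)), the Levi-Civita connection of
the metric cone over M written along M (`split_tractorDeriv`).

The usual cone structures are now parallel: the metric h = g + f² by metric compatibility, and J(X,
f) = (∇_X k + f k, -g(k,X)) by the Sasaki equation and the skewness of ∇k (`hasFDerivAt_coneH`,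
`fderiv_coneJ`). Differentiating g(k,k) = 1 twice gives the algebra of ∇k which makes J a Hermitian
complex structure (`covField_covField`, `coneJ_mul_self`, `coneH_coneJ`).

The curvature of the cone connection is W(u,v) = R(u,v) minus the curvature of constant curvature 1.
It acts on TM only, satisfies the Bianchi identity and has no Ricci trace. Since J is parallel it
commutes with the curvature. The standard argument that Ricci-flat Kähler curvature lies in su then
shows that both the trace of W(u,v) and the trace of its composition with J vanish
(`trace_comp_curvature_eq_zero`). The induced connection on the line bundle of complex volume forms
is thus flat, and it has local parallel sections: in a gauge which makes J constant, the complex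
trace of the connection form is closed, a primitive f exists on a ball, and exp f times the complex
determinant is parallel (`exists_parallel_volume`).

Two local parallel volume forms differ by a locally constant factor, so they form a covering of M
with fibre ℂˣ (`VolumeAtlas.core`). If M is simply connected the identity lifts to a global section.
A null-homotopic loop lifts to a closed loop in any case, and this gives complex determinant 1 for
parallel transport around it. Preservation of h and J follows from their being parallel
(`VolumeAtlas.isSpecialUnitary`).

All of this is proved for the Levi-Civita connection. The other members of the projective class have
the same tractor connection, because the changes of the splitting, of the density connection and of
the Schouten tensor cancel (`tractorDeriv_projective`). -/

namespace ProjTractor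

/-! ### Curvature of connection forms on a vector space -/

section ConnectionForms

variable {E : Type*} [NormedAddCommGroup E] [NormedSpace ℝ E]
variable {F : Type*} [NormedAddCommGroup F] [NormedSpace ℝ F]
variable {R : Type*} [NormedRing R] [NormedAlgebra ℝ R]

/-- The curvature `dA + A ∧ A` of the connection form `A` with values in the algebra `R`. -/
noncomputable def connCurv (A : E → E →L[ℝ] R) (z u v : E) : R :=
  fderiv ℝ A z u v - fderiv ℝ A z v u + A z u * A z v - A z v * A z u

theorem connCurv_swap (A : E → E →L[ℝ] R) (z u v : E) :
    connCurv A z v u = -connCurv A z u v := by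
  simp only [connCurv]; abel

theorem hasFDerivAt_clm_apply_const {G : Type*} [NormedAddCommGroup G] [NormedSpace ℝ G]
    {A : E → F →L[ℝ] G} {z : E} (hA : DifferentiableAt ℝ A z) (v : F) :
    HasFDerivAt (fun y ↦ A y v) ((fderiv ℝ A z).flip v) z := by
  simpa using hA.hasFDerivAt.clm_apply (hasFDerivAt_const v z)

theorem fderiv_clm_apply_const {G : Type*} [NormedAddCommGroup G] [NormedSpace ℝ G]
    {A : E → F →L[ℝ] G} {z : E} (hA : DifferentiableAt ℝ A z) (u : E) (v : F) :
    fderiv ℝ A z u v = fderiv ℝ (fun y ↦ A y v) z u := by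
  rw [(hasFDerivAt_clm_apply_const hA v).fderiv, ContinuousLinearMap.flip_apply]

theorem fderiv_clm_apply_const₂ {G H : Type*} [NormedAddCommGroup G] [NormedSpace ℝ G]
    [NormedAddCommGroup H] [NormedSpace ℝ H]
    {A : E → F →L[ℝ] G →L[ℝ] H} {z : E} (hA : DifferentiableAt ℝ A z) (u : E) (v : F) (w : G) :
    fderiv ℝ A z u v w = fderiv ℝ (fun y ↦ A y v w) z u := by
  rw [fderiv_clm_apply_const hA, fderiv_clm_apply_const (hA.clm_apply (differentiableAt_const v))]

/-- A parallel field `J` commutes with the curvature. -/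
theorem connCurv_comm_of_parallel {A : E → E →L[ℝ] R} {J : E → R} {z : E}
    (hA : DifferentiableAt ℝ A z) (hJ : ContDiffAt ℝ 2 J z)
    (hd : ∀ᶠ y in 𝓝 z, ∀ v, fderiv ℝ J y v = J y * A y v - A y v * J y) (u v : E) :
    J z * connCurv A z u v = connCurv A z u v * J z := by
  have hJ1 : DifferentiableAt ℝ J z := hJ.differentiableAt (by simp)
  have hJ2 : DifferentiableAt ℝ (fderiv ℝ J) z :=
    (hJ.fderiv_right (m := 1) (by norm_num)).differentiableAt (by simp)
  have hsymm := (hJ.isSymmSndFDerivAt (by simp)).eq u v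
  -- The equation dJ = [J, A] is differentiated once more. Symmetry of the second derivative of J
  -- then leaves [J, dA + A ∧ A] = 0.
  have key : ∀ u v, fderiv ℝ (fderiv ℝ J) z u v = fderiv ℝ J z u * A z v + J z * fderiv ℝ A z u v
      - fderiv ℝ A z u v * J z - A z v * fderiv ℝ J z u := by
    intro u v
    have hAv := hasFDerivAt_clm_apply_const hA v
    have h1 := (hJ1.hasFDerivAt.mul' hAv).sub (hAv.mul' hJ1.hasFDerivAt)
    have h2 : (fun y ↦ fderiv ℝ J y v) =ᶠ[𝓝 z] fun y ↦ J y * A y v - A y v * J y := by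
      filter_upwards [hd] with y hy using hy v
    rw [fderiv_clm_apply_const hJ2, h2.fderiv_eq]
    refine (congrArg (fun L : E →L[ℝ] R ↦ L u) h1.fderiv).trans ?_
    simp
    abel
  rw [key u v, key v u] at hsymm
  simp only [hd.self_of_nhds] at hsymm
  rw [connCurv, ← sub_eq_zero]
  rw [← sub_eq_zero] at hsymm
  rw [← hsymm]
  noncomm_ring

end ConnectionForms

/-! ### Gauge transformations making a parallel complex structure constant -/

section ComplexGauge

variable {E : Type*} [NormedAddCommGroup E] [NormedSpace ℝ E]
variable {R : Type*} [NormedRing R] [NormedAlgebra ℝ R]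

/-- The connection form of `d + A` after the gauge transformation `L`. -/
noncomputable def gaugeForm (A : E → E →L[ℝ] R) (L : E → R) (z : E) : E →L[ℝ] R :=
  ((ContinuousLinearMap.mul ℝ R).flip (Ring.inverse (L z))) ∘L
    ((ContinuousLinearMap.mul ℝ R (L z)) ∘L A z - fderiv ℝ L z)

theorem gaugeForm_apply (A : E → E →L[ℝ] R) (L : E → R) (z u : E) :
    gaugeForm A L z u = (L z * A z u - fderiv ℝ L z u) * Ring.inverse (L z) := by
  simp [gaugeForm, sub_mul]

theorem contDiffOn_gaugeForm [CompleteSpace R] {A : E → E →L[ℝ] R} {L : E → R} {B : Set E}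
    (hB : IsOpen B) (hA : ContDiffOn ℝ ∞ A B) (hL : ContDiffOn ℝ ∞ L B)
    (hu : ∀ z ∈ B, IsUnit (L z)) : ContDiffOn ℝ ∞ (gaugeForm A L) B := by
  have h1 : ContDiffOn ℝ ∞ (fun z ↦ Ring.inverse (L z)) B := fun z hz ↦ by
    obtain ⟨x, hx⟩ := hu z hz
    exact ContDiffAt.comp_contDiffWithinAt z (hx ▸ contDiffAt_ringInverse ℝ x) (hL z hz)
  have h2 : ContDiffOn ℝ ∞ (fderiv ℝ L) B := hL.fderiv_of_isOpen hB (by simp)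
  have h3 : ContDiffOn ℝ ∞ (fun z ↦ (ContinuousLinearMap.mul ℝ R).flip (Ring.inverse (L z))) B :=
    ((ContinuousLinearMap.mul ℝ R).flip).contDiff.comp_contDiffOn h1
  have h4 : ContDiffOn ℝ ∞ (fun z ↦ ContinuousLinearMap.mul ℝ R (L z)) B :=
    (ContinuousLinearMap.mul ℝ R).contDiff.comp_contDiffOn hL
  exact h3.clm_comp ((h4.clm_comp hA).sub h2)

set_option synthInstance.maxHeartbeats 200000 in
-- Curvature is gauge covariant. The second derivative of L enters symmetrically and drops out; the
-- terms in dL cancel against those of the quadratic part.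
theorem connCurv_gaugeForm [CompleteSpace R] {A : E → E →L[ℝ] R} {L : E → R} {z : E}
    (hA : DifferentiableAt ℝ A z) (hL : ContDiffAt ℝ 2 L z) (hu : IsUnit (L z)) (u v : E) :
    connCurv (gaugeForm A L) z u v = L z * connCurv A z u v * Ring.inverse (L z) := by
  have hL1 : DifferentiableAt ℝ L z := hL.differentiableAt (by simp)
  have hL2 : DifferentiableAt ℝ (fderiv ℝ L) z :=
    (hL.fderiv_right (m := 1) (by norm_num)).differentiableAt (by simp)
  have hsymm := (hL.isSymmSndFDerivAt (by simp)).eq u v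
  obtain ⟨x, hx⟩ := hu
  have hP : HasFDerivAt (fun y ↦ Ring.inverse (L y))
      (-ContinuousLinearMap.mulLeftRight ℝ R ↑x⁻¹ ↑x⁻¹ ∘L fderiv ℝ L z) z :=
    (hx ▸ hasFDerivAt_ringInverse (𝕜 := ℝ) x).comp z hL1.hasFDerivAt
  have hPz : Ring.inverse (L z) = ↑x⁻¹ := by rw [← hx, Ring.inverse_unit]
  have hθ : DifferentiableAt ℝ (gaugeForm A L) z := by
    have h3 : DifferentiableAt ℝ
        (fun z ↦ (ContinuousLinearMap.mul ℝ R).flip (Ring.inverse (L z))) z :=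
      ((ContinuousLinearMap.mul ℝ R).flip).differentiableAt.comp z hP.differentiableAt
    have h4 : DifferentiableAt ℝ (fun z ↦ ContinuousLinearMap.mul ℝ R (L z)) z :=
      (ContinuousLinearMap.mul ℝ R).differentiableAt.comp z hL1
    exact h3.clm_comp ((h4.clm_comp hA).sub hL2)
  have key : ∀ u v, fderiv ℝ (gaugeForm A L) z u v =
      (fderiv ℝ L z u * A z v + L z * fderiv ℝ A z u v - fderiv ℝ (fderiv ℝ L) z u v) * ↑x⁻¹ -
      (L z * A z v - fderiv ℝ L z v) * (↑x⁻¹ * fderiv ℝ L z u * ↑x⁻¹) := by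
    intro u v
    rw [fderiv_clm_apply_const hθ]
    simp only [gaugeForm_apply]
    have hAv := hasFDerivAt_clm_apply_const hA v
    have hLv := hasFDerivAt_clm_apply_const hL2 v
    have h1 := ((hL1.hasFDerivAt.mul' hAv).sub hLv).mul' hP
    refine (congrArg (fun L : E →L[ℝ] R ↦ L u) h1.fderiv).trans ?_
    simp [hPz]
    noncomm_ring
  simp only [connCurv, key, gaugeForm_apply, hPz, ← hsymm]
  have e : (↑x⁻¹ : R) * L z = 1 := by rw [← hx]; simp
  have e' : ∀ a : R, (↑x⁻¹ : R) * (L z * a) = a := fun a ↦ by rw [← mul_assoc, e, one_mul]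
  simp only [sub_mul, add_mul, mul_sub, mul_add, mul_assoc, e']
  abel

/-- The complex trace of an endomorphism which commutes with the complex structure `J₀`,
expressed by the real trace `tr`. -/
noncomputable def complexTrace (tr : R →L[ℝ] ℝ) (J₀ : R) : R →L[ℝ] ℂ :=
  (2⁻¹ : ℝ) • (Complex.ofRealCLM ∘L tr -
    ((ContinuousLinearMap.mul ℝ ℂ Complex.I) ∘L Complex.ofRealCLM ∘L tr) ∘L
      ContinuousLinearMap.mul ℝ R J₀)

theorem complexTrace_apply (tr : R →L[ℝ] ℝ) (J₀ T : R) :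
    complexTrace tr J₀ T = (2⁻¹ : ℝ) • ((tr T : ℂ) - Complex.I * (tr (J₀ * T) : ℂ)) := by
  simp [complexTrace]

/-- The complex trace is only a combination of real traces, so cyclicity has to move J₀ past one
factor. It is enough that T commutes with J₀; S is arbitrary. -/
theorem complexTrace_mul_comm {tr : R →L[ℝ] ℝ} (htr : ∀ a b, tr (a * b) = tr (b * a)) {J₀ T : R}
    (hT : J₀ * T = T * J₀) (S : R) :
    complexTrace tr J₀ (T * S) = complexTrace tr J₀ (S * T) := by
  rw [complexTrace_apply, complexTrace_apply, htr T S, ← mul_assoc, hT, mul_assoc, htr T,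
    ← mul_assoc]

/-- The gauge transformation `(1 - J₀ J) / 2` takes the complex structure `J` to `J₀`. -/
noncomputable def complexGauge (J₀ : R) (J : E → R) (z : E) : R := (2⁻¹ : ℝ) • (1 - J₀ * J z)

/-- Both sides equal (J + J₀)/2. -/
theorem complexGauge_mul {J₀ : R} {J : E → R} (h₀ : J₀ * J₀ = -1) {z : E} (h : J z * J z = -1) :
    complexGauge J₀ J z * J z = J₀ * complexGauge J₀ J z := by
  simp only [complexGauge, smul_mul_assoc, mul_smul_comm, sub_mul, mul_sub, mul_assoc, h]
  rw [← mul_assoc J₀ J₀, h₀]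
  congr 1
  noncomm_ring

/-- In the new gauge the parallel structure J becomes the constant J₀, and a constant endomorphism
is parallel only if it commutes with the connection form. The computation differentiates L J = J₀ L
and inserts dJ = [J, A]. -/
theorem gaugeForm_complexGauge_comm {A : E → E →L[ℝ] R} {J₀ : R} {J : E → R}
    (h₀ : J₀ * J₀ = -1) {z : E} (hJ : DifferentiableAt ℝ J z) (h : ∀ᶠ y in 𝓝 z, J y * J y = -1)
    (hd : ∀ v, fderiv ℝ J z v = J z * A z v - A z v * J z)
    (hu : IsUnit (complexGauge J₀ J z)) (u : E) :
    J₀ * gaugeForm A (complexGauge J₀ J) z u = gaugeForm A (complexGauge J₀ J) z u * J₀ := by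
  have hL : DifferentiableAt ℝ (complexGauge J₀ J) z := by
    unfold complexGauge
    exact ((differentiableAt_const _).sub (hJ.const_mul J₀)).const_smul (2⁻¹ : ℝ)
  have e1 := complexGauge_mul (J := J) h₀ h.self_of_nhds
  have e2 : fderiv ℝ (complexGauge J₀ J) z u * J z + complexGauge J₀ J z * fderiv ℝ J z u =
      J₀ * fderiv ℝ (complexGauge J₀ J) z u := by
    have h1 : (fun y ↦ complexGauge J₀ J y * J y) =ᶠ[𝓝 z] fun y ↦ J₀ * complexGauge J₀ J y := by
      filter_upwards [h] with y hy using complexGauge_mul h₀ hy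
    have h2 := h1.fderiv_eq (𝕜 := ℝ)
    have h3 := (hL.hasFDerivAt.mul' hJ.hasFDerivAt).fderiv
    have h4 := ((ContinuousLinearMap.mul ℝ R J₀).hasFDerivAt.comp z hL.hasFDerivAt).fderiv
    have h5 := congrArg (fun T : E →L[ℝ] R ↦ T u) (h3.symm.trans (h2.trans h4))
    simp at h5
    rw [← h5]; abel
  obtain ⟨x, hx⟩ := hu
  have hPz : Ring.inverse (complexGauge J₀ J z) = ↑x⁻¹ := by rw [← hx, Ring.inverse_unit]
  have e3 : (↑x⁻¹ : R) * J₀ = J z * ↑x⁻¹ := by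
    rw [← hx] at e1
    rw [← mul_one ((↑x⁻¹ : R) * J₀), ← x.mul_inv, mul_assoc, ← mul_assoc J₀, ← e1, mul_assoc,
      ← mul_assoc (↑x⁻¹ : R), x.inv_mul, one_mul]
  rw [gaugeForm_apply, hPz, mul_assoc, e3, ← mul_assoc, ← mul_assoc]
  congr 1
  rw [hd] at e2
  rw [mul_sub, ← e2, ← mul_assoc, ← e1]
  noncomm_ring

/-- If `J` is a parallel complex structure and the curvature has vanishing complex trace, then the
complex trace of the connection form in a complex gauge is locally exact. -/
theorem exists_primitive_complexTrace [CompleteSpace R] {A : E → E →L[ℝ] R} {J : E → R}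
    {B : Set E} (hB : IsOpen B) {z₀ : E} (hz₀ : z₀ ∈ B) (hA : ContDiffOn ℝ ∞ A B)
    (hJ : ContDiffOn ℝ ∞ J B) (hJJ : ∀ z ∈ B, J z * J z = -1)
    (hd : ∀ z ∈ B, ∀ v, fderiv ℝ J z v = J z * A z v - A z v * J z)
    {tr : R →L[ℝ] ℝ} (htr : ∀ a b, tr (a * b) = tr (b * a))
    (h1 : ∀ z ∈ B, ∀ u v, tr (connCurv A z u v) = 0)
    (h2 : ∀ z ∈ B, ∀ u v, tr (J z * connCurv A z u v) = 0) :
    ∃ B' ⊆ B, IsOpen B' ∧ z₀ ∈ B' ∧ (∀ z ∈ B', IsUnit (complexGauge (J z₀) J z)) ∧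
      ∃ f : E → ℂ, ContDiffOn ℝ ∞ f B' ∧ ∀ z ∈ B', ∀ u, fderiv ℝ f z u =
        complexTrace tr (J z₀) (gaugeForm A (complexGauge (J z₀) J) z u) := by
  set J₀ := J z₀
  set L := complexGauge J₀ J
  have h₀ : J₀ * J₀ = -1 := hJJ z₀ hz₀
  have hL : ContDiffOn ℝ ∞ L B := by
    unfold L complexGauge
    exact ((contDiffOn_const).sub (contDiffOn_const.mul hJ)).const_smul (2⁻¹ : ℝ)
  -- The gauge is the identity at z₀, where J = J₀, and so it is invertible nearby. The smaller set
  -- is taken to be a ball because the Poincaré lemma needs convexity.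
  have hL0 : IsUnit (L z₀) := by
    have : L z₀ = 1 := by
      simp only [L, complexGauge]
      rw [show J z₀ = J₀ from rfl, h₀, sub_neg_eq_add, ← two_smul ℝ (1 : R), smul_smul]; norm_num
    rw [this]; exact isUnit_one
  have hev : ∀ᶠ z in 𝓝 z₀, z ∈ B ∧ IsUnit (L z) :=
    (hB.eventually_mem hz₀).and
      ((hL.continuousOn.continuousAt (hB.mem_nhds hz₀)).eventually (Units.isOpen.mem_nhds hL0))
  obtain ⟨r, hr, hball⟩ := Metric.eventually_nhds_iff_ball.1 hev
  have hsub : Metric.ball z₀ r ⊆ B := fun z hz ↦ (hball z hz).1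
  have hun : ∀ z ∈ Metric.ball z₀ r, IsUnit (L z) := fun z hz ↦ (hball z hz).2
  have hθ : ContDiffOn ℝ ∞ (gaugeForm A L) (Metric.ball z₀ r) :=
    contDiffOn_gaugeForm Metric.isOpen_ball (hA.mono hsub) (hL.mono hsub) hun
  set τ : E → E →L[ℝ] ℂ := fun z ↦ complexTrace tr J₀ ∘L gaugeForm A L z
  have hτ : ContDiffOn ℝ ∞ τ (Metric.ball z₀ r) := contDiffOn_const.clm_comp hθ
  have hτsymm : ∀ z ∈ Metric.ball z₀ r, ∀ u v, fderiv ℝ τ z u v = fderiv ℝ τ z v u := by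
    intro z hz u v
    have hzB := hB.mem_nhds (hsub hz)
    have hθz : DifferentiableAt ℝ (gaugeForm A L) z :=
      (hθ.contDiffAt (Metric.isOpen_ball.mem_nhds hz)).differentiableAt (by simp)
    have e : ∀ u v, fderiv ℝ τ z u v = complexTrace tr J₀ (fderiv ℝ (gaugeForm A L) z u v) := by
      intro u v
      rw [fderiv_clm_apply_const ((hτ.contDiffAt (Metric.isOpen_ball.mem_nhds hz)).differentiableAt
        (by simp))]
      have := (complexTrace tr J₀).hasFDerivAt.comp z (hasFDerivAt_clm_apply_const hθz v)
      refine (congrArg (fun T : E →L[ℝ] ℂ ↦ T u) this.fderiv).trans ?_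
      simp
    have hcurv := connCurv_gaugeForm (A := A) (L := L)
      ((hA.contDiffAt hzB).differentiableAt (by simp))
      ((hL.contDiffAt hzB).of_le ENat.LEInfty.out) (hun z hz) u v
    have hJz : DifferentiableAt ℝ J z := (hJ.contDiffAt hzB).differentiableAt (by simp)
    have hJn : ∀ᶠ y in 𝓝 z, J y * J y = -1 := by filter_upwards [hzB] with y hy using hJJ y hy
    have hcomm := gaugeForm_complexGauge_comm h₀ hJz hJn (hd z (hsub hz)) (hun z hz)
    have hinv : Ring.inverse (L z) * L z = 1 := Ring.inverse_mul_cancel _ (hun z hz)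
    rw [e u v, e v u, ← sub_eq_zero, ← map_sub]
    have e3 : fderiv ℝ (gaugeForm A L) z u v - fderiv ℝ (gaugeForm A L) z v u =
        L z * connCurv A z u v * Ring.inverse (L z) -
        (gaugeForm A L z u * gaugeForm A L z v - gaugeForm A L z v * gaugeForm A L z u) := by
      rw [← hcurv, connCurv]; abel
    -- The commutator has no complex trace because the gauge form commutes with J₀. By cyclicity and
    -- J₀ L = L J, the complex trace of L F L⁻¹ is (tr F - i tr(J F))/2, which vanishes by
    -- hypothesis.
    rw [e3, map_sub, map_sub, complexTrace_mul_comm htr (hcomm u), sub_self, sub_zero,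
      complexTrace_apply, htr, ← mul_assoc, hinv, one_mul, h1 z (hsub hz), ← mul_assoc,
      ← mul_assoc, ← complexGauge_mul h₀ (hJJ z (hsub hz)), htr]
    rw [← mul_assoc, ← mul_assoc, hinv, one_mul, h2 z (hsub hz)]
    simp
  obtain ⟨f, hf⟩ := (convex_ball z₀ r).exists_forall_hasFDerivAt_of_fderiv_symmetric
    Metric.isOpen_ball (hτ.differentiableOn (by simp)) hτsymm
  refine ⟨Metric.ball z₀ r, hsub, Metric.isOpen_ball, Metric.mem_ball_self hr, hun, f, ?_, ?_⟩
  · rw [contDiffOn_infty_iff_fderiv_of_isOpen Metric.isOpen_ball]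
    exact ⟨fun z hz ↦ (hf z hz).differentiableAt.differentiableWithinAt,
      hτ.congr fun z hz ↦ (hf z hz).fderiv⟩
  · intro z hz u
    rw [(hf z hz).fderiv]; rfl

end ComplexGauge

/-! ### Complex determinants on a real vector space with a complex structure -/

section ComplexVolume

/-- This is the derivative of det at X in the direction X N. By Cramer's rule the j-th summand is
the j-th diagonal entry of X N adj(X), and adj(X) X = det(X) under the trace. It serves both the
complex volume forms and the Gram determinant of the metric. -/
theorem sum_det_updateRow_mul {m : ℕ} {K : Type*} [CommRing K] (X N : Matrix (Fin m) (Fin m) K) :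
    ∑ j, (X.updateRow j ((X * N) j)).det = N.trace * X.det := by
  have h : ∀ j, (X.updateRow j ((X * N) j)).det = (X * N * X.adjugate) j j := by
    intro j
    rw [← Matrix.cramer_transpose_apply, Matrix.cramer_eq_adjugate_mulVec,
      ← Matrix.adjugate_transpose, Matrix.mulVec_transpose]
    rfl
  simp only [h]
  change (X * N * X.adjugate).trace = _
  rw [Matrix.trace_mul_comm, ← mul_assoc, Matrix.adjugate_mul, Matrix.smul_mul, one_mul,
    Matrix.trace_smul, smul_eq_mul, mul_comm]

variable {F : Type*} [AddCommGroup F] [Module ℝ F]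

/-- A complex structure on a real vector space of dimension `2 m` identifies it with `ℂᵐ`. -/
theorem exists_complex_coordinates {m : ℕ} (J : F →ₗ[ℝ] F) (hJ : ∀ x, J (J x) = -x)
    (hF : finrank ℝ F = 2 * m) [FiniteDimensional ℝ F] :
    ∃ e : F ≃ₗ[ℝ] (Fin m → ℂ), ∀ x, e (J x) = Complex.I • e x := by
  let φ : ℂ →ₐ[ℝ] Module.End ℝ F := Complex.lift ⟨J, by ext x; simp [hJ]⟩
  let : Module ℂ F := Module.compHom F φ.toRingHom
  have hsm : ∀ (c : ℂ) (x : F), c • x = φ c x := fun _ _ ↦ rfl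
  have : IsScalarTower ℝ ℂ F := ⟨fun r c x ↦ by simp [hsm]⟩
  have : FiniteDimensional ℂ F := FiniteDimensional.right ℝ ℂ F
  have h1 : finrank ℂ F = m := by
    have := finrank_mul_finrank ℝ ℂ F
    rw [Complex.finrank_real_complex, hF] at this
    omega
  let e : F ≃ₗ[ℂ] (Fin m → ℂ) := LinearEquiv.ofFinrankEq _ _ (by simp [h1])
  refine ⟨e.restrictScalars ℝ, fun x ↦ ?_⟩
  have h2 : J x = Complex.I • x := by simp [hsm, φ]
  rw [h2]
  exact e.map_smul Complex.I x

theorem complex_linear_of_comm {m : ℕ} (J : F →ₗ[ℝ] F) (e : F →ₗ[ℝ] (Fin m → ℂ))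
    (he : ∀ x, e (J x) = Complex.I • e x) (c : ℂ) (x : F) :
    e (c.re • x + c.im • J x) = c • e x := by
  rw [map_add, map_smul, map_smul, he]
  ext j
  simp only [Pi.add_apply, Pi.smul_apply, smul_eq_mul, Complex.real_smul]
  conv_rhs => rw [← Complex.re_add_im c]
  ring

/-- The complex determinant on `ℂᵐ`, as a real alternating form. -/
noncomputable def complexDet (m : ℕ) : (Fin m → ℂ) [⋀^Fin m]→ₗ[ℝ] ℂ :=
  { (Matrix.detRowAlternating (R := ℂ) (n := Fin m)).toMultilinearMap.restrictScalars ℝ with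
    map_eq_zero_of_eq' := (Matrix.detRowAlternating (R := ℂ) (n := Fin m)).map_eq_zero_of_eq' }

theorem complexDet_apply {m : ℕ} (w : Fin m → Fin m → ℂ) :
    complexDet m w = (Matrix.of w).det := rfl

theorem complexDet_update_smul {m : ℕ} (w : Fin m → Fin m → ℂ) (i : Fin m) (c : ℂ)
    (x : Fin m → ℂ) :
    complexDet m (Function.update w i (c • x)) = c * complexDet m (Function.update w i x) :=
  (Matrix.detRowAlternating (R := ℂ) (n := Fin m)).map_update_smul w i c x

/-- In the real basis e_j, i e_j, a complex diagonal entry t contributes Re t twice. -/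
theorem trace_real_of_complex {m : ℕ} (T : (Fin m → ℂ) →ₗ[ℂ] (Fin m → ℂ)) :
    LinearMap.trace ℝ _ (T.restrictScalars ℝ) = 2 * (∑ j, T (Pi.single j 1) j).re := by
  let b := Pi.basis (fun _ : Fin m ↦ Complex.basisOneI)
  rw [LinearMap.trace_eq_matrix_trace ℝ b, Matrix.trace, Fintype.sum_sigma, Complex.re_sum,
    Finset.mul_sum]
  refine Finset.sum_congr rfl fun j _ ↦ ?_
  have hI : T (Pi.single j Complex.I) = Complex.I • T (Pi.single j 1) := by
    rw [← map_smul, ← Pi.single_smul, smul_eq_mul, mul_one]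
  simp [LinearMap.toMatrix_apply, b, hI]
  ring

/-- If `T` commutes with `J`, then the derivation which `T` induces on complex volume forms is the
multiplication by the complex trace of `T`. -/
theorem sum_complexDet_update {m : ℕ} (J T : F →ₗ[ℝ] F) (e : F ≃ₗ[ℝ] (Fin m → ℂ))
    (he : ∀ x, e (J x) = Complex.I • e x) (hT : ∀ x, J (T x) = T (J x)) (w : Fin m → F) :
    ∑ j, complexDet m (Function.update (fun i ↦ e (w i)) j (e (T (w j)))) =
      (2⁻¹ : ℝ) • ((LinearMap.trace ℝ F T : ℂ) - Complex.I * (LinearMap.trace ℝ F (J ∘ₗ T) : ℂ)) *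
        complexDet m (fun i ↦ e (w i)) := by
  -- Since T commutes with J, its coordinate expression is complex linear and has a complex matrix.
  -- The formula then reduces to the derivative of the complex determinant.
  let T' : (Fin m → ℂ) →ₗ[ℂ] (Fin m → ℂ) :=
    { toFun := fun x ↦ e (T (e.symm x))
      map_add' := by simp
      map_smul' := fun c x ↦ by
        have h1 : e.symm (c • x) = c.re • e.symm x + c.im • J (e.symm x) := by
          apply e.injective
          have := complex_linear_of_comm J (e : F →ₗ[ℝ] (Fin m → ℂ)) he c (e.symm x)
          simpa using this.symm
        have := complex_linear_of_comm J (e : F →ₗ[ℝ] (Fin m → ℂ)) he c (T (e.symm x))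
        simp only [LinearEquiv.coe_coe] at this
        rw [h1, map_add, map_smul, map_smul, ← hT, this]
        rfl }
  have hT' : ∀ x, e (T x) = T' (e x) := fun x ↦ by simp [T']
  have t1 : LinearMap.trace ℝ F T = 2 * (∑ j, T' (Pi.single j 1) j).re := by
    rw [← trace_real_of_complex, ← LinearMap.trace_conj' T e]
    rfl
  have t2 : LinearMap.trace ℝ F (J ∘ₗ T) =
      2 * (∑ j, (Complex.I • T') (Pi.single j 1) j).re := by
    rw [← trace_real_of_complex, ← LinearMap.trace_conj' (J ∘ₗ T) e]
    congr 1
    refine LinearMap.ext fun x ↦ ?_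
    simp [T', LinearEquiv.conj_apply, he]
  let N : Matrix (Fin m) (Fin m) ℂ := Matrix.of fun k ↦ T' (Pi.single k 1)
  have hN : ∀ x : Fin m → ℂ, T' x = Matrix.vecMul x N := by
    intro x
    conv_lhs => rw [← Finset.univ_sum_single x, map_sum]
    ext j
    simp only [Finset.sum_apply, Matrix.vecMul, dotProduct, N, Matrix.of_apply]
    refine Finset.sum_congr rfl fun k _ ↦ ?_
    have : (Pi.single k (x k) : Fin m → ℂ) = x k • Pi.single k 1 := by
      rw [← Pi.single_smul, smul_eq_mul, mul_one]
    rw [this, map_smul]; rfl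
  have hd := sum_det_updateRow_mul (Matrix.of fun i ↦ e (w i)) N
  have htr : (2⁻¹ : ℝ) • ((LinearMap.trace ℝ F T : ℂ) -
      Complex.I * (LinearMap.trace ℝ F (J ∘ₗ T) : ℂ)) = N.trace := by
    rw [t1, t2]
    have : N.trace = ∑ j, T' (Pi.single j 1) j := rfl
    rw [this]
    simp only [LinearMap.smul_apply, Pi.smul_apply, ← Finset.smul_sum]
    generalize ∑ j, T' (Pi.single j 1) j = s
    apply Complex.ext <;> simp
  rw [htr, complexDet_apply, ← hd]
  refine Finset.sum_congr rfl fun j _ ↦ ?_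
  rw [complexDet_apply, hT', hN]
  rfl

/-- The complex volume form given by the complex coordinates `e`. -/
noncomputable def coordVolume {m : ℕ} (e : F →ₗ[ℝ] (Fin m → ℂ)) : F [⋀^Fin m]→ₗ[ℝ] ℂ :=
  (complexDet m).compLinearMap e

theorem coordVolume_apply {m : ℕ} (e : F →ₗ[ℝ] (Fin m → ℂ)) (w : Fin m → F) :
    coordVolume e w = complexDet m (fun i ↦ e (w i)) := rfl

theorem isComplexForm_coordVolume {m : ℕ} (J : F →ₗ[ℝ] F) (e : F →ₗ[ℝ] (Fin m → ℂ))
    (he : ∀ x, e (J x) = Complex.I • e x) : IsComplexForm J (coordVolume e) := by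
  intro u i
  have h : ∀ x, (fun j ↦ e (Function.update u i x j)) =
      Function.update (fun j ↦ e (u j)) i (e x) := fun x ↦ by
    ext j : 1
    by_cases hj : j = i
    · subst hj; simp
    · simp [hj]
  rw [coordVolume_apply, h, he, complexDet_update_smul, Function.update_eq_self i fun j ↦ e (u j)]
  rfl

/-- A complex form of top degree is a multiple of the volume form given by complex coordinates. -/
theorem IsComplexForm.eq_coordVolume {m : ℕ} {J : F →ₗ[ℝ] F} {Ψ : F [⋀^Fin m]→ₗ[ℝ] ℂ}
    (hΨ : IsComplexForm J Ψ) (e : F ≃ₗ[ℝ] (Fin m → ℂ)) (he : ∀ x, e (J x) = Complex.I • e x) :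
    Ψ = Ψ (fun i ↦ e.symm (Pi.single i 1)) • coordVolume (e : F →ₗ[ℝ] (Fin m → ℂ)) := by
  have hes : ∀ (c : ℂ) (x : Fin m → ℂ),
      e.symm (c • x) = c.re • e.symm x + c.im • J (e.symm x) := fun c x ↦ by
    apply e.injective
    have := complex_linear_of_comm J (e : F →ₗ[ℝ] (Fin m → ℂ)) he c (e.symm x)
    simpa using this.symm
  have hu : ∀ (w : Fin m → Fin m → ℂ) (i : Fin m) (x : Fin m → ℂ),
      (fun j ↦ e.symm (Function.update w i x j)) =
        Function.update (fun j ↦ e.symm (w j)) i (e.symm x) := fun w i x ↦ by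
    ext j : 1
    by_cases hj : j = i
    · subst hj; simp
    · simp [hj]
  -- In complex coordinates Ψ is alternating over ℂ, and such a form of top degree is a multiple of
  -- the determinant.
  let Ψ' : (Fin m → ℂ) [⋀^Fin m]→ₗ[ℂ] ℂ :=
    { toFun := fun w ↦ Ψ (fun i ↦ e.symm (w i))
      map_update_add' := fun {inst} w i x y ↦ by
        obtain rfl : inst = instDecidableEqFin m := Subsingleton.elim _ _
        rw [hu, hu, hu, map_add, Ψ.map_update_add]
      map_update_smul' := fun {inst} w i c x ↦ by
        obtain rfl : inst = instDecidableEqFin m := Subsingleton.elim _ _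
        have h1 := hΨ (Function.update (fun j ↦ e.symm (w j)) i (e.symm x)) i
        simp only [Function.update_self, Function.update_idem] at h1
        rw [hu, hu, hes, Ψ.map_update_add, Ψ.map_update_smul, Ψ.map_update_smul, h1]
        simp only [Complex.real_smul, smul_eq_mul]
        conv_rhs => rw [← Complex.re_add_im c]
        ring
      map_eq_zero_of_eq' := fun w i j h hij ↦ Ψ.map_eq_zero_of_eq _ (by simp [h]) hij }
  ext w
  have h1 := congrArg (fun f : (Fin m → ℂ) [⋀^Fin m]→ₗ[ℂ] ℂ ↦ f (fun i ↦ e (w i)))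
    (Ψ'.eq_smul_basis_det (Pi.basisFun ℂ (Fin m)))
  simp only [AlternatingMap.smul_apply] at h1
  have h2 : Ψ' (fun i ↦ e (w i)) = Ψ w := by simp [Ψ']
  have h3 : Ψ' (Pi.basisFun ℂ (Fin m)) = Ψ (fun i ↦ e.symm (Pi.single i 1)) := by simp [Ψ']
  rw [h2, h3] at h1
  rw [h1, AlternatingMap.smul_apply, coordVolume_apply, Pi.basisFun_det]
  rfl

theorem coordVolume_ne_zero {m : ℕ} (e : F ≃ₗ[ℝ] (Fin m → ℂ)) :
    coordVolume (e : F →ₗ[ℝ] (Fin m → ℂ)) (fun i ↦ e.symm (Pi.single i 1)) = 1 := by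
  rw [coordVolume_apply]
  simp only [LinearEquiv.coe_coe, LinearEquiv.apply_symm_apply, complexDet_apply]
  rw [← Matrix.det_one (n := Fin m) (R := ℂ)]
  congr 1
  ext i j
  simp [Matrix.one_apply, Pi.single_apply, eq_comm]

/-- Two complex forms of top degree are proportional. -/
theorem IsComplexForm.exists_smul {m : ℕ} {J : F →ₗ[ℝ] F} (hJ : ∀ x, J (J x) = -x)
    [FiniteDimensional ℝ F] (hF : finrank ℝ F = 2 * m) {Ψ Ψ' : F [⋀^Fin m]→ₗ[ℝ] ℂ}
    (hΨ : IsComplexForm J Ψ) (hΨ' : IsComplexForm J Ψ') (h : Ψ' ≠ 0) : ∃ c : ℂ, Ψ = c • Ψ' := by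
  obtain ⟨e, he⟩ := exists_complex_coordinates J hJ hF
  have h1 := hΨ.eq_coordVolume e he
  have h2 := hΨ'.eq_coordVolume e he
  set a := Ψ (fun i ↦ e.symm (Pi.single i 1))
  set b := Ψ' (fun i ↦ e.symm (Pi.single i 1))
  have hb : b ≠ 0 := fun hb ↦ h (by rw [h2, hb, zero_smul])
  exact ⟨a / b, by rw [h1, h2, smul_smul, div_mul_cancel₀ a hb]⟩

end ComplexVolume

/-! ### Local parallel complex volume forms -/

section ParallelVolume

theorem hasFDerivAt_of_contDiffOn {E F : Type*} [NormedAddCommGroup E] [NormedSpace ℝ E]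
    [NormedAddCommGroup F] [NormedSpace ℝ F] {f : E → F} {B : Set E} (hB : IsOpen B)
    (hf : ContDiffOn ℝ ∞ f B) {z : E} (hz : z ∈ B) : HasFDerivAt f (fderiv ℝ f z) z :=
  ((hf.contDiffAt (hB.mem_nhds hz)).differentiableAt (by simp)).hasFDerivAt

variable {E : Type*} [NormedAddCommGroup E] [NormedSpace ℝ E]
variable {F : Type*} [NormedAddCommGroup F] [NormedSpace ℝ F] [FiniteDimensional ℝ F]

/-- The complex determinant as a continuous real multilinear map. -/
noncomputable def complexDetCLM (m : ℕ) :
    ContinuousMultilinearMap ℝ (fun _ : Fin m ↦ (Fin m → ℂ)) ℂ :=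
  ⟨(complexDet m).toMultilinearMap,
    (continuous_id.matrix_det : Continuous fun X : Matrix (Fin m) (Fin m) ℂ ↦ X.det)⟩

theorem complexDetCLM_apply {m : ℕ} (w : Fin m → Fin m → ℂ) :
    complexDetCLM m w = complexDet m w := rfl

/-- The real trace as a continuous linear functional. -/
noncomputable def traceCLM (F : Type*) [NormedAddCommGroup F] [NormedSpace ℝ F]
    [FiniteDimensional ℝ F] : (F →L[ℝ] F) →L[ℝ] ℝ :=
  LinearMap.toContinuousLinearMap
    (LinearMap.trace ℝ F ∘ₗ (ContinuousLinearMap.coeLM ℝ : (F →L[ℝ] F) →ₗ[ℝ] (F →ₗ[ℝ] F)))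

theorem traceCLM_apply (T : F →L[ℝ] F) : traceCLM F T = LinearMap.trace ℝ F T := rfl

theorem traceCLM_mul_comm (S T : F →L[ℝ] F) : traceCLM F (S * T) = traceCLM F (T * S) :=
  LinearMap.trace_mul_comm ℝ (S : F →ₗ[ℝ] F) (T : F →ₗ[ℝ] F)

/-- A form field `ψ` of degree `m` on the trivial bundle with fibre `F` is parallel on `B` for the
connection `d + A`. -/
structure IsParallelOn (A : E → E →L[ℝ] F →L[ℝ] F) {m : ℕ} (ψ : E → F [⋀^Fin m]→ₗ[ℝ] ℂ)
    (B : Set E) : Prop where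
  smooth : ContDiffOn ℝ ∞ (fun p : E × (Fin m → F) ↦ ψ p.1 p.2) (B ×ˢ Set.univ)
  parallel : ∀ z ∈ B, ∀ (s : Fin m → F) (u : E) (s' : Fin m → F),
    fderiv ℝ (fun p : E × (Fin m → F) ↦ ψ p.1 p.2) (z, s) (u, s') =
      ∑ j, ψ z (Function.update s j (s' j + A z u (s j)))

/-- If `J` is a parallel complex structure and the curvature has vanishing complex trace, then there
are local parallel complex volume forms. -/
theorem exists_parallel_volume {m : ℕ} (hF : finrank ℝ F = 2 * m)
    {A : E → E →L[ℝ] F →L[ℝ] F}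
    {J : E → F →L[ℝ] F} {B : Set E} (hB : IsOpen B) {z₀ : E} (hz₀ : z₀ ∈ B)
    (hA : ContDiffOn ℝ ∞ A B) (hJ : ContDiffOn ℝ ∞ J B) (hJJ : ∀ z ∈ B, J z * J z = -1)
    (hd : ∀ z ∈ B, ∀ v, fderiv ℝ J z v = J z * A z v - A z v * J z)
    (h1 : ∀ z ∈ B, ∀ u v, traceCLM F (connCurv A z u v) = 0)
    (h2 : ∀ z ∈ B, ∀ u v, traceCLM F (J z * connCurv A z u v) = 0) :
    ∃ B' ⊆ B, IsOpen B' ∧ z₀ ∈ B' ∧ ∃ ψ : E → F [⋀^Fin m]→ₗ[ℝ] ℂ, IsParallelOn A ψ B' ∧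
      ∀ z ∈ B', IsComplexForm (J z : F →ₗ[ℝ] F) (ψ z) ∧ ψ z ≠ 0 := by
  have : CompleteSpace F := FiniteDimensional.complete ℝ F
  obtain ⟨B', hBB', hB', hz₀', hL, f, hf, hdf⟩ := exists_primitive_complexTrace hB hz₀ hA hJ hJJ hd
    traceCLM_mul_comm h1 h2
  set J₀ := J z₀
  have h₀ : J₀ * J₀ = -1 := hJJ z₀ hz₀
  set L := complexGauge J₀ J
  have hLs : ContDiffOn ℝ ∞ L B' := by
    unfold L complexGauge
    exact ((contDiffOn_const).sub (contDiffOn_const.mul (hJ.mono hBB'))).const_smul (2⁻¹ : ℝ)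
  obtain ⟨e₀, he₀⟩ := exists_complex_coordinates (m := m) (J₀ : F →ₗ[ℝ] F)
    (fun x ↦ congrArg (fun T : F →L[ℝ] F ↦ T x) h₀) hF
  let e₁ : F →L[ℝ] (Fin m → ℂ) := LinearMap.toContinuousLinearMap (e₀ : F →ₗ[ℝ] (Fin m → ℂ))
  let c : E → F →ₗ[ℝ] (Fin m → ℂ) := fun z ↦ (e₀ : F →ₗ[ℝ] (Fin m → ℂ)) ∘ₗ (L z : F →ₗ[ℝ] F)
  have hc : ∀ z x, c z x = e₁ (L z x) := fun _ _ ↦ rfl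
  -- The gauge L turns J into J₀, so the fixed complex determinant composed with L is complex for J.
  -- In this gauge its covariant derivative is minus the complex trace of the gauge form, and the
  -- factor exp f compensates for that.
  let ψ : E → F [⋀^Fin m]→ₗ[ℝ] ℂ := fun z ↦ Complex.exp (f z) • coordVolume (c z)
  have hψ : ∀ z s, ψ z s = Complex.exp (f z) * complexDetCLM m (fun i ↦ e₁ (L z (s i))) :=
    fun _ _ ↦ rfl
  refine ⟨B', hBB', hB', hz₀', ψ, ⟨?_, ?_⟩, ?_⟩
  · simp only [hψ]
    have hp : Set.MapsTo (Prod.fst : E × (Fin m → F) → E) (B' ×ˢ Set.univ) B' := fun p hp ↦ hp.1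
    refine ContDiffOn.mul ((hf.comp contDiffOn_fst hp).cexp) ?_
    refine (complexDetCLM m).contDiff.comp_contDiffOn (contDiffOn_pi.2 fun j ↦ ?_)
    refine e₁.contDiff.comp_contDiffOn ?_
    exact (hLs.comp contDiffOn_fst hp).clm_apply
      ((ContinuousLinearMap.proj (R := ℝ) (φ := fun _ : Fin m ↦ F) j).contDiff.comp
        contDiff_snd).contDiffOn
  · intro z hz s u s'
    simp only [hψ]
    have d1 : HasFDerivAt (fun p : E × (Fin m → F) ↦ f p.1) _ (z, s) :=
      (hasFDerivAt_of_contDiffOn hB' hf hz : HasFDerivAt f _ (z, s).1).comp (z, s) hasFDerivAt_fst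
    have d2 : HasFDerivAt (fun p : E × (Fin m → F) ↦ L p.1) _ (z, s) :=
      (hasFDerivAt_of_contDiffOn hB' hLs hz : HasFDerivAt L _ (z, s).1).comp (z, s) hasFDerivAt_fst
    have d3 : ∀ j, HasFDerivAt (fun p : E × (Fin m → F) ↦ p.2 j)
        (ContinuousLinearMap.proj (R := ℝ) (φ := fun _ : Fin m ↦ F) j ∘L
          ContinuousLinearMap.snd ℝ E (Fin m → F)) (z, s) := fun j ↦
      ((ContinuousLinearMap.proj (R := ℝ) (φ := fun _ : Fin m ↦ F) j) ∘L
          ContinuousLinearMap.snd ℝ E (Fin m → F)).hasFDerivAt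
    have d4 := hasFDerivAt_pi.2 fun j ↦ e₁.hasFDerivAt.comp (z, s) (d2.clm_apply (d3 j))
    have d5 := d1.cexp.mul
      (HasFDerivAt.comp (z, s) ((complexDetCLM m).hasFDerivAt (fun i ↦ e₁ (L z (s i)))) d4)
    refine (congrArg (fun T : (E × (Fin m → F)) →L[ℝ] ℂ ↦ T (u, s')) d5.fderiv).trans ?_
    have hθc : ∀ x, J₀ (gaugeForm A L z u x) = gaugeForm A L z u (J₀ x) := by
      have hzB := hB.mem_nhds (hBB' hz)
      have := gaugeForm_complexGauge_comm (A := A) h₀ ((hJ.contDiffAt hzB).differentiableAt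
        (by simp)) (by filter_upwards [hzB] with y hy using hJJ y hy) (hd z (hBB' hz)) (hL z hz) u
      exact fun x ↦ congrArg (fun T : F →L[ℝ] F ↦ T x) this
    have key := sum_complexDet_update (J₀ : F →ₗ[ℝ] F) (gaugeForm A L z u : F →ₗ[ℝ] F) e₀ he₀ hθc
      (fun i ↦ L z (s i))
    have hθL : ∀ x, gaugeForm A L z u (L z x) = L z (A z u x) - fderiv ℝ L z u x := by
      intro x
      have h3 := Ring.inverse_mul_cancel _ (hL z hz)
      have h4 : gaugeForm A L z u * L z = L z * A z u - fderiv ℝ L z u := by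
        rw [gaugeForm_apply, mul_assoc, h3, mul_one]
      exact congrArg (fun T : F →L[ℝ] F ↦ T x) h4
    have hdfz : fderiv ℝ f z u = (2⁻¹ : ℝ) • ((LinearMap.trace ℝ F (gaugeForm A L z u) : ℂ) -
        Complex.I * (LinearMap.trace ℝ F ((J₀ : F →ₗ[ℝ] F) ∘ₗ
          (gaugeForm A L z u : F →ₗ[ℝ] F)) : ℂ)) := by
      rw [hdf z hz u, complexTrace_apply]; rfl
    have hupd : ∀ (x : F) (j : Fin m), (fun i ↦ e₁ (L z (Function.update s j x i))) =
        Function.update (fun i ↦ e₁ (L z (s i))) j (e₁ (L z x)) := fun x j ↦ by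
      ext i : 1
      by_cases hij : i = j
      · subst hij; simp
      · simp [hij]
    rw [← hdfz] at key
    -- With θ the gauge form, df is the complex trace of θ, and θ L = L A - dL. Hence the derivative
    -- of exp f accounts exactly for the difference between the terms in dL, which differentiation
    -- produces, and the terms in L A, which parallelism requires.
    have key' : fderiv ℝ f z u * complexDet m (fun i ↦ e₁ (L z (s i))) =
        ∑ j, (complexDet m (Function.update (fun i ↦ e₁ (L z (s i))) j (e₁ (L z (A z u (s j))))) -
          complexDet m (Function.update (fun i ↦ e₁ (L z (s i))) j (e₁ (fderiv ℝ L z u (s j))))) :=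
        key.symm.trans (Finset.sum_congr rfl fun j _ ↦ by
      rw [ContinuousLinearMap.coe_coe, hθL, map_sub, AlternatingMap.map_update_sub]; rfl)
    simp only [hupd, complexDetCLM_apply, map_add, AlternatingMap.map_update_add]
    simp [ContinuousMultilinearMap.linearDeriv_apply, complexDetCLM_apply]
    rw [← Finset.mul_sum, mul_comm (complexDet m _), mul_assoc, ← mul_add, key',
      ← Finset.sum_add_distrib]
    congr 1
    refine Finset.sum_congr rfl fun j _ ↦ ?_
    ring
  · intro z hz
    have hJc : ∀ x, c z (J z x) = Complex.I • c z x := fun x ↦ by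
      have := congrArg (fun T : F →L[ℝ] F ↦ T x) (complexGauge_mul (J := J) h₀ (hJJ z (hBB' hz)))
      change e₀ (L z (J z x)) = _
      rw [show L z (J z x) = J₀ (L z x) from this]
      exact he₀ _
    refine ⟨fun w i ↦ ?_, ?_⟩
    · have := isComplexForm_coordVolume (J z : F →ₗ[ℝ] F) (c z) hJc w i
      simp only [ψ, AlternatingMap.smul_apply, this, smul_eq_mul]
      ring
    · obtain ⟨x, hx⟩ := hL z hz
      have hinv : ∀ y, L z ((↑x⁻¹ : F →L[ℝ] F) y) = y := fun y ↦ by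
        rw [← hx]
        exact congrArg (fun T : F →L[ℝ] F ↦ T y) x.mul_inv
      intro h0
      have h3 : coordVolume (c z) (fun i ↦ (↑x⁻¹ : F →L[ℝ] F) (e₀.symm (Pi.single i 1))) = 1 := by
        refine Eq.trans ?_ (coordVolume_ne_zero e₀)
        rw [coordVolume_apply, coordVolume_apply]
        congr 1
        ext i : 1
        rw [hc, hinv]; rfl
      have h4 := congrArg (fun Ψ : F [⋀^Fin m]→ₗ[ℝ] ℂ ↦
        Ψ (fun i ↦ (↑x⁻¹ : F →L[ℝ] F) (e₀.symm (Pi.single i 1)))) h0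
      simp only [ψ, AlternatingMap.smul_apply, h3] at h4
      simp at h4

end ParallelVolume

/-! ### The cone connection of a Sasaki–Einstein structure in coordinates -/

section SasakiChart

variable {E : Type*} [NormedAddCommGroup E] [NormedSpace ℝ E]

/-- The covariant derivative, with Christoffel symbols `Γ`, of the vector field `k`. -/
noncomputable def covField (Γ : E → E →L[ℝ] E →L[ℝ] E) (k : E → E) (z : E) : E →L[ℝ] E :=
  fderiv ℝ k z + (Γ z).flip (k z)

theorem covField_apply (Γ : E → E →L[ℝ] E →L[ℝ] E) (k : E → E) (z u : E) :
    covField Γ k z u = fderiv ℝ k z u + Γ z u (k z) := rfl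

section Bilinear

variable {R : Type*} [NormedRing R] [NormedAlgebra ℝ R] (A : E → E →L[ℝ] R) (z : E)

theorem connCurv_add_left (u u' v : E) :
    connCurv A z (u + u') v = connCurv A z u v + connCurv A z u' v := by
  simp [connCurv, add_mul, mul_add]; abel

theorem connCurv_smul_left (c : ℝ) (u v : E) :
    connCurv A z (c • u) v = c • connCurv A z u v := by
  simp [connCurv, smul_sub, smul_add]

theorem connCurv_add_right (u v v' : E) :
    connCurv A z u (v + v') = connCurv A z u v + connCurv A z u v' := by
  simp [connCurv, add_mul, mul_add]; abel

theorem connCurv_smul_right (c : ℝ) (u v : E) :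
    connCurv A z u (c • v) = c • connCurv A z u v := by
  simp [connCurv, smul_sub, smul_add]

end Bilinear

theorem fderiv_covField {Γ : E → E →L[ℝ] E →L[ℝ] E} {k : E → E} {z : E}
    (hΓ : DifferentiableAt ℝ Γ z) (hk : ContDiffAt ℝ 2 k z) :
    DifferentiableAt ℝ (covField Γ k) z ∧ ∀ u v, fderiv ℝ (covField Γ k) z u v =
      fderiv ℝ (fderiv ℝ k) z u v + fderiv ℝ Γ z u v (k z) + Γ z v (fderiv ℝ k z u) := by
  have hk2 : DifferentiableAt ℝ (fderiv ℝ k) z :=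
    (hk.fderiv_right (m := 1) (by norm_num)).differentiableAt one_ne_zero
  have hk1 := (hk.differentiableAt (by simp)).hasFDerivAt
  have hd : DifferentiableAt ℝ (covField Γ k) z :=
    hk2.add (((ContinuousLinearMap.flipₗᵢ ℝ E E E).differentiableAt.comp z hΓ).clm_apply
      hk1.differentiableAt)
  refine ⟨hd, fun u v ↦ ?_⟩
  rw [fderiv_clm_apply_const hd]
  simp only [covField_apply]
  have d1 := (hasFDerivAt_clm_apply_const hk2 v).add
    ((hasFDerivAt_clm_apply_const hΓ v).clm_apply hk1)
  refine (congrArg (fun T : E →L[ℝ] E ↦ T u) d1.fderiv).trans ?_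
  simp
  abel

/-- The Ricci identity for a vector field. -/
theorem covField_curvature {Γ : E → E →L[ℝ] E →L[ℝ] E} {k : E → E} {z : E}
    (hΓ : DifferentiableAt ℝ Γ z) (hk : ContDiffAt ℝ 2 k z) (u v : E) :
    fderiv ℝ (covField Γ k) z u v + Γ z u (covField Γ k z v) -
      (fderiv ℝ (covField Γ k) z v u + Γ z v (covField Γ k z u)) = connCurv Γ z u v (k z) := by
  have hsymm := (hk.isSymmSndFDerivAt (by simp)).eq u v
  rw [(fderiv_covField hΓ hk).2, (fderiv_covField hΓ hk).2, ← hsymm]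
  simp only [connCurv, covField_apply, map_add, sub_apply, add_apply, mul_apply_eq_comp]
  abel

/-- The curvature of the Christoffel symbols `Γ` at `z`, as a trilinear map. -/
noncomputable def curvLM (Γ : E → E →L[ℝ] E →L[ℝ] E) (z : E) : E →ₗ[ℝ] E →ₗ[ℝ] E →ₗ[ℝ] E :=
  LinearMap.mk₂ ℝ (fun u v ↦ ((connCurv Γ z u v : E →L[ℝ] E) : E →ₗ[ℝ] E))
    (fun u u' v ↦ by rw [connCurv_add_left]; rfl)
    (fun c u v ↦ by rw [connCurv_smul_left]; rfl)
    (fun u v v' ↦ by rw [connCurv_add_right]; rfl)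
    (fun c u v ↦ by rw [connCurv_smul_right]; rfl)

theorem curvLM_apply (Γ : E → E →L[ℝ] E →L[ℝ] E) (z u v w : E) :
    curvLM Γ z u v w = connCurv Γ z u v w := rfl

/-- The Ricci tensor of the Christoffel symbols `Γ`. -/
noncomputable def ricciLM (Γ : E → E →L[ℝ] E →L[ℝ] E) (z v w : E) : ℝ :=
  LinearMap.trace ℝ E (((curvLM Γ z).flip v).flip w)

/-- The connection form `(ν, ρ) ↦ (Γ(u) ν + ρ u, - G(u, ν))` of the tractor connection of an
Einstein metric `G`. -/
noncomputable def coneForm (Γ : E → E →L[ℝ] E →L[ℝ] E) (G : E → E →L[ℝ] E →L[ℝ] ℝ) (z : E) :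
    E →L[ℝ] (E × ℝ) →L[ℝ] (E × ℝ) :=
  (ContinuousLinearMap.compL ℝ (E × ℝ) E (E × ℝ) (ContinuousLinearMap.inl ℝ E ℝ)) ∘L
      (((ContinuousLinearMap.compL ℝ (E × ℝ) E E).flip (ContinuousLinearMap.fst ℝ E ℝ)) ∘L Γ z +
        ContinuousLinearMap.smulRightL ℝ (E × ℝ) E (ContinuousLinearMap.snd ℝ E ℝ)) -
    (ContinuousLinearMap.compL ℝ (E × ℝ) ℝ (E × ℝ) (ContinuousLinearMap.inr ℝ E ℝ)) ∘L
      ((ContinuousLinearMap.compL ℝ (E × ℝ) E ℝ).flip (ContinuousLinearMap.fst ℝ E ℝ)) ∘L G z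

theorem coneForm_apply (Γ : E → E →L[ℝ] E →L[ℝ] E) (G : E → E →L[ℝ] E →L[ℝ] ℝ) (z u : E)
    (x : E × ℝ) : coneForm Γ G z u x = (Γ z u x.1 + x.2 • u, -G z u x.1) := by
  ext <;> simp [coneForm]

/-- The complex structure `(ν, ρ) ↦ (K ν + ρ k, - G(k, ν))`. -/
noncomputable def coneJ (Γ : E → E →L[ℝ] E →L[ℝ] E) (G : E → E →L[ℝ] E →L[ℝ] ℝ) (k : E → E)
    (z : E) : (E × ℝ) →L[ℝ] (E × ℝ) :=
  ContinuousLinearMap.inl ℝ E ℝ ∘L (covField Γ k z ∘L ContinuousLinearMap.fst ℝ E ℝ +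
      (ContinuousLinearMap.smulRightL ℝ (E × ℝ) E (ContinuousLinearMap.snd ℝ E ℝ)) (k z)) -
    ContinuousLinearMap.inr ℝ E ℝ ∘L G z (k z) ∘L ContinuousLinearMap.fst ℝ E ℝ

theorem coneJ_apply (Γ : E → E →L[ℝ] E →L[ℝ] E) (G : E → E →L[ℝ] E →L[ℝ] ℝ) (k : E → E) (z : E)
    (x : E × ℝ) : coneJ Γ G k z x = (covField Γ k z x.1 + x.2 • k z, -G z (k z) x.1) := by
  ext <;> simp [coneJ]

/-- The metric `G + ρ²`. -/
noncomputable def coneH (G : E → E →L[ℝ] E →L[ℝ] ℝ) (z : E) (x y : E × ℝ) : ℝ :=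
  G z x.1 y.1 + x.2 * y.2

/-- The coordinate expression of a Sasaki–Einstein structure on an open set `B`. -/
structure SasakiChart (B : Set E) (Γ : E → E →L[ℝ] E →L[ℝ] E) (G : E → E →L[ℝ] E →L[ℝ] ℝ)
    (k : E → E) : Prop where
  isOpen : IsOpen B
  smooth_Γ : ContDiffOn ℝ ∞ Γ B
  smooth_G : ContDiffOn ℝ ∞ G B
  smooth_k : ContDiffOn ℝ ∞ k B
  symm_Γ : ∀ z ∈ B, ∀ u v, Γ z u v = Γ z v u
  symm_G : ∀ z ∈ B, ∀ u v, G z u v = G z v u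
  nondegenerate : ∀ z ∈ B, ∀ v, (∀ w, G z v w = 0) → v = 0
  metric : ∀ z ∈ B, ∀ u v w, fderiv ℝ G z u v w = G z (Γ z u v) w + G z v (Γ z u w)
  skew : ∀ z ∈ B, ∀ v w, G z (covField Γ k z v) w + G z v (covField Γ k z w) = 0
  unit : ∀ z ∈ B, G z (k z) (k z) = 1
  second_deriv : ∀ z ∈ B, ∀ u w, fderiv ℝ (covField Γ k) z u w + Γ z u (covField Γ k z w) -
    covField Γ k z (Γ z u w) = -G z u w • k z + G z (k z) w • u
  einstein : ∀ z ∈ B, ∃ c : ℝ, ∀ v w, ricciLM Γ z v w = c * G z v w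

namespace SasakiChart

variable {B : Set E} {Γ : E → E →L[ℝ] E →L[ℝ] E} {G : E → E →L[ℝ] E →L[ℝ] ℝ} {k : E → E}

theorem smooth_covField (h : SasakiChart B Γ G k) : ContDiffOn ℝ ∞ (covField Γ k) B := by
  have h1 : ContDiffOn ℝ ∞ (fderiv ℝ k) B := h.smooth_k.fderiv_of_isOpen h.isOpen (by simp)
  have h2 : ContDiffOn ℝ ∞ (fun z ↦ (Γ z).flip) B :=
    (ContinuousLinearMap.flipₗᵢ ℝ E E E).contDiff.comp_contDiffOn h.smooth_Γ
  exact h1.add (h2.clm_apply h.smooth_k)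

theorem smooth_coneForm (h : SasakiChart B Γ G k) : ContDiffOn ℝ ∞ (coneForm Γ G) B := by
  unfold coneForm
  exact (contDiffOn_const.clm_comp ((contDiffOn_const.clm_comp h.smooth_Γ).add
    contDiffOn_const)).sub (contDiffOn_const.clm_comp (contDiffOn_const.clm_comp h.smooth_G))

theorem smooth_coneJ (h : SasakiChart B Γ G k) : ContDiffOn ℝ ∞ (coneJ Γ G k) B := by
  unfold coneJ
  exact (contDiffOn_const.clm_comp ((h.smooth_covField.clm_comp contDiffOn_const).add
    ((ContinuousLinearMap.contDiff _).comp_contDiffOn h.smooth_k))).sub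
    (contDiffOn_const.clm_comp ((h.smooth_G.clm_apply h.smooth_k).clm_comp contDiffOn_const))

theorem hasFDerivAt_Γ (h : SasakiChart B Γ G k) {z : E} (hz : z ∈ B) :
    HasFDerivAt Γ (fderiv ℝ Γ z) z := hasFDerivAt_of_contDiffOn h.isOpen h.smooth_Γ hz

theorem hasFDerivAt_G (h : SasakiChart B Γ G k) {z : E} (hz : z ∈ B) :
    HasFDerivAt G (fderiv ℝ G z) z := hasFDerivAt_of_contDiffOn h.isOpen h.smooth_G hz

theorem hasFDerivAt_k (h : SasakiChart B Γ G k) {z : E} (hz : z ∈ B) :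
    HasFDerivAt k (fderiv ℝ k z) z := hasFDerivAt_of_contDiffOn h.isOpen h.smooth_k hz

theorem hasFDerivAt_covField (h : SasakiChart B Γ G k) {z : E} (hz : z ∈ B) :
    HasFDerivAt (covField Γ k) (fderiv ℝ (covField Γ k) z) z :=
  hasFDerivAt_of_contDiffOn h.isOpen h.smooth_covField hz

/-- Metric compatibility, for vector fields along a parameter space. -/
theorem hasFDerivAt_G_apply (h : SasakiChart B Γ G k) {z : E} (hz : z ∈ B)
    {P : Type*} [NormedAddCommGroup P] [NormedSpace ℝ P] {c : P → E} {c' : P →L[ℝ] E} {p : P}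
    (hcp : c p = z) (hc : HasFDerivAt c c' p) {X Y : P → E} {X' Y' : P →L[ℝ] E}
    (hX : HasFDerivAt X X' p) (hY : HasFDerivAt Y Y' p) :
    HasFDerivAt (fun p ↦ G (c p) (X p) (Y p))
      (G z (X p) ∘L (Y' + (Γ z).flip (Y p) ∘L c') +
        (G z).flip (Y p) ∘L (X' + (Γ z).flip (X p) ∘L c')) p := by
  subst hcp
  have h0 : HasFDerivAt (fun p ↦ G (c p)) (fderiv ℝ G (c p) ∘L c') p :=
    HasFDerivAt.comp (g := G) (f := c) p (h.hasFDerivAt_G hz) hc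
  have h1 := (h0.clm_apply hX).clm_apply hY
  refine h1.congr_fderiv (ContinuousLinearMap.ext fun u ↦ ?_)
  change G (c p) (X p) (Y' u) + (G (c p) (X' u) + fderiv ℝ G (c p) (c' u) (X p)) (Y p) =
    G (c p) (X p) (Y' u + Γ (c p) (c' u) (Y p)) + G (c p) (X' u + Γ (c p) (c' u) (X p)) (Y p)
  rw [map_add, map_add, add_apply, add_apply, h.metric _ hz]
  ring

theorem fderiv_const_eq {f : E → ℝ} {f' : E →L[ℝ] ℝ} (hB : IsOpen B) {a : ℝ}
    (hf : ∀ z ∈ B, f z = a) {z : E} (hz : z ∈ B) (h' : HasFDerivAt f f' z) : f' = 0 := by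
  have h1 : f =ᶠ[𝓝 z] fun _ ↦ a := by
    filter_upwards [hB.mem_nhds hz] with y hy using hf y hy
  exact h'.unique ((hasFDerivAt_const a z).congr_of_eventuallyEq h1)

/-- The derivative of g(k,k) = 1. -/
theorem G_k_covField (h : SasakiChart B Γ G k) {z : E} (hz : z ∈ B) (u : E) :
    G z (k z) (covField Γ k z u) = 0 := by
  have h1 := fderiv_const_eq h.isOpen h.unit hz
    (h.hasFDerivAt_G_apply hz rfl (hasFDerivAt_id z) (h.hasFDerivAt_k hz) (h.hasFDerivAt_k hz))
  have h2 := congrArg (fun T : E →L[ℝ] ℝ ↦ T u) h1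
  simp only [ContinuousLinearMap.comp_id, add_apply,
    ContinuousLinearMap.comp_apply, ContinuousLinearMap.flip_apply,
    zero_apply] at h2
  rw [h.symm_G z hz _ (k z)] at h2
  rw [covField_apply]
  linarith

/-- Skewness of ∇k moves the previous identity to the other slot, and g is nondegenerate. -/
theorem covField_k (h : SasakiChart B Γ G k) {z : E} (hz : z ∈ B) :
    covField Γ k z (k z) = 0 := by
  refine h.nondegenerate z hz _ fun w ↦ ?_
  have := h.skew z hz (k z) w
  rw [h.G_k_covField hz] at this
  linarith

/-- The derivative of g(k, ∇_w k) = 0 in the direction u, with the second derivative of k replaced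
through the Sasaki equation. -/
theorem G_covField_covField (h : SasakiChart B Γ G k) {z : E} (hz : z ∈ B) (u w : E) :
    G z (covField Γ k z u) (covField Γ k z w) = G z u w - G z (k z) u * G z (k z) w := by
  have h1 := fderiv_const_eq h.isOpen (fun y hy ↦ h.G_k_covField hy w) hz
    (h.hasFDerivAt_G_apply hz rfl (hasFDerivAt_id z) (h.hasFDerivAt_k hz)
      ((h.hasFDerivAt_covField hz).clm_apply (hasFDerivAt_const w z)))
  have h2 := congrArg (fun T : E →L[ℝ] ℝ ↦ T u) h1
  have h3 := h.second_deriv z hz u w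
  have h4 := congrArg (G z (k z)) h3
  simp only [map_add, map_sub, map_smul, h.unit z hz, h.G_k_covField hz, smul_eq_mul] at h4
  simp at h2
  rw [covField_apply Γ k z u, add_comm, map_add, add_apply]
  linarith

/-- Skewness of ∇k turns `G_covField_covField` into a statement about its square: ∇k is a complex
structure on the orthogonal complement of k. This is the tangential part of J² = -1. -/
theorem covField_covField (h : SasakiChart B Γ G k) {z : E} (hz : z ∈ B) (w : E) :
    covField Γ k z (covField Γ k z w) = -w + G z (k z) w • k z := by
  rw [← sub_eq_zero]
  refine h.nondegenerate z hz _ fun u ↦ ?_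
  have h1 := h.G_covField_covField hz w u
  have h2 := h.skew z hz (covField Γ k z w) u
  simp only [map_sub, map_add, map_neg, map_smul, sub_apply,
    add_apply, neg_apply, smul_apply,
    smul_eq_mul]
  linarith

theorem coneJ_mul_self (h : SasakiChart B Γ G k) {z : E} (hz : z ∈ B) :
    coneJ Γ G k z * coneJ Γ G k z = -1 := by
  refine ContinuousLinearMap.ext fun x ↦ ?_
  change coneJ Γ G k z (coneJ Γ G k z x) = -x
  rw [coneJ_apply, coneJ_apply]
  ext
  · simp [h.covField_covField hz, h.covField_k hz]
  · simp [h.G_k_covField hz, h.unit z hz]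

theorem coneH_coneJ (h : SasakiChart B Γ G k) {z : E} (hz : z ∈ B) (x y : E × ℝ) :
    coneH G z (coneJ Γ G k z x) (coneJ Γ G k z y) = coneH G z x y := by
  have h1 : ∀ u, G z (covField Γ k z u) (k z) = 0 := fun u ↦ by
    rw [h.symm_G z hz, h.G_k_covField hz]
  simp only [coneH, coneJ_apply, map_add, map_smul, add_apply,
    smul_apply, smul_eq_mul, h1, h.G_k_covField hz, h.unit z hz,
    h.G_covField_covField hz]
  ring

/-- This says that J is parallel. The tangential component is the Sasaki equation for the second
derivative of k; the scalar component is the skewness of ∇k. -/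
theorem fderiv_coneJ (h : SasakiChart B Γ G k) {z : E} (hz : z ∈ B) (u : E) :
    fderiv ℝ (coneJ Γ G k) z u =
      coneJ Γ G k z * coneForm Γ G z u - coneForm Γ G z u * coneJ Γ G k z := by
  refine ContinuousLinearMap.ext fun x ↦ ?_
  rw [fderiv_clm_apply_const
    (hasFDerivAt_of_contDiffOn h.isOpen h.smooth_coneJ hz).differentiableAt]
  simp only [coneJ_apply]
  have d1 := ((h.hasFDerivAt_covField hz).clm_apply (hasFDerivAt_const x.1 z)).add
    ((h.hasFDerivAt_k hz).const_smul x.2)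
  have d2 := (h.hasFDerivAt_G_apply hz rfl (hasFDerivAt_id z) (h.hasFDerivAt_k hz)
    (hasFDerivAt_const x.1 z)).neg
  refine (congrArg (fun T : E →L[ℝ] (E × ℝ) ↦ T u) (d1.prodMk d2).fderiv).trans ?_
  change _ = coneJ Γ G k z (coneForm Γ G z u x) - coneForm Γ G z u (coneJ Γ G k z x)
  rw [coneJ_apply, coneForm_apply, coneForm_apply, coneJ_apply]
  have e1 := h.second_deriv z hz u x.1
  have e2 : fderiv ℝ (covField Γ k) z u x.1 = -G z u x.1 • k z + G z (k z) x.1 • u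
      - Γ z u (covField Γ k z x.1) + covField Γ k z (Γ z u x.1) := by rw [← e1]; abel
  have e3 : fderiv ℝ k z u = covField Γ k z u - Γ z u (k z) := by rw [covField_apply]; abel
  have e4 := h.skew z hz u x.1
  have e5 := h.symm_G z hz u (k z)
  ext
  · simp [e2, e3, smul_sub]
    abel
  · simp only [ContinuousLinearMap.prod_apply, neg_apply,
      add_apply, ContinuousLinearMap.comp_apply,
      ContinuousLinearMap.flip_apply, zero_apply, zero_add, e3, map_add,
      map_smul, smul_eq_mul, ContinuousLinearMap.id_apply, sub_add_cancel, Prod.snd_sub, e5]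
    linarith

/-- The metric `G + ρ²` is parallel. -/
theorem hasFDerivAt_coneH (h : SasakiChart B Γ G k) {z : E} (hz : z ∈ B)
    {P : Type*} [NormedAddCommGroup P] [NormedSpace ℝ P] {c : P → E} {c' : P →L[ℝ] E} {p : P}
    (hcp : c p = z) (hc : HasFDerivAt c c' p) {X Y : P → E × ℝ} {X' Y' : P →L[ℝ] E × ℝ}
    (hX : HasFDerivAt X X' p) (hY : HasFDerivAt Y Y' p) (u : P) :
    DifferentiableAt ℝ (fun p ↦ coneH G (c p) (X p) (Y p)) p ∧
    fderiv ℝ (fun p ↦ coneH G (c p) (X p) (Y p)) p u =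
      coneH G z (X' u + coneForm Γ G z (c' u) (X p)) (Y p) +
      coneH G z (X p) (Y' u + coneForm Γ G z (c' u) (Y p)) := by
  have d1 := h.hasFDerivAt_G_apply hz hcp hc hX.fst hY.fst
  have d2 := d1.add (hX.snd.mul hY.snd)
  refine ⟨d2.differentiableAt, ?_⟩
  refine (congrArg (fun T : P →L[ℝ] ℝ ↦ T u) d2.fderiv).trans ?_
  have e := h.symm_G z hz
  simp [coneH, coneForm_apply]
  rw [e (X p).1 (c' u)]
  ring

/-- The Ricci identity expresses R(u,v)k by antisymmetrised second derivatives of k, and these are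
prescribed by the Sasaki equation. In the direction of k the curvature is that of the unit sphere.
-/
theorem curvLM_k (h : SasakiChart B Γ G k) {z : E} (hz : z ∈ B) (u v : E) :
    curvLM Γ z u v (k z) = G z (k z) v • u - G z (k z) u • v := by
  have e0 := covField_curvature (h.hasFDerivAt_Γ hz).differentiableAt
    ((h.smooth_k.contDiffAt (h.isOpen.mem_nhds hz)).of_le ENat.LEInfty.out) u v
  have e1 := h.second_deriv z hz u v
  have e2 := h.second_deriv z hz v u
  rw [h.symm_Γ z hz v u, h.symm_G z hz v u] at e2
  have e3 : curvLM Γ z u v (k z) = (-G z u v • k z + G z (k z) v • u) -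
      (-G z u v • k z + G z (k z) u • v) := by
    rw [← e1, ← e2, curvLM_apply, ← e0]
    abel
  rw [e3]; abel

/-- Γ is symmetric on a whole open set, so its derivative is symmetric in the last two arguments as
well, and the cyclic sum cancels in pairs. -/
theorem curvLM_bianchi (h : SasakiChart B Γ G k) {z : E} (hz : z ∈ B) (u v w : E) :
    curvLM Γ z u v w + curvLM Γ z v w u + curvLM Γ z w u v = 0 := by
  have hd := (h.hasFDerivAt_Γ hz).differentiableAt
  have hs : ∀ u v w, fderiv ℝ Γ z u v w = fderiv ℝ Γ z u w v := by
    intro u v w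
    rw [fderiv_clm_apply_const₂ hd, fderiv_clm_apply_const₂ hd]
    have : (fun y ↦ Γ y v w) =ᶠ[𝓝 z] fun y ↦ Γ y w v := by
      filter_upwards [h.isOpen.mem_nhds hz] with y hy using h.symm_Γ y hy v w
    rw [this.fderiv_eq]
  simp only [curvLM_apply, connCurv, sub_apply,
      add_apply, mul_apply_eq_comp]
  rw [hs u w v, hs v w u, hs w v u, h.symm_Γ z hz w v, h.symm_Γ z hz w u, h.symm_Γ z hz v u]
  abel

end SasakiChart

end SasakiChart

/-! ### Ricci-flat curvature commuting with an endomorphism -/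

section TraceFree

/-- The endomorphisms `W(u, v)` of an algebraic curvature tensor with vanishing Ricci trace have no
trace, even after composition with an endomorphism which commutes with them. -/
theorem trace_comp_curvature_eq_zero {V : Type*} [AddCommGroup V] [Module ℝ V]
    (W : V →ₗ[ℝ] V →ₗ[ℝ] V →ₗ[ℝ] V) (K : V →ₗ[ℝ] V) (hanti : ∀ u v w, W u v w = -W v u w)
    (hbianchi : ∀ u v w, W u v w + W v w u + W w u v = 0)
    (hric : ∀ v w, LinearMap.trace ℝ V ((W.flip v).flip w) = 0)
    (hK : ∀ u v w, K (W u v w) = W u v (K w)) (u v : V) :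
    LinearMap.trace ℝ V (K ∘ₗ W u v) = 0 := by
  -- Since K commutes with W(u,v), the Bianchi identity for u, v, Kw gives K W(u,v)w = W(Kw,v)u -
  -- W(Kw,u)v.
  have h1 : K ∘ₗ W u v = ((W.flip v).flip u) ∘ₗ K - ((W.flip u).flip v) ∘ₗ K := by
    ext w
    have := hbianchi u v (K w)
    rw [hanti v (K w) u] at this
    simp only [LinearMap.comp_apply, LinearMap.sub_apply, LinearMap.flip_apply, hK]
    rw [← sub_eq_zero, ← this]; abel
  -- By cyclicity K can be moved to the outside, and by commutation from there onto b. What remains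
  -- is the Ricci trace with b replaced by K b.
  have h2 : ∀ a b, LinearMap.trace ℝ V (((W.flip a).flip b) ∘ₗ K) = 0 := fun a b ↦ by
    rw [← hric a (K b)]
    refine (LinearMap.trace_mul_comm ℝ ((W.flip a).flip b) K).trans ?_
    congr 1
    ext w
    exact hK w a b
  rw [h1, map_sub, h2, h2, sub_zero]

end TraceFree

/-! ### Curvature of the cone connection -/

namespace SasakiChart

variable {E : Type*} [NormedAddCommGroup E] [NormedSpace ℝ E]
variable {B : Set E} {Γ : E → E →L[ℝ] E →L[ℝ] E} {G : E → E →L[ℝ] E →L[ℝ] ℝ} {k : E → E}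

/-- The curvature minus that of a space of constant curvature `1`. -/
noncomputable def coneCurv (Γ : E → E →L[ℝ] E →L[ℝ] E) (G : E → E →L[ℝ] E →L[ℝ] ℝ) (z : E) :
    E →ₗ[ℝ] E →ₗ[ℝ] E →ₗ[ℝ] E :=
  curvLM Γ z - LinearMap.mk₂ ℝ (fun u v ↦
      ((G z v : E →L[ℝ] ℝ) : E →ₗ[ℝ] ℝ).smulRight u - ((G z u : E →L[ℝ] ℝ) : E →ₗ[ℝ] ℝ).smulRight v)
    (fun u u' v ↦ by ext w; simp [add_smul]; abel)
    (fun c u v ↦ by ext w; simp [smul_smul, mul_comm, smul_sub])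
    (fun u v v' ↦ by ext w; simp [add_smul]; abel)
    (fun c u v ↦ by ext w; simp [smul_smul, mul_comm, smul_sub])

theorem coneCurv_apply (Γ : E → E →L[ℝ] E →L[ℝ] E) (G : E → E →L[ℝ] E →L[ℝ] ℝ) (z u v w : E) :
    coneCurv Γ G z u v w = curvLM Γ z u v w - (G z v w • u - G z u w • v) := rfl

/-- The Ricci contraction for constant curvature 1, where b is the metric with one argument fixed.
-/
theorem trace_constantCurv [FiniteDimensional ℝ E] (b : E →ₗ[ℝ] ℝ) (v : E) :
    LinearMap.trace ℝ E (b v • LinearMap.id - b.smulRight v) = ((finrank ℝ E : ℝ) - 1) * b v := by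
  rw [map_sub, map_smul, LinearMap.trace_id, LinearMap.trace_smulRight]
  simp
  ring

/-- Contracting `curvLM_k` gives Ric(k,k) = N - 1, with N the dimension. As g(k,k) = 1, this is the
value of the Einstein constant. -/
theorem ricciLM_eq [FiniteDimensional ℝ E] (h : SasakiChart B Γ G k) {z : E} (hz : z ∈ B)
    (v w : E) : ricciLM Γ z v w = ((finrank ℝ E : ℝ) - 1) * G z v w := by
  obtain ⟨c, hc⟩ := h.einstein z hz
  have h1 : ricciLM Γ z (k z) (k z) = ((finrank ℝ E : ℝ) - 1) * G z (k z) (k z) := by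
    refine Eq.trans ?_ (trace_constantCurv ((G z (k z) : E →L[ℝ] ℝ) : E →ₗ[ℝ] ℝ) (k z))
    rw [ricciLM]
    congr 1
    ext u
    exact h.curvLM_k hz u (k z)
  rw [hc, h.unit z hz] at h1
  rw [hc, show c = (finrank ℝ E : ℝ) - 1 by linarith]

theorem trace_coneCurv [FiniteDimensional ℝ E] (h : SasakiChart B Γ G k) {z : E} (hz : z ∈ B)
    (v w : E) : LinearMap.trace ℝ E (((coneCurv Γ G z).flip v).flip w) = 0 := by
  have h1 := trace_constantCurv (((G z).flip w : E →L[ℝ] ℝ) : E →ₗ[ℝ] ℝ) v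
  have h2 : ((coneCurv Γ G z).flip v).flip w = ((curvLM Γ z).flip v).flip w -
      ((((G z).flip w : E →L[ℝ] ℝ) : E →ₗ[ℝ] ℝ) v • LinearMap.id -
        (((G z).flip w : E →L[ℝ] ℝ) : E →ₗ[ℝ] ℝ).smulRight v) := by
    ext u
    simp [coneCurv_apply]
  rw [h2, map_sub, h1]
  change ricciLM Γ z v w - _ * G z v w = 0
  rw [h.ricciLM_eq hz, sub_self]

theorem coneCurv_anti (u v w z : E) : coneCurv Γ G z u v w = -coneCurv Γ G z v u w := by
  have : curvLM Γ z u v w = -curvLM Γ z v u w := by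
    rw [curvLM_apply, connCurv_swap]; rfl
  rw [coneCurv_apply, coneCurv_apply, this]
  abel

theorem coneCurv_bianchi (h : SasakiChart B Γ G k) {z : E} (hz : z ∈ B) (u v w : E) :
    coneCurv Γ G z u v w + coneCurv Γ G z v w u + coneCurv Γ G z w u v = 0 := by
  rw [coneCurv_apply, coneCurv_apply, coneCurv_apply, h.symm_G z hz v w, h.symm_G z hz u w,
    h.symm_G z hz v u]
  rw [← h.curvLM_bianchi hz u v w]
  abel

/-- The quadratic part of the cone form subtracts the curvature of constant curvature 1. The terms
with ρ cancel by the symmetry of Γ. The scalar component cancels by that symmetry together with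
metric compatibility. -/
theorem connCurv_coneForm (h : SasakiChart B Γ G k) {z : E} (hz : z ∈ B) (u v : E) (x : E × ℝ) :
    connCurv (coneForm Γ G) z u v x = (coneCurv Γ G z u v x.1, 0) := by
  have hA := (hasFDerivAt_of_contDiffOn h.isOpen h.smooth_coneForm hz).differentiableAt
  have hd : ∀ u v, fderiv ℝ (coneForm Γ G) z u v x =
      (fderiv ℝ Γ z u v x.1, -fderiv ℝ G z u v x.1) := by
    intro u v
    rw [fderiv_clm_apply_const₂ hA]
    simp only [coneForm_apply]
    have d1 := (hasFDerivAt_clm_apply_const (hasFDerivAt_clm_apply_const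
      (h.hasFDerivAt_Γ hz).differentiableAt v).differentiableAt x.1)
    have d2 := (hasFDerivAt_clm_apply_const (hasFDerivAt_clm_apply_const
      (h.hasFDerivAt_G hz).differentiableAt v).differentiableAt x.1)
    refine (congrArg (fun T : E →L[ℝ] (E × ℝ) ↦ T u)
      ((d1.add_const (x.2 • v)).prodMk d2.neg).fderiv).trans ?_
    rw [(hasFDerivAt_clm_apply_const (h.hasFDerivAt_Γ hz).differentiableAt v).fderiv,
      (hasFDerivAt_clm_apply_const (h.hasFDerivAt_G hz).differentiableAt v).fderiv]
    rfl
  change fderiv ℝ (coneForm Γ G) z u v x - fderiv ℝ (coneForm Γ G) z v u x +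
    coneForm Γ G z u (coneForm Γ G z v x) - coneForm Γ G z v (coneForm Γ G z u x) = _
  rw [hd, hd, coneForm_apply, coneForm_apply, coneForm_apply, coneForm_apply, coneCurv_apply]
  have e1 : curvLM Γ z u v x.1 = fderiv ℝ Γ z u v x.1 - fderiv ℝ Γ z v u x.1 +
    Γ z u (Γ z v x.1) - Γ z v (Γ z u x.1) := rfl
  rw [e1, h.metric z hz, h.metric z hz, h.symm_Γ z hz v u]
  ext
  · simp [h.symm_Γ z hz v u]
    abel
  · simp [h.symm_G z hz v u]
    ring

theorem coneJ_comm_connCurv (h : SasakiChart B Γ G k) {z : E} (hz : z ∈ B) (u v : E) :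
    coneJ Γ G k z * connCurv (coneForm Γ G) z u v =
      connCurv (coneForm Γ G) z u v * coneJ Γ G k z := by
  refine connCurv_comm_of_parallel
    (hasFDerivAt_of_contDiffOn h.isOpen h.smooth_coneForm hz).differentiableAt
    ((h.smooth_coneJ.contDiffAt (h.isOpen.mem_nhds hz)).of_le ENat.LEInfty.out) ?_ u v
  filter_upwards [h.isOpen.mem_nhds hz] with y hy w using h.fderiv_coneJ hy w

/-- J commutes with the curvature of the cone connection; this is the tangential component of that
identity on the vector (w, 0). It provides the endomorphism K for `trace_comp_curvature_eq_zero`. -/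
theorem covField_coneCurv (h : SasakiChart B Γ G k) {z : E} (hz : z ∈ B) (u v w : E) :
    covField Γ k z (coneCurv Γ G z u v w) = coneCurv Γ G z u v (covField Γ k z w) := by
  have h1 : coneJ Γ G k z (connCurv (coneForm Γ G) z u v (w, 0)) =
      connCurv (coneForm Γ G) z u v (coneJ Γ G k z (w, 0)) :=
    congrArg (fun T : (E × ℝ) →L[ℝ] (E × ℝ) ↦ T (w, 0)) (h.coneJ_comm_connCurv hz u v)
  rw [h.connCurv_coneForm hz, h.connCurv_coneForm hz, coneJ_apply, coneJ_apply] at h1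
  simpa using congrArg Prod.fst h1

/-- The curvature factors through the summand E, so its trace is that of W(u,v). This is the case K
= 1 of `trace_comp_curvature_eq_zero`. -/
theorem trace_connCurv [FiniteDimensional ℝ E] (h : SasakiChart B Γ G k) {z : E} (hz : z ∈ B)
    (u v : E) : traceCLM (E × ℝ) (connCurv (coneForm Γ G) z u v) = 0 := by
  have h1 := trace_comp_curvature_eq_zero (coneCurv Γ G z) LinearMap.id
    (fun u v w ↦ coneCurv_anti u v w z) (h.coneCurv_bianchi hz) (h.trace_coneCurv hz)
    (fun _ _ _ ↦ rfl) u v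
  rw [LinearMap.id_comp] at h1
  have h2 : ((connCurv (coneForm Γ G) z u v : (E × ℝ) →L[ℝ] (E × ℝ)) : (E × ℝ) →ₗ[ℝ] (E × ℝ)) =
      (LinearMap.inl ℝ E ℝ ∘ₗ coneCurv Γ G z u v) ∘ₗ LinearMap.fst ℝ E ℝ := by
    refine LinearMap.ext fun x ↦ ?_
    exact h.connCurv_coneForm hz u v x
  rw [traceCLM_apply, h2, LinearMap.trace_comp_comm', ← LinearMap.comp_assoc,
    LinearMap.fst_comp_inl, LinearMap.id_comp, h1]

/-- After cyclic reduction to the summand E, only the tangential block of J matters. This block is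
∇k, so the claim is the case K = ∇k of `trace_comp_curvature_eq_zero`. -/
theorem trace_coneJ_connCurv [FiniteDimensional ℝ E] (h : SasakiChart B Γ G k) {z : E}
    (hz : z ∈ B) (u v : E) :
    traceCLM (E × ℝ) (coneJ Γ G k z * connCurv (coneForm Γ G) z u v) = 0 := by
  have h1 := trace_comp_curvature_eq_zero (coneCurv Γ G z)
    ((covField Γ k z : E →L[ℝ] E) : E →ₗ[ℝ] E)
    (fun u v w ↦ coneCurv_anti u v w z) (h.coneCurv_bianchi hz) (h.trace_coneCurv hz)
    (h.covField_coneCurv hz) u v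
  have h2 : ((coneJ Γ G k z * connCurv (coneForm Γ G) z u v : (E × ℝ) →L[ℝ] (E × ℝ)) :
      (E × ℝ) →ₗ[ℝ] (E × ℝ)) =
      ((coneJ Γ G k z : (E × ℝ) →ₗ[ℝ] (E × ℝ)) ∘ₗ LinearMap.inl ℝ E ℝ ∘ₗ coneCurv Γ G z u v) ∘ₗ
        LinearMap.fst ℝ E ℝ := by
    refine LinearMap.ext fun x ↦ ?_
    exact congrArg (coneJ Γ G k z) (h.connCurv_coneForm hz u v x)
  rw [traceCLM_apply, h2, LinearMap.trace_comp_comm', ← h1]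
  congr 1
  ext w
  simp [coneJ_apply]

/-- The tractor bundle of a Sasaki–Einstein structure has local parallel complex volume forms. -/
theorem exists_volume [FiniteDimensional ℝ E] (h : SasakiChart B Γ G k) {m : ℕ}
    (hm : finrank ℝ E + 1 = 2 * m) {z₀ : E} (hz₀ : z₀ ∈ B) :
    ∃ B' ⊆ B, IsOpen B' ∧ z₀ ∈ B' ∧ ∃ ψ : E → (E × ℝ) [⋀^Fin m]→ₗ[ℝ] ℂ,
      IsParallelOn (coneForm Γ G) ψ B' ∧ ∀ z ∈ B',
        IsComplexForm (coneJ Γ G k z : (E × ℝ) →ₗ[ℝ] (E × ℝ)) (ψ z) ∧ ψ z ≠ 0 :=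
  exists_parallel_volume (by rw [finrank_prod, finrank_self, hm]) h.isOpen hz₀ h.smooth_coneForm
    h.smooth_coneJ (fun _ hz ↦ h.coneJ_mul_self hz) (fun _ hz ↦ h.fderiv_coneJ hz)
    (fun _ hz ↦ h.trace_connCurv hz) (fun _ hz ↦ h.trace_coneJ_connCurv hz)

end SasakiChart

/-! ### Vector fields and functions in a chart of the manifold -/

section ChartCoordinates

variable {E : Type*} [NormedAddCommGroup E] [NormedSpace ℝ E] [FiniteDimensional ℝ E]
variable {M : Type*} [TopologicalSpace M] [ChartedSpace E M] [IsManifold 𝓘(ℝ, E) ∞ M]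
variable {F : Type*} [NormedAddCommGroup F] [NormedSpace ℝ F]

instance isManifold_one : IsManifold 𝓘(ℝ, E) 1 M :=
  IsManifold.of_le (n := ∞) (by exact_mod_cast le_top)

/-- The coordinates, in the chart at `x₀`, of a tangent vector at `y`. -/
noncomputable def tanCoord (x₀ y : M) : Tan E y →L[ℝ] E :=
  (trivializationAt E (TangentSpace 𝓘(ℝ, E)) x₀).continuousLinearMapAt ℝ y

/-- The tangent vector at `y` with given coordinates in the chart at `x₀`. -/
noncomputable def tanVec (x₀ y : M) : E →L[ℝ] Tan E y :=
  (trivializationAt E (TangentSpace 𝓘(ℝ, E)) x₀).symmL ℝ y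

/-- The vector field with constant coordinates `w` in the chart at `x₀`. -/
noncomputable def chartField (x₀ : M) (w : E) (y : M) : Tan E y := tanVec x₀ y w

/-- The coordinate expression of a vector field in the chart at `x₀`. -/
noncomputable def fieldCoord (x₀ : M) (X : ∀ y : M, Tan E y) (z : E) : E :=
  tanCoord x₀ ((chartAt E x₀).symm z) (X ((chartAt E x₀).symm z))

variable {x₀ y : M}

theorem tanCoord_tanVec (hy : y ∈ (chartAt E x₀).source) (w : E) :
    tanCoord x₀ y (tanVec x₀ y w) = w :=
  (trivializationAt E (TangentSpace 𝓘(ℝ, E)) x₀).continuousLinearMapAt_symmL (by simpa using hy) w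

theorem tanVec_tanCoord (hy : y ∈ (chartAt E x₀).source) (v : Tan E y) :
    tanVec x₀ y (tanCoord x₀ y v) = v :=
  (trivializationAt E (TangentSpace 𝓘(ℝ, E)) x₀).symmL_continuousLinearMapAt (by simpa using hy) v

theorem tanCoord_apply (hy : y ∈ (chartAt E x₀).source) (v : Tan E y) :
    tanCoord x₀ y v = (trivializationAt E (TangentSpace 𝓘(ℝ, E)) x₀ ⟨y, v⟩).2 :=
  (trivializationAt E (TangentSpace 𝓘(ℝ, E)) x₀).coe_linearMapAt_of_mem (R := ℝ)
    (by simpa using hy) ▸ rfl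

theorem tanVec_apply (hy : y ∈ (chartAt E x₀).source) (w : E) :
    tanVec x₀ y w = (trivializationAt E (TangentSpace 𝓘(ℝ, E)) x₀).symm y w :=
  (trivializationAt E (TangentSpace 𝓘(ℝ, E)) x₀).symmL_apply (R := ℝ) (by simpa using hy) w

theorem tanCoord_eq_tangentChange (hy : y ∈ (chartAt E x₀).source) :
    tanCoord x₀ y = tangentChange (achart E y) (achart E x₀) y :=
  TangentBundle.continuousLinearMapAt_trivializationAt_eq_core hy

theorem mfderiv_chartAt (hy : y ∈ (chartAt E x₀).source) :
    mfderiv 𝓘(ℝ, E) 𝓘(ℝ, E) (chartAt E x₀) y = tanCoord x₀ y := by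
  have := TangentBundle.continuousLinearMapAt_trivializationAt (I := 𝓘(ℝ, E)) hy
  rw [tanCoord, this]
  simp only [mfld_simps]

theorem contMDiffAt_chartAt (hy : y ∈ (chartAt E x₀).source) :
    ContMDiffAt 𝓘(ℝ, E) 𝓘(ℝ, E) ∞ (chartAt E x₀) y :=
  (contMDiffOn_chart (I := 𝓘(ℝ, E)) (n := ∞)).contMDiffAt ((chartAt E x₀).open_source.mem_nhds hy)

theorem contMDiffAt_chartAt_symm {z : E} (hz : z ∈ (chartAt E x₀).target) :
    ContMDiffAt 𝓘(ℝ, E) 𝓘(ℝ, E) ∞ (chartAt E x₀).symm z :=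
  (contMDiffOn_chart_symm (I := 𝓘(ℝ, E)) (n := ∞)).contMDiffAt
    ((chartAt E x₀).open_target.mem_nhds hz)

theorem eventuallyEq_comp_chart (hy : y ∈ (chartAt E x₀).source) {α : Type*} (f : M → α) :
    f =ᶠ[𝓝 y] (f ∘ (chartAt E x₀).symm) ∘ chartAt E x₀ := by
  filter_upwards [(chartAt E x₀).open_source.mem_nhds hy] with y' hy'
  simp [(chartAt E x₀).left_inv hy']

theorem differentiableAt_comp_chart_symm (hy : y ∈ (chartAt E x₀).source) {f : M → F}
    (hf : MDifferentiableAt 𝓘(ℝ, E) 𝓘(ℝ, F) f y) :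
    DifferentiableAt ℝ (f ∘ (chartAt E x₀).symm) (chartAt E x₀ y) := by
  rw [← mdifferentiableAt_iff_differentiableAt]
  refine MDifferentiableAt.comp (I' := 𝓘(ℝ, E)) _ ?_
    ((contMDiffAt_chartAt_symm ((chartAt E x₀).map_source hy)).mdifferentiableAt (by simp))
  rwa [(chartAt E x₀).left_inv hy]

theorem mdifferentiableAt_of_comp_chart_symm (hy : y ∈ (chartAt E x₀).source) {f : M → F}
    (hf : DifferentiableAt ℝ (f ∘ (chartAt E x₀).symm) (chartAt E x₀ y)) :
    MDifferentiableAt 𝓘(ℝ, E) 𝓘(ℝ, F) f y := by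
  refine MDifferentiableAt.congr_of_eventuallyEq ?_ (eventuallyEq_comp_chart hy f)
  exact MDifferentiableAt.comp (I' := 𝓘(ℝ, E)) _ hf.mdifferentiableAt
    ((contMDiffAt_chartAt hy).mdifferentiableAt (by simp))

theorem mvfderiv_eq_fderiv (hy : y ∈ (chartAt E x₀).source) {f : M → F}
    (hf : MDifferentiableAt 𝓘(ℝ, E) 𝓘(ℝ, F) f y) (v : Tan E y) :
    mvfderiv 𝓘(ℝ, E) f y v =
      fderiv ℝ (f ∘ (chartAt E x₀).symm) (chartAt E x₀ y) (tanCoord x₀ y v) := by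
  have h1 := (differentiableAt_comp_chart_symm hy hf).mdifferentiableAt.hasMFDerivAt
  have h2 := ((contMDiffAt_chartAt hy).mdifferentiableAt (by simp)).hasMFDerivAt
  have h3 := (h1.comp y h2).congr_of_eventuallyEq (eventuallyEq_comp_chart hy f)
  rw [mfderiv_chartAt hy, mfderiv_eq_fderiv] at h3
  exact congrArg (fun T : E →L[ℝ] F ↦ T v) h3.mfderiv

theorem contDiffAt_comp_chart_symm {n : ℕ∞} (hy : y ∈ (chartAt E x₀).source) {f : M → F}
    (hf : ContMDiffAt 𝓘(ℝ, E) 𝓘(ℝ, F) n f y) :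
    ContDiffAt ℝ n (f ∘ (chartAt E x₀).symm) (chartAt E x₀ y) := by
  rw [← contMDiffAt_iff_contDiffAt]
  refine ContMDiffAt.comp (I' := 𝓘(ℝ, E)) _ ?_
    ((contMDiffAt_chartAt_symm ((chartAt E x₀).map_source hy)).of_le (by exact_mod_cast le_top))
  rwa [(chartAt E x₀).left_inv hy]

theorem contMDiffAt_of_comp_chart_symm {n : ℕ∞} (hy : y ∈ (chartAt E x₀).source) {f : M → F}
    (hf : ContDiffAt ℝ n (f ∘ (chartAt E x₀).symm) (chartAt E x₀ y)) :
    ContMDiffAt 𝓘(ℝ, E) 𝓘(ℝ, F) n f y := by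
  refine ContMDiffAt.congr_of_eventuallyEq ?_ (eventuallyEq_comp_chart hy f)
  exact ContMDiffAt.comp (I' := 𝓘(ℝ, E)) _ hf.contMDiffAt
    ((contMDiffAt_chartAt hy).of_le (by exact_mod_cast le_top))

/-- The coordinate representation of a vector field, as a function on the manifold. -/
theorem fieldCoord_eventuallyEq (hy : y ∈ (chartAt E x₀).source) (X : ∀ y : M, Tan E y) :
    fieldCoord x₀ X =ᶠ[𝓝 (chartAt E x₀ y)]
      (fun y ↦ (trivializationAt E (TangentSpace 𝓘(ℝ, E)) x₀ ⟨y, X y⟩).2) ∘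
        (chartAt E x₀).symm := by
  filter_upwards [(chartAt E x₀).open_target.mem_nhds ((chartAt E x₀).map_source hy)] with z hz
  exact tanCoord_apply ((chartAt E x₀).map_target hz) _

theorem fieldCoord_chartAt (hy : y ∈ (chartAt E x₀).source) (X : ∀ y : M, Tan E y) :
    fieldCoord x₀ X (chartAt E x₀ y) = tanCoord x₀ y (X y) := by
  rw [fieldCoord, (chartAt E x₀).left_inv hy]

theorem diffFieldAt_iff (hy : y ∈ (chartAt E x₀).source) {X : ∀ y : M, Tan E y} :
    DiffFieldAt X y ↔ DifferentiableAt ℝ (fieldCoord x₀ X) (chartAt E x₀ y) := by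
  rw [DiffFieldAt, (fieldCoord_eventuallyEq hy X).differentiableAt_iff,
    (trivializationAt E (TangentSpace 𝓘(ℝ, E)) x₀).mdifferentiableAt_section_iff _ _
      (by simpa using hy)]
  exact ⟨differentiableAt_comp_chart_symm hy, mdifferentiableAt_of_comp_chart_symm hy⟩

/-- The vector field `X` is smooth at `y`. -/
def SmoothFieldAt (X : ∀ y : M, Tan E y) (y : M) : Prop :=
  ContMDiffAt 𝓘(ℝ, E) (𝓘(ℝ, E).prod 𝓘(ℝ, E)) ∞
    (fun y ↦ (TotalSpace.mk' E y (X y) : TangentBundle 𝓘(ℝ, E) M)) y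

theorem smoothFieldAt_iff (hy : y ∈ (chartAt E x₀).source) {X : ∀ y : M, Tan E y} :
    SmoothFieldAt X y ↔ ContDiffAt ℝ ∞ (fieldCoord x₀ X) (chartAt E x₀ y) := by
  rw [SmoothFieldAt, (trivializationAt E (TangentSpace 𝓘(ℝ, E)) x₀).contMDiffAt_section_iff
      (by simpa using hy)]
  refine ⟨fun h ↦ (contDiffAt_comp_chart_symm (n := ⊤) hy h).congr_of_eventuallyEq
    (fieldCoord_eventuallyEq hy X), fun h ↦ contMDiffAt_of_comp_chart_symm (n := ⊤) hy
    (h.congr_of_eventuallyEq (fieldCoord_eventuallyEq hy X).symm)⟩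

theorem SmoothFieldAt.diffFieldAt {X : ∀ y : M, Tan E y} (h : SmoothFieldAt X y) :
    DiffFieldAt X y := ContMDiffAt.mdifferentiableAt h (by simp)

theorem fieldCoord_chartField (w : E) {z : E} (hz : z ∈ (chartAt E x₀).target) :
    fieldCoord x₀ (chartField x₀ w) z = w :=
  tanCoord_tanVec ((chartAt E x₀).map_target hz) w

theorem smoothFieldAt_of_eq {X : ∀ y : M, Tan E y} (hy : y ∈ (chartAt E x₀).source) {f : E → E}
    {s : Set E} (hs : IsOpen s) (hys : chartAt E x₀ y ∈ s) (hX : Set.EqOn (fieldCoord x₀ X) f s)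
    (hf : ContDiffOn ℝ ∞ f s) : SmoothFieldAt X y := by
  rw [smoothFieldAt_iff hy]
  exact (hf.contDiffAt (hs.mem_nhds hys)).congr_of_eventuallyEq
    (hX.eventuallyEq_of_mem (hs.mem_nhds hys))

theorem smoothFieldAt_chartField (hy : y ∈ (chartAt E x₀).source) (w : E) :
    SmoothFieldAt (chartField x₀ w) y :=
  smoothFieldAt_of_eq hy (chartAt E x₀).open_target ((chartAt E x₀).map_source hy)
    (fun _ hz ↦ fieldCoord_chartField w hz) contDiffOn_const

/-- A locally smooth section coincides near a point with a global smooth section. -/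
theorem exists_contMDiff_eventuallyEq [T2Space M]
    {V : M → Type*} [TopologicalSpace (TotalSpace F V)] [∀ x, TopologicalSpace (V x)]
    [∀ x, AddCommGroup (V x)] [∀ x, Module ℝ (V x)] [FiberBundle F V] [VectorBundle ℝ F V]
    [ContMDiffVectorBundle ∞ F V 𝓘(ℝ, E)] {s : ∀ x, V x} {U : Set M} (hU : IsOpen U) (hy : y ∈ U)
    (hs : ContMDiffOn 𝓘(ℝ, E) (𝓘(ℝ, E).prod 𝓘(ℝ, F)) ∞ (fun x ↦ TotalSpace.mk' F x (s x)) U) :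
    ∃ s' : ∀ x, V x, ContMDiff 𝓘(ℝ, E) (𝓘(ℝ, E).prod 𝓘(ℝ, F)) ∞ (fun x ↦ TotalSpace.mk' F x (s' x)) ∧
      ∀ᶠ x in 𝓝 y, s' x = s x := by
  obtain ⟨f, -, hf⟩ := (SmoothBumpFunction.nhds_basis_tsupport (I := 𝓘(ℝ, E)) y).mem_iff.1
    (hU.mem_nhds hy)
  refine ⟨fun x ↦ f x • s x, ?_, ?_⟩
  · exact ContMDiffOn.smul_section_of_tsupport (f.contMDiff.contMDiffOn) hU hf hs
  · filter_upwards [f.eventuallyEq_one] with x hx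
    simp [hx]

end ChartCoordinates

/-! ### Christoffel symbols of an abstract connection -/

section Christoffel

variable {E : Type*} [NormedAddCommGroup E] [NormedSpace ℝ E] [FiniteDimensional ℝ E]
variable {M : Type*} [TopologicalSpace M] [ChartedSpace E M] [IsManifold 𝓘(ℝ, E) ∞ M]

/-- The coordinate functionals of the standard basis of `E`. -/
noncomputable def basisCoord (E : Type*) [NormedAddCommGroup E] [NormedSpace ℝ E]
    [FiniteDimensional ℝ E] (i : Fin (finrank ℝ E)) : E →L[ℝ] ℝ :=
  LinearMap.toContinuousLinearMap ((finBasis ℝ E).coord i)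

theorem sum_basisCoord (w : E) : ∑ i, basisCoord E i w • finBasis ℝ E i = w :=
  (finBasis ℝ E).sum_repr w

/-- The covariant derivative of a coordinate vector field at `y`, in coordinates. -/
noncomputable def chartConnection (nabla : Connection E M) (x₀ : M) (w : E) (y : M) : E →L[ℝ] E :=
  tanCoord x₀ y ∘L nabla (chartField x₀ w) y ∘L tanVec x₀ y

/-- The Christoffel symbols of a connection in the chart at `x₀`. -/
noncomputable def christoffel (nabla : Connection E M) (x₀ : M) (z : E) : E →L[ℝ] E →L[ℝ] E :=
  ∑ i, (ContinuousLinearMap.smulRightL ℝ E E (basisCoord E i)) ∘L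
    chartConnection nabla x₀ (finBasis ℝ E i) ((chartAt E x₀).symm z)

theorem christoffel_apply (nabla : Connection E M) (x₀ : M) (z u w : E) :
    christoffel nabla x₀ z u w = ∑ i, basisCoord E i w •
      chartConnection nabla x₀ (finBasis ℝ E i) ((chartAt E x₀).symm z) u := by
  simp [christoffel]

/-- The constant vector field on `E`. -/
def constField (u z : E) : TangentSpace 𝓘(ℝ, E) z := u

variable {x₀ y : M} (nabla : Connection E M)

theorem nabla_congr {X Y : ∀ y : M, Tan E y} (hX : DiffFieldAt X y) (h : ∀ᶠ z in 𝓝 y, X z = Y z) :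
    nabla X y = nabla Y y := by
  refine nabla.isCovariantDerivativeOnUniv.congr_of_eventuallyEq hX ?_ Filter.univ_mem h
  refine MDifferentiableAt.congr_of_eventuallyEq hX ?_
  filter_upwards [h] with z hz
  rw [hz]

theorem nabla_add {X Y : ∀ y : M, Tan E y} (hX : DiffFieldAt X y) (hY : DiffFieldAt Y y)
    (v : Tan E y) : nabla (X + Y) y v = nabla X y v + nabla Y y v :=
  congrArg (fun T : Tan E y →L[ℝ] Tan E y ↦ T v)
    (nabla.isCovariantDerivativeOnUniv.add hX hY)

theorem nabla_smul {X : ∀ y : M, Tan E y} {f : M → ℝ} (hX : DiffFieldAt X y)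
    (hf : MDifferentiableAt 𝓘(ℝ, E) 𝓘(ℝ, ℝ) f y) (v : Tan E y) :
    nabla (f • X) y v = f y • nabla X y v + mvfderiv 𝓘(ℝ, E) f y v • X y :=
  congrArg (fun T : Tan E y →L[ℝ] Tan E y ↦ T v)
    (nabla.isCovariantDerivativeOnUniv.leibniz hX hf)

theorem nabla_sum_smul {ι : Type*} (s : Finset ι) {X : ι → ∀ y : M, Tan E y} {f : ι → M → ℝ}
    (hX : ∀ i, DiffFieldAt (X i) y) (hf : ∀ i, MDifferentiableAt 𝓘(ℝ, E) 𝓘(ℝ, ℝ) (f i) y)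
    (v : Tan E y) :
    nabla (∑ i ∈ s, f i • X i) y v =
      ∑ i ∈ s, (f i y • nabla (X i) y v + mvfderiv 𝓘(ℝ, E) (f i) y v • X i y) := by
  classical
  have hd : ∀ t : Finset ι, DiffFieldAt (∑ i ∈ t, f i • X i) y := by
    intro t
    have := MDifferentiableAt.sum_section (s := t) (t := fun i ↦ f i • X i)
      fun i _ ↦ (hf i).smul_section (hX i)
    simpa [DiffFieldAt, Finset.sum_apply] using this
  induction s using Finset.induction_on with
  | empty =>
    simp only [Finset.sum_empty]
    rw [nabla.isCovariantDerivativeOnUniv.zero]; rfl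
  | insert a s ha ih =>
    rw [Finset.sum_insert ha, Finset.sum_insert ha, nabla_add _ ((hf a).smul_section (hX a)) (hd s),
      nabla_smul _ (hX a) (hf a), ih]

/-- The covariant derivative in coordinates. -/
theorem tanCoord_nabla (hy : y ∈ (chartAt E x₀).source) {X : ∀ y : M, Tan E y}
    (hX : DiffFieldAt X y) (v : Tan E y) :
    tanCoord x₀ y (nabla X y v) = fderiv ℝ (fieldCoord x₀ X) (chartAt E x₀ y) (tanCoord x₀ y v) +
      christoffel nabla x₀ (chartAt E x₀ y) (tanCoord x₀ y v) (tanCoord x₀ y (X y)) := by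
  have hX' := (diffFieldAt_iff hy).1 hX
  let f : Fin (finrank ℝ E) → M → ℝ := fun i y ↦ basisCoord E i (tanCoord x₀ y (X y))
  have hfc : ∀ i, f i ∘ (chartAt E x₀).symm = fun z ↦ basisCoord E i (fieldCoord x₀ X z) :=
    fun i ↦ rfl
  have hf : ∀ i, MDifferentiableAt 𝓘(ℝ, E) 𝓘(ℝ, ℝ) (f i) y := fun i ↦ by
    refine mdifferentiableAt_of_comp_chart_symm hy ?_
    rw [hfc]
    exact (basisCoord E i).differentiableAt.comp _ hX'
  have hc : ∀ i, DiffFieldAt (chartField x₀ (finBasis ℝ E i)) y := fun i ↦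
    (smoothFieldAt_chartField hy _).diffFieldAt
  have hXs : ∀ᶠ z in 𝓝 y, X z = (∑ i, f i • chartField x₀ (finBasis ℝ E i)) z := by
    filter_upwards [(chartAt E x₀).open_source.mem_nhds hy] with z hz
    have h1 : (∑ i, f i • chartField x₀ (finBasis ℝ E i)) z =
        tanVec x₀ z (∑ i, basisCoord E i (tanCoord x₀ z (X z)) • finBasis ℝ E i) := by
      simp [f, chartField, Finset.sum_apply]
    rw [h1, sum_basisCoord, tanVec_tanCoord hz]
  have hdf : ∀ i, mvfderiv 𝓘(ℝ, E) (f i) y v = basisCoord E i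
      (fderiv ℝ (fieldCoord x₀ X) (chartAt E x₀ y) (tanCoord x₀ y v)) := fun i ↦ by
    rw [mvfderiv_eq_fderiv hy (hf i), hfc]
    exact congrArg (fun T : E →L[ℝ] ℝ ↦ T (tanCoord x₀ y v))
      ((basisCoord E i).hasFDerivAt.comp _ hX'.hasFDerivAt).fderiv
  rw [nabla_congr nabla hX hXs, nabla_sum_smul _ _ hc hf, map_sum, christoffel_apply]
  simp only [map_add, map_smul, Finset.sum_add_distrib, hdf]
  rw [add_comm]
  congr 1
  · refine Eq.trans ?_ (sum_basisCoord _)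
    refine Finset.sum_congr rfl fun i _ ↦ ?_
    rw [chartField, tanCoord_tanVec hy]
  · refine Finset.sum_congr rfl fun i _ ↦ ?_
    rw [(chartAt E x₀).left_inv hy, chartConnection, ContinuousLinearMap.comp_apply,
      ContinuousLinearMap.comp_apply, tanVec_tanCoord hy]

theorem smoothFieldAt_congr {X Y : ∀ y : M, Tan E y} (h : SmoothFieldAt X y)
    (he : ∀ᶠ z in 𝓝 y, Y z = X z) : SmoothFieldAt Y y := by
  refine ContMDiffAt.congr_of_eventuallyEq h ?_
  filter_upwards [he] with z hz
  rw [hz]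

variable {nabla}

/-- Smoothness of the connection is available for globally smooth fields. A field which is smooth
near y agrees near y with a global one, obtained with a bump function, and ∇ is local. -/
theorem smoothFieldAt_nabla [T2Space M] (hs : CovariantDerivative.ContMDiffCovariantDerivative nabla ∞)
    {X Y : ∀ y : M, Tan E y} (hX : ∀ᶠ z in 𝓝 y, SmoothFieldAt X z) (hY : SmoothFieldAt Y y) :
    SmoothFieldAt (fun z ↦ nabla X z (Y z)) y := by
  obtain ⟨U, hU, hUo, hyU⟩ := eventually_nhds_iff.1 hX
  obtain ⟨X', hX', he⟩ := exists_contMDiff_eventuallyEq hUo hyU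
    (s := X) (fun z hz ↦ (ContMDiffAt.contMDiffWithinAt (hU z hz)))
  have h1 := hs.contMDiff.contMDiff (σ := X') hX'.contMDiffOn
  have h2 : SmoothFieldAt (fun z ↦ nabla X' z (Y z)) y :=
    ContMDiffAt.clm_bundle_apply (h1.contMDiffAt Filter.univ_mem) hY
  refine smoothFieldAt_congr h2 ?_
  filter_upwards [eventually_eventually_nhds.2 he, hX] with z hz hz'
  rw [nabla_congr nabla hz'.diffFieldAt (hz.mono fun _ h ↦ h.symm)]

theorem contDiffOn_christoffel [T2Space M]
    (hs : CovariantDerivative.ContMDiffCovariantDerivative nabla ∞) (x₀ : M) :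
    ContDiffOn ℝ ∞ (christoffel nabla x₀) (chartAt E x₀).target := by
  unfold christoffel
  refine ContDiffOn.sum fun i _ ↦ contDiffOn_const.clm_comp ?_
  refine contDiffOn_clm_apply.2 fun u z hz ↦ ?_
  have hy := (chartAt E x₀).map_target hz
  have h := smoothFieldAt_nabla hs (X := chartField x₀ (finBasis ℝ E i)) (Y := chartField x₀ u)
    (y := (chartAt E x₀).symm z) ?_ (smoothFieldAt_chartField hy u)
  · rw [smoothFieldAt_iff hy, (chartAt E x₀).right_inv hz] at h
    exact h.contDiffWithinAt
  · filter_upwards [(chartAt E x₀).open_source.mem_nhds hy] with z hz using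
      smoothFieldAt_chartField hz _

/-- Coordinate fields are pullbacks of constant fields under the chart, and the Lie bracket is
natural under pullback. -/
theorem mlieBracket_chartField (hy : y ∈ (chartAt E x₀).source) (u w : E) :
    VectorField.mlieBracket 𝓘(ℝ, E) (chartField x₀ u) (chartField x₀ w) y = 0 := by
  have h1 : ∀ u : E, ∀ᶠ z in 𝓝 y, chartField x₀ u z =
      VectorField.mpullback 𝓘(ℝ, E) 𝓘(ℝ, E) (chartAt E x₀) (constField u) z := by
    intro u
    filter_upwards [(chartAt E x₀).open_source.mem_nhds hy] with z hz
    rw [VectorField.mpullback_apply, mfderiv_chartAt (E := E) hz]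
    have h2 : (tanCoord (E := E) x₀ z).inverse = tanVec x₀ z := by
      refine ContinuousLinearMap.inverse_eq ?_ ?_
      · ext w; exact tanCoord_tanVec hz w
      · ext w; exact tanVec_tanCoord hz w
    exact (DFunLike.congr_fun h2 u).symm
  rw [Filter.EventuallyEq.mlieBracket_vectorField_eq (h1 u) (h1 w)]
  have hM : IsManifold 𝓘(ℝ, E) (minSmoothness ℝ 2) M :=
    IsManifold.of_le (n := ∞) (by simpa using ENat.LEInfty.out)
  rw [← VectorField.mpullback_mlieBracket (n := ∞)]
  · rw [VectorField.mpullback_apply, ← VectorField.mlieBracketWithin_univ, VectorField.mlieBracketWithin_eq_lieBracketWithin]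
    have : VectorField.lieBracketWithin ℝ (fun _ : E ↦ u) (fun _ ↦ w) Set.univ
        (chartAt E x₀ y) = 0 := by
      simp [VectorField.lieBracketWithin]
    exact (congrArg (mfderiv 𝓘(ℝ, E) 𝓘(ℝ, E) (chartAt E x₀) y).inverse this).trans (map_zero _)
  · exact (contMDiffAt_vectorSpace_iff_contDiffAt.2
      (contDiffAt_const (c := u) (n := 1))).mdifferentiableAt one_ne_zero
  · exact (contMDiffAt_vectorSpace_iff_contDiffAt.2
      (contDiffAt_const (c := w) (n := 1))).mdifferentiableAt one_ne_zero
  · exact contMDiffAt_chartAt hy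
  · simpa using ENat.LEInfty.out

theorem tanCoord_nabla_chartField (nabla : Connection E M) (hy : y ∈ (chartAt E x₀).source)
    (u w : E) : tanCoord x₀ y (nabla (chartField x₀ w) y (chartField x₀ u y)) =
      christoffel nabla x₀ (chartAt E x₀ y) u w := by
  rw [tanCoord_nabla nabla hy (smoothFieldAt_chartField hy w).diffFieldAt]
  have h3 : fieldCoord x₀ (chartField x₀ w) =ᶠ[𝓝 (chartAt E x₀ y)] fun _ ↦ w := by
    filter_upwards [(chartAt E x₀).open_target.mem_nhds ((chartAt E x₀).map_source hy)] with z hz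
    exact fieldCoord_chartField w hz
  rw [h3.fderiv_eq]
  simp [chartField, tanCoord_tanVec hy]

/-- Coordinate fields commute, so for them vanishing torsion is symmetry of the Christoffel symbols.
-/
theorem christoffel_symm (h : IsTorsionFreeAffine nabla) (hy : y ∈ (chartAt E x₀).source) (u w : E) :
    christoffel nabla x₀ (chartAt E x₀ y) u w = christoffel nabla x₀ (chartAt E x₀ y) w u := by
  have hd : ∀ u : E, DiffFieldAt (chartField x₀ u) y := fun u ↦
    (smoothFieldAt_chartField hy u).diffFieldAt
  have h1 := h.torsion_free (chartField x₀ u) (chartField x₀ w) y (hd u) (hd w)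
  rw [mlieBracket_chartField hy, sub_eq_zero] at h1
  rw [← tanCoord_nabla_chartField nabla hy, h1, tanCoord_nabla_chartField nabla hy]

end Christoffel

/-! ### Curvature, Ricci tensor and metric in a chart -/

section CurvatureCoordinates

variable {E : Type*} [NormedAddCommGroup E] [NormedSpace ℝ E] [FiniteDimensional ℝ E]
variable {M : Type*} [TopologicalSpace M] [T2Space M] [ChartedSpace E M] [IsManifold 𝓘(ℝ, E) ∞ M]
variable {nabla : Connection E M} {x₀ y : M}

theorem tanCoord_nabla_eq_covField (nabla : Connection E M) (hy : y ∈ (chartAt E x₀).source)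
    {X : ∀ y : M, Tan E y} (hX : DiffFieldAt X y) (v : Tan E y) :
    tanCoord x₀ y (nabla X y v) =
      covField (christoffel nabla x₀) (fieldCoord x₀ X) (chartAt E x₀ y) (tanCoord x₀ y v) := by
  rw [tanCoord_nabla nabla hy hX, covField_apply, fieldCoord_chartAt hy]

theorem smoothNear_extend (v : Tan E y) : ∀ᶠ z in 𝓝 y, SmoothFieldAt (FiberBundle.extend E v) z := by
  obtain ⟨s, hs, h⟩ := FiberBundle.exists_contMDiffOn_extend 𝓘(ℝ, E) E (k := ∞) v
  filter_upwards [eventually_mem_nhds_iff.2 hs] with z hz using h.contMDiffAt hz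

theorem fieldCoord_nabla (nabla : Connection E M) (hy : y ∈ (chartAt E x₀).source)
    {X : ∀ y : M, Tan E y} (Y : ∀ y : M, Tan E y) (hX : ∀ᶠ z in 𝓝 y, SmoothFieldAt X z) :
    fieldCoord x₀ (fun z ↦ nabla X z (Y z)) =ᶠ[𝓝 (chartAt E x₀ y)]
      fun z ↦ covField (christoffel nabla x₀) (fieldCoord x₀ X) z (fieldCoord x₀ Y z) := by
  have h1 : ContinuousAt (chartAt E x₀).symm (chartAt E x₀ y) :=
    (chartAt E x₀).continuousAt_symm ((chartAt E x₀).map_source hy)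
  rw [ContinuousAt, (chartAt E x₀).left_inv hy] at h1
  filter_upwards [h1.eventually hX, (chartAt E x₀).open_target.mem_nhds
    ((chartAt E x₀).map_source hy)] with z hz hzt
  have h2 := (chartAt E x₀).map_target hzt
  have h3 := tanCoord_nabla_eq_covField nabla h2 hz.diffFieldAt (Y ((chartAt E x₀).symm z))
  rw [(chartAt E x₀).right_inv hzt] at h3
  exact h3

theorem differentiableAt_christoffel
    (hs : CovariantDerivative.ContMDiffCovariantDerivative nabla ∞)
    (hy : y ∈ (chartAt E x₀).source) :
    DifferentiableAt ℝ (christoffel nabla x₀) (chartAt E x₀ y) :=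
  (hasFDerivAt_of_contDiffOn (chartAt E x₀).open_target (contDiffOn_christoffel hs x₀)
    ((chartAt E x₀).map_source hy)).differentiableAt

/-- An iterated covariant derivative in coordinates. -/
theorem tanCoord_nabla_nabla (hs : CovariantDerivative.ContMDiffCovariantDerivative nabla ∞)
    (hy : y ∈ (chartAt E x₀).source) {X Y : ∀ y : M, Tan E y}
    (hX : ∀ᶠ z in 𝓝 y, SmoothFieldAt X z) (hY : SmoothFieldAt Y y) (v : Tan E y) :
    tanCoord x₀ y (nabla (fun z ↦ nabla X z (Y z)) y v) =
      fderiv ℝ (covField (christoffel nabla x₀) (fieldCoord x₀ X)) (chartAt E x₀ y)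
        (tanCoord x₀ y v) (tanCoord x₀ y (Y y)) +
      covField (christoffel nabla x₀) (fieldCoord x₀ X) (chartAt E x₀ y)
        (fderiv ℝ (fieldCoord x₀ Y) (chartAt E x₀ y) (tanCoord x₀ y v)) +
      christoffel nabla x₀ (chartAt E x₀ y) (tanCoord x₀ y v)
        (covField (christoffel nabla x₀) (fieldCoord x₀ X) (chartAt E x₀ y)
          (tanCoord x₀ y (Y y))) := by
  have h1 := (smoothFieldAt_nabla hs hX hY).diffFieldAt
  have hX2 : ContDiffAt ℝ 2 (fieldCoord x₀ X) (chartAt E x₀ y) :=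
    ((smoothFieldAt_iff hy).1 hX.self_of_nhds).of_le ENat.LEInfty.out
  have d1 := (fderiv_covField (differentiableAt_christoffel hs hy) hX2).1.hasFDerivAt.clm_apply
    ((diffFieldAt_iff hy).1 hY.diffFieldAt).hasFDerivAt
  rw [tanCoord_nabla nabla hy h1, (fieldCoord_nabla nabla hy Y hX).fderiv_eq, d1.fderiv,
    tanCoord_nabla_eq_covField nabla hy hX.self_of_nhds.diffFieldAt, fieldCoord_chartAt hy]
  simp only [add_apply, ContinuousLinearMap.comp_apply, ContinuousLinearMap.flip_apply]
  abel

/-- The curvature in coordinates. -/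
theorem tanCoord_curvatureField (h : IsTorsionFreeAffine nabla) (hy : y ∈ (chartAt E x₀).source)
    {X Y Z : ∀ y : M, Tan E y} (hX : SmoothFieldAt X y) (hY : SmoothFieldAt Y y)
    (hZ : ∀ᶠ z in 𝓝 y, SmoothFieldAt Z z) :
    tanCoord x₀ y (curvatureField nabla X Y Z y) =
      connCurv (christoffel nabla x₀) (chartAt E x₀ y) (tanCoord x₀ y (X y)) (tanCoord x₀ y (Y y))
        (tanCoord x₀ y (Z y)) := by
  have hZ2 : ContDiffAt ℝ 2 (fieldCoord x₀ Z) (chartAt E x₀ y) :=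
    ((smoothFieldAt_iff hy).1 hZ.self_of_nhds).of_le ENat.LEInfty.out
  rw [← fieldCoord_chartAt hy Z, ← covField_curvature (differentiableAt_christoffel h.smooth hy) hZ2,
    curvatureField, ← h.torsion_free X Y y hX.diffFieldAt hY.diffFieldAt, map_sub, map_sub,
    tanCoord_nabla_nabla h.smooth hy hZ hY, tanCoord_nabla_nabla h.smooth hy hZ hX,
    tanCoord_nabla_eq_covField nabla hy hZ.self_of_nhds.diffFieldAt, map_sub,
    tanCoord_nabla nabla hy hY.diffFieldAt, tanCoord_nabla nabla hy hX.diffFieldAt,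
    christoffel_symm h hy (tanCoord x₀ y (Y y)) (tanCoord x₀ y (X y))]
  simp only [map_sub, map_add]
  abel

/-- The coordinate formula for fields involves only their values at y, so the local extensions in
the definition of the curvature do not matter. -/
theorem tanCoord_curvature (h : IsTorsionFreeAffine nabla) (hy : y ∈ (chartAt E x₀).source)
    (u v w : Tan E y) : tanCoord x₀ y (curvature nabla y u v w) =
      curvLM (christoffel nabla x₀) (chartAt E x₀ y) (tanCoord x₀ y u) (tanCoord x₀ y v)
        (tanCoord x₀ y w) := by
  have := tanCoord_curvatureField h hy (smoothNear_extend u).self_of_nhds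
    (smoothNear_extend v).self_of_nhds (smoothNear_extend w)
  rw [FiberBundle.extend_apply_self, FiberBundle.extend_apply_self,
    FiberBundle.extend_apply_self] at this
  exact this

/-- The chart identifies the tangent space with the model space. -/
noncomputable def tanEquiv (hy : y ∈ (chartAt E x₀).source) : Tan E y ≃ₗ[ℝ] E :=
  { toFun := tanCoord x₀ y
    map_add' := map_add _
    map_smul' := map_smul _
    invFun := tanVec x₀ y
    left_inv := fun v ↦ tanVec_tanCoord hy v
    right_inv := fun w ↦ tanCoord_tanVec hy w }

theorem trace_eq_sum_coord {ι V : Type*} [Fintype ι] [AddCommGroup V] [Module ℝ V]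
    (b : Basis ι ℝ V) (T : V →ₗ[ℝ] V) : LinearMap.trace ℝ V T = ∑ i, b.coord i (T (b i)) := by
  classical
  rw [LinearMap.trace_eq_matrix_trace ℝ b, Matrix.trace]
  simp [LinearMap.toMatrix_apply]

/-- The Ricci tensor is defined with one particular basis of the tangent space. A trace does not
depend on the basis, so any chart around y may be used. -/
theorem ricci_eq_ricciLM (h : IsTorsionFreeAffine nabla) (hy : y ∈ (chartAt E x₀).source)
    (v w : Tan E y) : ricci nabla y v w = ricciLM (christoffel nabla x₀) (chartAt E x₀ y)
      (tanCoord x₀ y v) (tanCoord x₀ y w) := by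
  rw [ricciLM, ← LinearMap.trace_conj' _ (tanEquiv hy).symm]
  have h1 : ∀ u : Tan E y, curvature nabla y u v w = (tanEquiv hy).symm.conj
      (((curvLM (christoffel nabla x₀) (chartAt E x₀ y)).flip (tanCoord x₀ y v)).flip
        (tanCoord x₀ y w)) u := fun u ↦ by
    rw [← tanVec_tanCoord hy (curvature nabla y u v w), tanCoord_curvature h hy]
    rfl
  refine Eq.trans ?_ (trace_eq_sum_coord (V := Tan E y) (finBasis ℝ E) _).symm
  exact Finset.sum_congr rfl fun i _ ↦ congrArg ((finBasis ℝ E).coord i) (h1 _)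

/-- The derivative of the extension of w occurs in both terms of the definition and cancels, so the
result depends on the vector w alone. -/
theorem tanCoord_secondDeriv (h : IsTorsionFreeAffine nabla) {k : ∀ y : M, Tan E y}
    (hk : SmoothField k) (hy : y ∈ (chartAt E x₀).source) (v w : Tan E y) :
    tanCoord x₀ y (secondDeriv nabla k y v w) =
      fderiv ℝ (covField (christoffel nabla x₀) (fieldCoord x₀ k)) (chartAt E x₀ y)
        (tanCoord x₀ y v) (tanCoord x₀ y w) +
      christoffel nabla x₀ (chartAt E x₀ y) (tanCoord x₀ y v)
        (covField (christoffel nabla x₀) (fieldCoord x₀ k) (chartAt E x₀ y) (tanCoord x₀ y w)) -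
      covField (christoffel nabla x₀) (fieldCoord x₀ k) (chartAt E x₀ y)
        (christoffel nabla x₀ (chartAt E x₀ y) (tanCoord x₀ y v) (tanCoord x₀ y w)) := by
  have hk' : ∀ z, SmoothFieldAt k z := fun z ↦ hk z
  have hw := (smoothNear_extend w).self_of_nhds
  rw [secondDeriv, map_sub, tanCoord_nabla_nabla h.smooth hy (Filter.Eventually.of_forall hk') hw,
    tanCoord_nabla_eq_covField nabla hy (hk' y).diffFieldAt,
    tanCoord_nabla nabla hy hw.diffFieldAt]
  simp only [FiberBundle.extend_apply_self, map_add]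
  abel

/-- The coordinate expression of a metric in the chart at `x₀`. -/
noncomputable def chartMetric (g : PseudoRiemannianMetric E M) (x₀ : M) (z : E) :
    E →L[ℝ] E →L[ℝ] ℝ :=
  ContinuousLinearMap.bilinearComp (E := E) (F := E) (G := ℝ) (g.inner ((chartAt E x₀).symm z))
    (tanVec x₀ ((chartAt E x₀).symm z)) (tanVec x₀ ((chartAt E x₀).symm z))

theorem chartMetric_apply (g : PseudoRiemannianMetric E M) (x₀ : M) (z v w : E) :
    chartMetric g x₀ z v w = g.inner ((chartAt E x₀).symm z)
      (chartField x₀ v ((chartAt E x₀).symm z)) (chartField x₀ w ((chartAt E x₀).symm z)) := rfl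

theorem chartMetric_tanCoord (g : PseudoRiemannianMetric E M) (hy : y ∈ (chartAt E x₀).source)
    (v w : Tan E y) :
    chartMetric g x₀ (chartAt E x₀ y) (tanCoord x₀ y v) (tanCoord x₀ y w) = g.inner y v w := by
  rw [chartMetric_apply, (chartAt E x₀).left_inv hy, chartField, chartField, tanVec_tanCoord hy,
    tanVec_tanCoord hy]

theorem contDiffOn_chartMetric (g : PseudoRiemannianMetric E M) (x₀ : M) :
    ContDiffOn ℝ ∞ (chartMetric g x₀) (chartAt E x₀).target := by
  refine contDiffOn_clm_apply.2 fun v ↦ contDiffOn_clm_apply.2 fun w z hz ↦ ?_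
  have hy := (chartAt E x₀).map_target hz
  have h1 : ContMDiffAt 𝓘(ℝ, E) 𝓘(ℝ, ℝ) ∞ (fun y ↦ g.inner y (chartField x₀ v y)
      (chartField x₀ w y)) ((chartAt E x₀).symm z) := by
    have := ContMDiffAt.clm_bundle_apply₂ (F₃ := ℝ) (E₃ := Bundle.Trivial M ℝ) (g.smooth _)
      (smoothFieldAt_chartField hy v) (smoothFieldAt_chartField hy w)
    rw [contMDiffAt_section] at this
    exact this
  have h2 := contDiffAt_comp_chart_symm (n := ⊤) hy h1
  rw [(chartAt E x₀).right_inv hz] at h2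
  exact h2.contDiffWithinAt

theorem mdifferentiableAt_metric (g : PseudoRiemannianMetric E M) {X Y : ∀ y : M, Tan E y}
    (hX : DiffFieldAt X y) (hY : DiffFieldAt Y y) :
    MDifferentiableAt 𝓘(ℝ, E) 𝓘(ℝ, ℝ) (fun y ↦ g.inner y (X y) (Y y)) y := by
  have := MDifferentiableAt.clm_bundle_apply₂ (F₃ := ℝ) (E₃ := Bundle.Trivial M ℝ)
    ((g.smooth _).mdifferentiableAt (by simp)) hX hY
  rw [mdifferentiableAt_section] at this
  exact this

variable {g : PseudoRiemannianMetric E M} {k : ∀ y : M, Tan E y}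

theorem fderiv_chartMetric (hLC : IsLeviCivita g nabla) (hy : y ∈ (chartAt E x₀).source)
    (u v w : E) : fderiv ℝ (chartMetric g x₀) (chartAt E x₀ y) u v w =
      chartMetric g x₀ (chartAt E x₀ y) (christoffel nabla x₀ (chartAt E x₀ y) u v) w +
      chartMetric g x₀ (chartAt E x₀ y) v (christoffel nabla x₀ (chartAt E x₀ y) u w) := by
  have hd : ∀ v : E, DiffFieldAt (chartField x₀ v) y := fun v ↦
    (smoothFieldAt_chartField hy v).diffFieldAt
  have hc : ∀ w : E, tanCoord x₀ y (chartField x₀ w y) = w := tanCoord_tanVec hy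
  have h1 := hLC.metric (chartField x₀ v) (chartField x₀ w) y (hd v) (hd w) (chartField x₀ u y)
  rw [mvfderiv_eq_fderiv hy (mdifferentiableAt_metric g (hd v) (hd w)), hc,
    ← chartMetric_tanCoord g hy, ← chartMetric_tanCoord g hy, hc, hc,
    tanCoord_nabla_chartField nabla hy, tanCoord_nabla_chartField nabla hy] at h1
  rw [← h1, fderiv_clm_apply_const₂ (hasFDerivAt_of_contDiffOn (chartAt E x₀).open_target
    (contDiffOn_chartMetric g x₀) ((chartAt E x₀).map_source hy)).differentiableAt]
  rfl

/-- For a torsion-free metric connection, the Lie derivative of g along k is g(∇_Y k, Z) + g(Y, ∇_Z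
k), since the terms with ∇_k Y and ∇_k Z cancel. -/
theorem skew_of_killing (hLC : IsLeviCivita g nabla) (hk : IsKilling g k) (v w : Tan E y) :
    g.inner y (nabla k y v) w + g.inner y v (nabla k y w) = 0 := by
  have hv := (smoothNear_extend v).self_of_nhds.diffFieldAt
  have hw := (smoothNear_extend w).self_of_nhds.diffFieldAt
  have hkd : DiffFieldAt k y := ContMDiffAt.mdifferentiableAt (hk.1 y) (by simp)
  have h1 := hk.2 _ _ y hv hw
  rw [hLC.metric _ _ y hv hw, ← hLC.torsion_free k _ y hkd hv, ← hLC.torsion_free k _ y hkd hw,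
    map_sub, map_sub, sub_apply, FiberBundle.extend_apply_self, FiberBundle.extend_apply_self] at h1
  linarith

set_option maxHeartbeats 400000 in
/-- The coordinate expression of a Sasaki–Einstein structure. -/
theorem sasakiChart (hLC : IsLeviCivita g nabla) (hS : IsSasaki g nabla k)
    (hE : IsEinstein g nabla) (x₀ : M) :
    SasakiChart (chartAt E x₀).target (christoffel nabla x₀) (chartMetric g x₀) (fieldCoord x₀ k) := by
  -- Each clause is stated at a point z of the chart target, while the geometric facts live at a
  -- point y of M. Every z is the image of such a y.
  have key : ∀ {P : E → Prop}, (∀ y ∈ (chartAt E x₀).source, P (chartAt E x₀ y)) →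
      ∀ z ∈ (chartAt E x₀).target, P z := fun h z hz ↦ by
    simpa only [(chartAt E x₀).right_inv hz] using h _ ((chartAt E x₀).map_target hz)
  have hkd : ∀ y, SmoothFieldAt k y := fun y ↦ hS.killing.1 y
  constructor
  · exact (chartAt E x₀).open_target
  · exact contDiffOn_christoffel hLC.smooth x₀
  · exact contDiffOn_chartMetric g x₀
  · refine key (P := fun z ↦ ContDiffWithinAt ℝ ∞ _ _ z) fun y hy ↦ ?_
    exact ((smoothFieldAt_iff hy).1 (hkd y)).contDiffWithinAt
  · exact key fun y hy u v ↦ christoffel_symm hLC.toIsTorsionFreeAffine hy u v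
  · exact fun z hz u v ↦ g.symm _ _ _
  · refine key fun y hy v hv ↦ ?_
    have h1 : tanVec x₀ y v = 0 := g.nondegenerate y _ fun w ↦ by
      rw [← chartMetric_tanCoord g hy, tanCoord_tanVec hy, hv]
    rw [← tanCoord_tanVec hy v, h1, map_zero]
  · exact key fun y hy u v w ↦ fderiv_chartMetric hLC hy u v w
  · refine key fun y hy v w ↦ ?_
    have h1 := skew_of_killing hLC hS.killing (tanVec x₀ y v) (tanVec x₀ y w)
    rwa [← chartMetric_tanCoord g hy, ← chartMetric_tanCoord g hy,
      tanCoord_nabla_eq_covField nabla hy (hkd y).diffFieldAt,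
      tanCoord_nabla_eq_covField nabla hy (hkd y).diffFieldAt, tanCoord_tanVec hy,
      tanCoord_tanVec hy] at h1
  · refine key fun y hy ↦ ?_
    rw [fieldCoord_chartAt hy, chartMetric_tanCoord g hy, hS.unit]
  · refine key fun y hy v w ↦ ?_
    have h1 := congrArg (tanCoord x₀ y) (hS.second_deriv y (tanVec x₀ y v) (tanVec x₀ y w))
    rw [tanCoord_secondDeriv hLC.toIsTorsionFreeAffine hS.killing.1 hy, map_add, map_smul, map_smul,
      ← chartMetric_tanCoord g hy, ← chartMetric_tanCoord g hy, tanCoord_tanVec hy,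
      tanCoord_tanVec hy, ← fieldCoord_chartAt hy k] at h1
    exact h1
  · refine key fun y hy ↦ ?_
    obtain ⟨c, hc⟩ := hE
    refine ⟨c, fun v w ↦ ?_⟩
    have h1 := hc y (tanVec x₀ y v) (tanVec x₀ y w)
    rwa [ricci_eq_ricciLM hLC.toIsTorsionFreeAffine hy, ← chartMetric_tanCoord g hy,
      tanCoord_tanVec hy, tanCoord_tanVec hy] at h1

end CurvatureCoordinates

/-! ### The metric density and its logarithm -/

section GramDeterminant

variable {E : Type*} [NormedAddCommGroup E] [NormedSpace ℝ E] [FiniteDimensional ℝ E]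

/-- The determinant as a continuous multilinear map of the rows. -/
noncomputable def detCLM (n : ℕ) : ContinuousMultilinearMap ℝ (fun _ : Fin n ↦ (Fin n → ℝ)) ℝ :=
  ⟨(Matrix.detRowAlternating : (Fin n → ℝ) [⋀^Fin n]→ₗ[ℝ] ℝ).toMultilinearMap,
    (continuous_id.matrix_det : Continuous fun X : Matrix (Fin n) (Fin n) ℝ ↦ X.det)⟩

theorem detCLM_apply {n : ℕ} (w : Fin n → Fin n → ℝ) : detCLM n w = Matrix.det w := rfl

/-- The Gram matrix of a bilinear form in the standard basis of `E`. -/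
noncomputable def gram (G : E →L[ℝ] E →L[ℝ] ℝ) :
    Matrix (Fin (finrank ℝ E)) (Fin (finrank ℝ E)) ℝ :=
  fun i j ↦ G (finBasis ℝ E i) (finBasis ℝ E j)

theorem gram_comp (G : E →L[ℝ] E →L[ℝ] ℝ) (A : E →L[ℝ] E) :
    (gram (G.bilinearComp A A)).det = A.det ^ 2 * (gram G).det := by
  have h1 : ∀ G : E →L[ℝ] E →L[ℝ] ℝ,
      gram G = LinearMap.BilinForm.toMatrix (finBasis ℝ E) G.toLinearMap₁₂ := fun G ↦ by
    ext i j; simp [gram, LinearMap.BilinForm.toMatrix_apply]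
  have h2 : (G.bilinearComp A A).toLinearMap₁₂ =
      LinearMap.BilinForm.comp G.toLinearMap₁₂ (A : E →ₗ[ℝ] E) (A : E →ₗ[ℝ] E) := rfl
  rw [h1, h2, LinearMap.BilinForm.toMatrix_comp (finBasis ℝ E), ← h1, Matrix.det_mul,
    Matrix.det_mul, Matrix.det_transpose, LinearMap.det_toMatrix, ContinuousLinearMap.det]
  ring

theorem gram_det_ne_zero {G : E →L[ℝ] E →L[ℝ] ℝ} (hG : ∀ v, (∀ w, G v w = 0) → v = 0) :
    (gram G).det ≠ 0 := by
  intro h0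
  obtain ⟨v, hv, h1⟩ := Matrix.exists_vecMul_eq_zero_iff.2 h0
  have h2 : ∑ i, v i • finBasis ℝ E i = 0 := by
    refine hG _ fun w ↦ ?_
    have h3 : G (∑ i, v i • finBasis ℝ E i) = 0 := by
      refine ContinuousLinearMap.coe_injective ((finBasis ℝ E).ext fun j ↦ ?_)
      have := congrFun h1 j
      simpa [Matrix.vecMul, dotProduct, gram] using this
    rw [h3]; rfl
  exact hv (funext (Fintype.linearIndependent_iff.1 (finBasis ℝ E).linearIndependent v h2))

/-- Let C be the matrix of Γ(u). Metric compatibility makes row i of the differentiated Gram matrix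
the sum of row i of (Gram matrix) · C and of the combination of rows with coefficients from column i
of C. Each part contributes tr C times the determinant, which explains the factor 2. -/
theorem hasFDerivAt_det_gram {Γ : E → E →L[ℝ] E →L[ℝ] E} {G : E → E →L[ℝ] E →L[ℝ] ℝ} {z : E}
    (hG : DifferentiableAt ℝ G z)
    (hm : ∀ u v w, fderiv ℝ G z u v w = G z (Γ z u v) w + G z v (Γ z u w)) :
    HasFDerivAt (fun z ↦ (gram (G z)).det)
      ((2 * (gram (G z)).det) • (traceCLM E ∘L Γ z)) z := by
  have d1 : ∀ i, HasFDerivAt (fun z j ↦ G z (finBasis ℝ E i) (finBasis ℝ E j)) _ z := fun i ↦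
    hasFDerivAt_pi.2 fun j ↦ hasFDerivAt_clm_apply_const
      (hasFDerivAt_clm_apply_const hG (finBasis ℝ E i)).differentiableAt (finBasis ℝ E j)
  have d2 := HasFDerivAt.comp z ((detCLM (finrank ℝ E)).hasFDerivAt
    (fun i j ↦ G z (finBasis ℝ E i) (finBasis ℝ E j)))
    (hasFDerivAt_pi.2 d1)
  refine HasFDerivAt.congr_fderiv d2 (ContinuousLinearMap.ext fun u ↦ ?_)
  let C : Matrix (Fin (finrank ℝ E)) (Fin (finrank ℝ E)) ℝ :=
    LinearMap.toMatrix (finBasis ℝ E) (finBasis ℝ E) ((Γ z u : E →L[ℝ] E) : E →ₗ[ℝ] E)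
  have hC : ∀ j, Γ z u (finBasis ℝ E j) = ∑ k, C k j • finBasis ℝ E k := fun j ↦ by
    simp only [C, LinearMap.toMatrix_apply]
    exact ((finBasis ℝ E).sum_repr _).symm
  have hrow : ∀ i, (fun j ↦ fderiv ℝ G z u (finBasis ℝ E i) (finBasis ℝ E j)) =
      (gram (G z) * C) i + ∑ k, C k i • gram (G z) k := by
    intro i
    ext j
    rw [hm, hC, hC]
    simp [Matrix.mul_apply, gram, Finset.sum_apply, mul_comm, add_comm]
  have hd : ∀ i j, fderiv ℝ (fun z ↦ G z (finBasis ℝ E i)) z u (finBasis ℝ E j) =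
      fderiv ℝ G z u (finBasis ℝ E i) (finBasis ℝ E j) := fun i j ↦ by
    rw [(hasFDerivAt_clm_apply_const hG (finBasis ℝ E i)).fderiv]; rfl
  have htr : C.trace = traceCLM E (Γ z u) := by
    rw [traceCLM_apply, LinearMap.trace_eq_matrix_trace ℝ (finBasis ℝ E)]
  have key : ∑ i, (Matrix.updateRow (gram (G z)) i
      (fun j ↦ fderiv ℝ G z u (finBasis ℝ E i) (finBasis ℝ E j))).det =
      2 * (gram (G z)).det * traceCLM E (Γ z u) := by
    simp only [hrow, Matrix.det_updateRow_add, Matrix.det_updateRow_sum, Finset.sum_add_distrib,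
      smul_eq_mul]
    rw [sum_det_updateRow_mul, ← Finset.sum_mul]
    have : ∑ i, C i i = C.trace := rfl
    rw [this, htr]; ring
  refine Eq.trans ?_ key
  refine (ContinuousMultilinearMap.linearDeriv_apply (detCLM (finrank ℝ E)) _ _).trans ?_
  refine Finset.sum_congr rfl fun i _ ↦ ?_
  rw [detCLM_apply]
  refine congrArg Matrix.det ?_
  rw [Matrix.updateRow]
  congr 1
  ext j
  exact hd i j

/-- The logarithm of the density `|det G| ^ (-1 / (2 (N + 1)))` of weight `1`. -/
noncomputable def gramLog (G : E →L[ℝ] E →L[ℝ] ℝ) : ℝ :=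
  -Real.log (gram G).det / (2 * ((finrank ℝ E : ℝ) + 1))

/-- The Gram determinant is multiplied by (det A)², so the exponent -1/(2(N+1)) produces |det
A|^(1/(N+1)), the transition function of weight 1. Since `Real.log` depends only on the absolute
value, the sign of the Gram determinant, that is the signature, plays no role. -/
theorem gramLog_comp {G : E →L[ℝ] E →L[ℝ] ℝ} (hG : (gram G).det ≠ 0) {A : E →L[ℝ] E}
    (hA : A.det ≠ 0) : gramLog G =
      gramLog (G.bilinearComp A A) + Real.log |A.det| / ((finrank ℝ E : ℝ) + 1) := by
  have hN : (finrank ℝ E : ℝ) + 1 ≠ 0 := by positivity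
  rw [gramLog, gramLog, gram_comp, Real.log_mul (pow_ne_zero 2 hA) hG, Real.log_pow, Real.log_abs]
  field_simp
  push_cast
  ring

/-- The form `tr Γ / (N + 1)`. -/
noncomputable def traceForm (Γ : E → E →L[ℝ] E →L[ℝ] E) (z : E) : E →L[ℝ] ℝ :=
  ((finrank ℝ E : ℝ) + 1)⁻¹ • (traceCLM E ∘L Γ z)

/-- This says that the metric density is parallel: on ℰ(1) the induced connection is d + tr Γ/(N+1)
with respect to the coordinate density. -/
theorem hasFDerivAt_gramLog {Γ : E → E →L[ℝ] E →L[ℝ] E} {G : E → E →L[ℝ] E →L[ℝ] ℝ} {z : E}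
    (hG : DifferentiableAt ℝ G z) (h0 : (gram (G z)).det ≠ 0)
    (hm : ∀ u v w, fderiv ℝ G z u v w = G z (Γ z u v) w + G z v (Γ z u w)) :
    HasFDerivAt (fun z ↦ gramLog (G z)) (-traceForm Γ z) z := by
  have h1 := ((hasFDerivAt_det_gram hG hm).log h0).neg.mul_const
    (2 * ((finrank ℝ E : ℝ) + 1))⁻¹
  refine h1.congr_fderiv (ContinuousLinearMap.ext fun u ↦ ?_)
  have hN : (finrank ℝ E : ℝ) + 1 ≠ 0 := by positivity
  simp [traceForm]
  field_simp

theorem contDiffOn_gramLog {G : E → E →L[ℝ] E →L[ℝ] ℝ} {B : Set E} (hG : ContDiffOn ℝ ∞ G B)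
    (h0 : ∀ z ∈ B, (gram (G z)).det ≠ 0) : ContDiffOn ℝ ∞ (fun z ↦ gramLog (G z)) B := by
  have h1 : ContDiffOn ℝ ∞ (fun z ↦ (gram (G z)).det) B :=
    (detCLM (finrank ℝ E)).contDiff.comp_contDiffOn 
      (f := fun z i j ↦ G z (finBasis ℝ E i) (finBasis ℝ E j))
      (contDiffOn_pi.2 fun i ↦ contDiffOn_pi.2 fun j ↦
        (hG.clm_apply contDiffOn_const).clm_apply contDiffOn_const)
  exact (h1.log h0).neg.div_const _

/-- The change from the coordinates `(ν, r)` of a tractor to its components in the splitting given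
by the connection, in the scale given by the metric. -/
noncomputable def scaleMap (Γ : E → E →L[ℝ] E →L[ℝ] E) (G : E → E →L[ℝ] E →L[ℝ] ℝ) (z : E) :
    (E × ℝ) →L[ℝ] (E × ℝ) :=
  Real.exp (gramLog (G z)) • (ContinuousLinearMap.id ℝ (E × ℝ) -
    ContinuousLinearMap.inr ℝ E ℝ ∘L traceForm Γ z ∘L ContinuousLinearMap.fst ℝ E ℝ)

/-- The inverse of `scaleMap`. -/
noncomputable def scaleMapInv (Γ : E → E →L[ℝ] E →L[ℝ] E) (G : E → E →L[ℝ] E →L[ℝ] ℝ) (z : E) :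
    (E × ℝ) →L[ℝ] (E × ℝ) :=
  Real.exp (-gramLog (G z)) • (ContinuousLinearMap.id ℝ (E × ℝ) +
    ContinuousLinearMap.inr ℝ E ℝ ∘L traceForm Γ z ∘L ContinuousLinearMap.fst ℝ E ℝ)

theorem scaleMap_apply (Γ : E → E →L[ℝ] E →L[ℝ] E) (G : E → E →L[ℝ] E →L[ℝ] ℝ) (z : E)
    (x : E × ℝ) : scaleMap Γ G z x =
      Real.exp (gramLog (G z)) • (x.1, x.2 - traceForm Γ z x.1) := by
  simp only [scaleMap, smul_apply]
  congr 1
  ext <;> simp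

theorem scaleMapInv_apply (Γ : E → E →L[ℝ] E →L[ℝ] E) (G : E → E →L[ℝ] E →L[ℝ] ℝ) (z : E)
    (x : E × ℝ) : scaleMapInv Γ G z x =
      Real.exp (-gramLog (G z)) • (x.1, x.2 + traceForm Γ z x.1) := by
  simp only [scaleMapInv, smul_apply]
  congr 1
  ext <;> simp

theorem scaleMapInv_scaleMap (Γ : E → E →L[ℝ] E →L[ℝ] E) (G : E → E →L[ℝ] E →L[ℝ] ℝ) (z : E)
    (x : E × ℝ) : scaleMapInv Γ G z (scaleMap Γ G z x) = x := by
  rw [scaleMap_apply, map_smul, scaleMapInv_apply, smul_smul, ← Real.exp_add]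
  simp

theorem scaleMap_scaleMapInv (Γ : E → E →L[ℝ] E →L[ℝ] E) (G : E → E →L[ℝ] E →L[ℝ] ℝ) (z : E)
    (x : E × ℝ) : scaleMap Γ G z (scaleMapInv Γ G z x) = x := by
  rw [scaleMapInv_apply, map_smul, scaleMap_apply, smul_smul, ← Real.exp_add]
  simp

theorem contDiffOn_traceForm {Γ : E → E →L[ℝ] E →L[ℝ] E} {B : Set E} (hΓ : ContDiffOn ℝ ∞ Γ B) :
    ContDiffOn ℝ ∞ (traceForm Γ) B :=
  (contDiffOn_const.clm_comp hΓ).const_smul _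

theorem contDiffOn_scaleMap {Γ : E → E →L[ℝ] E →L[ℝ] E} {G : E → E →L[ℝ] E →L[ℝ] ℝ} {B : Set E}
    (hΓ : ContDiffOn ℝ ∞ Γ B) (hG : ContDiffOn ℝ ∞ G B) (h0 : ∀ z ∈ B, (gram (G z)).det ≠ 0) :
    ContDiffOn ℝ ∞ (scaleMap Γ G) B :=
  (contDiffOn_gramLog hG h0).exp.smul (contDiffOn_const.sub (contDiffOn_const.clm_comp
    ((contDiffOn_traceForm hΓ).clm_comp contDiffOn_const)))

theorem contDiffOn_scaleMapInv {Γ : E → E →L[ℝ] E →L[ℝ] E} {G : E → E →L[ℝ] E →L[ℝ] ℝ} {B : Set E}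
    (hΓ : ContDiffOn ℝ ∞ Γ B) (hG : ContDiffOn ℝ ∞ G B) (h0 : ∀ z ∈ B, (gram (G z)).det ≠ 0) :
    ContDiffOn ℝ ∞ (scaleMapInv Γ G) B :=
  (contDiffOn_gramLog hG h0).neg.exp.smul (contDiffOn_const.add (contDiffOn_const.clm_comp
    ((contDiffOn_traceForm hΓ).clm_comp contDiffOn_const)))

end GramDeterminant

/-! ### The splitting of the tractor bundle in the metric scale -/

section Splitting

variable {E : Type*} [NormedAddCommGroup E] [NormedSpace ℝ E] [FiniteDimensional ℝ E]
variable {M : Type*} [TopologicalSpace M] [T2Space M] [ChartedSpace E M] [IsManifold 𝓘(ℝ, E) ∞ M]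

/-- The coordinates of a tractor in the chart at `x₀`. -/
noncomputable def tracCoord (x₀ y : M) : Tractor E y →L[ℝ] E × ℝ :=
  (trivializationAt (E × ℝ) (Tractor E : M → Type _) x₀).continuousLinearMapAt ℝ y

/-- The tractor at `y` with given coordinates in the chart at `x₀`. -/
noncomputable def tracVec (x₀ y : M) : E × ℝ →L[ℝ] Tractor E y :=
  (trivializationAt (E × ℝ) (Tractor E : M → Type _) x₀).symmL ℝ y

variable {x₀ y : M}

theorem mem_tractor_baseSet (hy : y ∈ (chartAt E x₀).source) :
    y ∈ (trivializationAt (E × ℝ) (Tractor E : M → Type _) x₀).baseSet := hy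

theorem tracCoord_tracVec (hy : y ∈ (chartAt E x₀).source) (w : E × ℝ) :
    tracCoord x₀ y (tracVec x₀ y w) = w :=
  (trivializationAt (E × ℝ) (Tractor E : M → Type _) x₀).continuousLinearMapAt_symmL
    (mem_tractor_baseSet hy) w

theorem tracVec_tracCoord (hy : y ∈ (chartAt E x₀).source) (v : Tractor E y) :
    tracVec x₀ y (tracCoord x₀ y v) = v :=
  (trivializationAt (E × ℝ) (Tractor E : M → Type _) x₀).symmL_continuousLinearMapAt
    (mem_tractor_baseSet hy) v

theorem tracCoord_apply (hy : y ∈ (chartAt E x₀).source) (v : Tractor E y) :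
    tracCoord x₀ y v = (trivializationAt (E × ℝ) (Tractor E : M → Type _) x₀ ⟨y, v⟩).2 :=
  (trivializationAt (E × ℝ) (Tractor E : M → Type _) x₀).coe_linearMapAt_of_mem (R := ℝ)
    (mem_tractor_baseSet hy) ▸ rfl

theorem tracVec_apply (hy : y ∈ (chartAt E x₀).source) (w : E × ℝ) :
    tracVec x₀ y w = (trivializationAt (E × ℝ) (Tractor E : M → Type _) x₀).symm y w :=
  (trivializationAt (E × ℝ) (Tractor E : M → Type _) x₀).symmL_apply (R := ℝ)
    (mem_tractor_baseSet hy) w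

theorem tracCoord_eq_coordChange (hy : y ∈ (chartAt E x₀).source) :
    tracCoord x₀ y = tractorCoordChange (achart E y) (achart E x₀) y :=
  (tractorCore E M).trivializationAt_continuousLinearMapAt (mem_tractor_baseSet hy)

theorem tracCoord_change (hy : y ∈ (chartAt E x₀).source) (t : Tractor E y) :
    tracCoord x₀ y t =
      tractorCoordChange (achart E y) (achart E x₀) y (tracCoord y y t) := by
  have h1 : tracCoord y y t = t := by
    rw [tracCoord_eq_coordChange (mem_chart_source E y)]
    exact (tractorCore E M).coordChange_self (achart E y) y (mem_chart_source E y) t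
  rw [h1, tracCoord_eq_coordChange hy]
  rfl

theorem gram_chartMetric_ne_zero (g : PseudoRiemannianMetric E M)
    (hy : y ∈ (chartAt E x₀).source) : (gram (chartMetric g x₀ (chartAt E x₀ y))).det ≠ 0 := by
  refine gram_det_ne_zero fun v hv ↦ ?_
  have h1 : tanVec x₀ y v = 0 := g.nondegenerate y _ fun w ↦ by
    rw [← chartMetric_tanCoord g hy, tanCoord_tanVec hy, hv]
  rw [← tanCoord_tanVec hy v, h1, map_zero]

theorem gram_chartMetric_ne_zero' (g : PseudoRiemannianMetric E M) {z : E}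
    (hz : z ∈ (chartAt E x₀).target) : (gram (chartMetric g x₀ z)).det ≠ 0 := by
  have := gram_chartMetric_ne_zero g ((chartAt E x₀).map_target hz)
  rwa [(chartAt E x₀).right_inv hz] at this

theorem tangentChange_tanCoord {x₁ : M} (hy : y ∈ (chartAt E x₀).source)
    (hy' : y ∈ (chartAt E x₁).source) (v : Tan E y) :
    tangentChange (achart E x₀) (achart E x₁) y (tanCoord x₀ y v) = tanCoord x₁ y v := by
  rw [tanCoord_eq_tangentChange hy, tanCoord_eq_tangentChange hy']
  exact DFunLike.congr_fun (tangentChange_comp (achart E y) (achart E x₀) (achart E x₁) y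
    (mem_chart_source E y) hy hy') v

theorem chartMetric_change (g : PseudoRiemannianMetric E M) {x₁ : M}
    (hy : y ∈ (chartAt E x₀).source) (hy' : y ∈ (chartAt E x₁).source) :
    (chartMetric g x₁ (chartAt E x₁ y)).bilinearComp
      (tangentChange (achart E x₀) (achart E x₁) y) (tangentChange (achart E x₀) (achart E x₁) y) =
    chartMetric g x₀ (chartAt E x₀ y) := by
  refine ContinuousLinearMap.ext fun v ↦ ContinuousLinearMap.ext fun w ↦ ?_
  have h1 : ∀ v, tangentChange (achart E x₀) (achart E x₁) y v =
      tanCoord x₁ y (tanVec x₀ y v) := fun v ↦ by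
    rw [← tangentChange_tanCoord hy hy', tanCoord_tanVec hy]
  rw [ContinuousLinearMap.bilinearComp_apply, h1, h1, chartMetric_tanCoord g hy',
    ← chartMetric_tanCoord g hy, tanCoord_tanVec hy, tanCoord_tanVec hy]

/-- The metric density is a density of weight `1`. -/
theorem gramLog_change (g : PseudoRiemannianMetric E M) {x₁ : M}
    (hy : y ∈ (chartAt E x₀).source) (hy' : y ∈ (chartAt E x₁).source) :
    gramLog (chartMetric g x₁ (chartAt E x₁ y)) = gramLog (chartMetric g x₀ (chartAt E x₀ y)) +
      densityLog (achart E x₀) (achart E x₁) y := by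
  rw [gramLog_comp (gram_chartMetric_ne_zero g hy')
    (tangentChange_det_ne (achart E x₀) (achart E x₁) y hy hy'), densityLog,
    chartMetric_change g hy hy']

variable (nabla : Connection E M) (g : PseudoRiemannianMetric E M)

/-- The components, in the chart at `x₀`, of a tractor in the splitting given by `∇`, scaled by the
metric density. -/
noncomputable def pairCoord (x₀ y : M) : Tractor E y →L[ℝ] E × ℝ :=
  scaleMap (christoffel nabla x₀) (chartMetric g x₀) (chartAt E x₀ y) ∘L tracCoord x₀ y

/-- The inverse of `pairCoord`. -/
noncomputable def pairVec (x₀ y : M) : E × ℝ →L[ℝ] Tractor E y :=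
  tracVec x₀ y ∘L scaleMapInv (christoffel nabla x₀) (chartMetric g x₀) (chartAt E x₀ y)

theorem pairCoord_pairVec (hy : y ∈ (chartAt E x₀).source) (w : E × ℝ) :
    pairCoord nabla g x₀ y (pairVec nabla g x₀ y w) = w := by
  simp only [pairCoord, pairVec, ContinuousLinearMap.comp_apply]
  rw [tracCoord_tracVec hy, scaleMap_scaleMapInv]

theorem pairVec_pairCoord (hy : y ∈ (chartAt E x₀).source) (t : Tractor E y) :
    pairVec nabla g x₀ y (pairCoord nabla g x₀ y t) = t := by
  simp only [pairCoord, pairVec, ContinuousLinearMap.comp_apply]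
  rw [scaleMapInv_scaleMap, tracVec_tracCoord hy]

/-- The splitting `𝒯 ≅ TM ⊕ ℝ` given by `∇` and the metric density. -/
noncomputable def split (y : M) : Tractor E y ≃ₗ[ℝ] Tan E y × ℝ :=
  { toFun := fun t ↦ (tanVec y y (pairCoord nabla g y y t).1, (pairCoord nabla g y y t).2)
    map_add' := fun t t' ↦ by simp
    map_smul' := fun c t ↦ by simp
    invFun := fun w ↦ pairVec nabla g y y (tanCoord y y w.1, w.2)
    left_inv := fun t ↦ by
      simp only [tanCoord_tanVec (mem_chart_source E y)]
      exact pairVec_pairCoord nabla g (mem_chart_source E y) t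
    right_inv := fun w ↦ by
      simp only [pairCoord_pairVec nabla g (mem_chart_source E y),
        tanVec_tanCoord (mem_chart_source E y)] }

theorem split_apply (t : Tractor E y) :
    split nabla g y t = (tanVec y y (pairCoord nabla g y y t).1, (pairCoord nabla g y y t).2) := rfl

variable {nabla g}

theorem hasFDerivAt_gramLog_chartMetric (hLC : IsLeviCivita g nabla)
    (hy : y ∈ (chartAt E x₀).source) : HasFDerivAt (fun z ↦ gramLog (chartMetric g x₀ z))
      (-traceForm (christoffel nabla x₀) (chartAt E x₀ y)) (chartAt E x₀ y) :=
  hasFDerivAt_gramLog (hasFDerivAt_of_contDiffOn (chartAt E x₀).open_target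
      (contDiffOn_chartMetric g x₀) ((chartAt E x₀).map_source hy)).differentiableAt
    (gram_chartMetric_ne_zero g hy) fun u v w ↦ fderiv_chartMetric hLC hy u v w

/-- The splitting does not depend on the chart. -/
theorem pairCoord_eq_split (hLC : IsLeviCivita g nabla) (hy : y ∈ (chartAt E x₀).source)
    (t : Tractor E y) :
    pairCoord nabla g x₀ y t = (tanCoord x₀ y (split nabla g y t).1, (split nabla g y t).2) := by
  have hyy := mem_chart_source E y
  have hd : ∀ {x₁ : M}, y ∈ (chartAt E x₁).source →
      HasFDerivAt (fun z ↦ Real.exp (gramLog (chartMetric g x₁ z)))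
        (Real.exp (gramLog (chartMetric g x₁ (chartAt E x₁ y))) •
          -traceForm (christoffel nabla x₁) (chartAt E x₁ y)) (chartAt E x₁ y) := fun h ↦
    (hasFDerivAt_gramLog_chartMetric hLC h).exp
  -- The scalar component of a tractor is its pairing with the 1-jet of the metric density σ: as dσ
  -- = -σ tr Γ/(N+1), the pairing σ ρ + dσ(ν) equals σ (ρ - tr Γ(ν)/(N+1)). Such a pairing is the
  -- same in all charts.
  have h1 := tractorCoordChange_jet (achart E y) (achart E x₀) y hyy hy
    (fun z ↦ Real.exp (gramLog (chartMetric g y z)))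
    (fun z ↦ Real.exp (gramLog (chartMetric g x₀ z))) (hd hy).differentiableAt ?_
    (tracCoord y y t)
  · rw [← tracCoord_change hy] at h1
    have h2 : (pairCoord nabla g x₀ y t).2 = (pairCoord nabla g y y t).2 := by
      have e1 := (hd hy).fderiv
      have e2 := (hd hyy).fderiv
      change _ + (fderiv ℝ (fun z ↦ Real.exp (gramLog (chartMetric g x₀ z))) (chartAt E x₀ y)) _ =
        _ + (fderiv ℝ (fun z ↦ Real.exp (gramLog (chartMetric g y z))) (chartAt E y y)) _ at h1
      rw [e1, e2] at h1
      simp only [pairCoord, ContinuousLinearMap.comp_apply, scaleMap_apply, Prod.smul_snd,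
        smul_eq_mul, mul_add, mul_neg, sub_eq_add_neg]
      simpa using h1
    ext1
    · rw [split_apply]
      simp only
      rw [← tangentChange_tanCoord hyy hy, tanCoord_tanVec hyy]
      simp only [pairCoord, ContinuousLinearMap.comp_apply, scaleMap_apply, Prod.smul_fst]
      rw [gramLog_change g hyy hy, tracCoord_change hy, tractorCoordChange]
      simp [smul_smul, ← Real.exp_add]
    · exact h2
  · have hc := (isOpen_chartOverlap (achart E y) (achart E x₀)).mem_nhds
      (x := (chartAt E y) y) ⟨(chartAt E y).map_source hyy, by
        simpa [(chartAt E y).left_inv hyy] using hy⟩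
    filter_upwards [hc] with z hz
    have h3 := gramLog_change g (x₀ := y) (x₁ := x₀) ((chartAt E y).map_target hz.1) hz.2
    rw [(chartAt E y).right_inv hz.1] at h3
    change Real.exp (gramLog (chartMetric g x₀ (chartAt E x₀ ((chartAt E y).symm z)))) = _
    rw [h3, Real.exp_add, mul_comm]
    rfl

end Splitting

/-! ### The tractor connection in the metric scale -/

section TractorDerivative

variable {E : Type*} [NormedAddCommGroup E] [NormedSpace ℝ E] [FiniteDimensional ℝ E]
variable {M : Type*} [TopologicalSpace M] [T2Space M] [ChartedSpace E M] [IsManifold 𝓘(ℝ, E) ∞ M]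

/-- `(M, g, k)` is a Sasaki–Einstein manifold of dimension at least `2` with Levi-Civita
connection `∇`. -/
structure IsSasakiEinstein (g : PseudoRiemannianMetric E M) (nabla : Connection E M)
    (k : ∀ y : M, Tan E y) : Prop where
  leviCivita : IsLeviCivita g nabla
  sasaki : IsSasaki g nabla k
  einstein : IsEinstein g nabla
  two_le : 2 ≤ finrank ℝ E

/-- The tractor section `s` is differentiable at `y`. -/
def DiffTractorAt (s : ∀ y : M, Tractor E y) (y : M) : Prop :=
  MDifferentiableAt 𝓘(ℝ, E) (𝓘(ℝ, E).prod 𝓘(ℝ, E × ℝ))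
    (fun y ↦ (TotalSpace.mk' (E × ℝ) y (s y) : TotalSpace (E × ℝ) (Tractor E : M → Type _))) y

/-- The tractor section `s` is smooth at `y`. -/
def SmoothTractorAt (s : ∀ y : M, Tractor E y) (y : M) : Prop :=
  ContMDiffAt 𝓘(ℝ, E) (𝓘(ℝ, E).prod 𝓘(ℝ, E × ℝ)) ∞
    (fun y ↦ (TotalSpace.mk' (E × ℝ) y (s y) : TotalSpace (E × ℝ) (Tractor E : M → Type _))) y

theorem SmoothTractorAt.diffTractorAt {s : ∀ y : M, Tractor E y} {y : M}
    (h : SmoothTractorAt s y) : DiffTractorAt s y := ContMDiffAt.mdifferentiableAt h (by simp)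

/-- The coordinate expression of a tractor section in the chart at `x₀`. -/
noncomputable def tracField (x₀ : M) (s : ∀ y : M, Tractor E y) (z : E) : E × ℝ :=
  tracCoord x₀ ((chartAt E x₀).symm z) (s ((chartAt E x₀).symm z))

variable (nabla : Connection E M) (g : PseudoRiemannianMetric E M)

/-- The components of a tractor section in the splitting, in the chart at `x₀`. -/
noncomputable def sectionCoord (x₀ : M) (s : ∀ y : M, Tractor E y) (z : E) : E × ℝ :=
  pairCoord nabla g x₀ ((chartAt E x₀).symm z) (s ((chartAt E x₀).symm z))

variable {x₀ y : M} {s : ∀ y : M, Tractor E y}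

theorem sectionCoord_chartAt (hy : y ∈ (chartAt E x₀).source) :
    sectionCoord nabla g x₀ s (chartAt E x₀ y) = pairCoord nabla g x₀ y (s y) := by
  rw [sectionCoord, (chartAt E x₀).left_inv hy]

theorem sectionCoord_eq_scaleMap {z : E} (hz : z ∈ (chartAt E x₀).target) :
    sectionCoord nabla g x₀ s z =
      scaleMap (christoffel nabla x₀) (chartMetric g x₀) z (tracField x₀ s z) := by
  rw [sectionCoord, pairCoord, (chartAt E x₀).right_inv hz]
  rfl

theorem tracField_eq_scaleMapInv {z : E} (hz : z ∈ (chartAt E x₀).target) :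
    tracField x₀ s z =
      scaleMapInv (christoffel nabla x₀) (chartMetric g x₀) z (sectionCoord nabla g x₀ s z) := by
  rw [sectionCoord_eq_scaleMap nabla g hz, scaleMapInv_scaleMap]

theorem eventually_target (hy : y ∈ (chartAt E x₀).source) :
    ∀ᶠ z in 𝓝 (chartAt E x₀ y), z ∈ (chartAt E x₀).target :=
  (chartAt E x₀).open_target.mem_nhds ((chartAt E x₀).map_source hy)

theorem eventually_source (hy : y ∈ (chartAt E x₀).source) :
    ∀ᶠ z in 𝓝 y, z ∈ (chartAt E x₀).source :=
  (chartAt E x₀).open_source.mem_nhds hy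

theorem tracField_eventuallyEq (hy : y ∈ (chartAt E x₀).source) (s : ∀ y : M, Tractor E y) :
    tracField x₀ s =ᶠ[𝓝 (chartAt E x₀ y)]
      (fun y ↦ (trivializationAt (E × ℝ) (Tractor E : M → Type _) x₀ ⟨y, s y⟩).2) ∘
        (chartAt E x₀).symm := by
  filter_upwards [eventually_target hy] with z hz
  exact tracCoord_apply ((chartAt E x₀).map_target hz) _

theorem diffTractorAt_iff_tracField (hy : y ∈ (chartAt E x₀).source) :
    DiffTractorAt s y ↔ DifferentiableAt ℝ (tracField x₀ s) (chartAt E x₀ y) := by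
  rw [DiffTractorAt, (tracField_eventuallyEq hy s).differentiableAt_iff,
    (trivializationAt (E × ℝ) (Tractor E : M → Type _) x₀).mdifferentiableAt_section_iff _ _
      (mem_tractor_baseSet hy)]
  exact ⟨differentiableAt_comp_chart_symm hy, mdifferentiableAt_of_comp_chart_symm hy⟩

theorem smoothTractorAt_iff_tracField (hy : y ∈ (chartAt E x₀).source) :
    SmoothTractorAt s y ↔ ContDiffAt ℝ ∞ (tracField x₀ s) (chartAt E x₀ y) := by
  rw [SmoothTractorAt, (trivializationAt (E × ℝ) (Tractor E : M → Type _) x₀).contMDiffAt_section_iff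
      (mem_tractor_baseSet hy)]
  refine ⟨fun h ↦ (contDiffAt_comp_chart_symm (n := ⊤) hy h).congr_of_eventuallyEq
    (tracField_eventuallyEq hy s), fun h ↦ contMDiffAt_of_comp_chart_symm (n := ⊤) hy
    (h.congr_of_eventuallyEq (tracField_eventuallyEq hy s).symm)⟩

variable {nabla g}

theorem contDiffAt_scaleMap (hLC : IsLeviCivita g nabla) (hy : y ∈ (chartAt E x₀).source) :
    ContDiffAt ℝ ∞ (scaleMap (christoffel nabla x₀) (chartMetric g x₀)) (chartAt E x₀ y) ∧
    ContDiffAt ℝ ∞ (scaleMapInv (christoffel nabla x₀) (chartMetric g x₀)) (chartAt E x₀ y) :=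
  ⟨(contDiffOn_scaleMap (contDiffOn_christoffel hLC.smooth x₀) (contDiffOn_chartMetric g x₀)
    fun _ hz ↦ gram_chartMetric_ne_zero' g hz).contDiffAt (eventually_target hy),
  (contDiffOn_scaleMapInv (contDiffOn_christoffel hLC.smooth x₀) (contDiffOn_chartMetric g x₀)
    fun _ hz ↦ gram_chartMetric_ne_zero' g hz).contDiffAt (eventually_target hy)⟩

theorem diffTractorAt_iff (hLC : IsLeviCivita g nabla) (hy : y ∈ (chartAt E x₀).source) :
    DiffTractorAt s y ↔ DifferentiableAt ℝ (sectionCoord nabla g x₀ s) (chartAt E x₀ y) := by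
  rw [diffTractorAt_iff_tracField hy]
  refine ⟨fun h ↦ ?_, fun h ↦ ?_⟩
  · refine DifferentiableAt.congr_of_eventuallyEq
      (((contDiffAt_scaleMap hLC hy).1.differentiableAt (by simp)).clm_apply h) ?_
    filter_upwards [eventually_target hy] with z hz using sectionCoord_eq_scaleMap nabla g hz
  · refine DifferentiableAt.congr_of_eventuallyEq
      (((contDiffAt_scaleMap hLC hy).2.differentiableAt (by simp)).clm_apply h) ?_
    filter_upwards [eventually_target hy] with z hz using tracField_eq_scaleMapInv nabla g hz

theorem smoothTractorAt_iff (hLC : IsLeviCivita g nabla) (hy : y ∈ (chartAt E x₀).source) :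
    SmoothTractorAt s y ↔ ContDiffAt ℝ ∞ (sectionCoord nabla g x₀ s) (chartAt E x₀ y) := by
  rw [smoothTractorAt_iff_tracField hy]
  refine ⟨fun h ↦ ?_, fun h ↦ ?_⟩
  · refine ContDiffAt.congr_of_eventuallyEq ((contDiffAt_scaleMap hLC hy).1.clm_apply h) ?_
    filter_upwards [eventually_target hy] with z hz using sectionCoord_eq_scaleMap nabla g hz
  · refine ContDiffAt.congr_of_eventuallyEq ((contDiffAt_scaleMap hLC hy).2.clm_apply h) ?_
    filter_upwards [eventually_target hy] with z hz using tracField_eq_scaleMapInv nabla g hz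

/-- The frame in the definition agrees near y with the coordinate fields, and ∇ is local. The sum
over the frame is then the trace of Γ(v). -/
theorem densityForm_eq_traceForm (nabla : Connection E M) (hy : y ∈ (chartAt E x₀).source)
    (v : Tan E y) : densityForm nabla x₀ y v =
      traceForm (christoffel nabla x₀) (chartAt E x₀ y) (tanCoord x₀ y v) := by
  have h1 : ∀ w : E, nabla (fun z ↦ (trivializationAt E (TangentSpace 𝓘(ℝ, E)) x₀).symm z w) y =
      nabla (chartField x₀ w) y := fun w ↦ by
    refine (nabla_congr nabla (smoothFieldAt_chartField hy w).diffFieldAt ?_).symm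
    filter_upwards [eventually_source hy] with z hz using tanVec_apply hz w
  rw [densityForm, LinearMap.smul_apply]
  rw [traceForm, smul_apply, ContinuousLinearMap.comp_apply, traceCLM_apply,
    trace_eq_sum_coord (finBasis ℝ E)]
  refine congrArg (((finrank ℝ E : ℝ) + 1)⁻¹ * ·) ?_
  rw [LinearMap.sum_apply]
  refine Finset.sum_congr rfl fun i _ ↦ ?_
  refine congrArg ((finBasis ℝ E).coord i) ?_
  have h2 := tanCoord_nabla_chartField nabla hy (tanCoord x₀ y v) (finBasis ℝ E i)
  rw [chartField, tanVec_tanCoord hy] at h2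
  refine Eq.trans ?_ h2
  change tanCoord x₀ y (nabla (fun z ↦ (trivializationAt E (TangentSpace 𝓘(ℝ, E)) x₀).symm z
    (finBasis ℝ E i)) y v) = _
  rw [h1]

/-- With Ric = (N - 1) g the numerator of P is (N + 1)(N - 1) g. The division by N - 1 is where
dimension at least 2 is needed. -/
theorem schouten_eq_metric {k : ∀ y : M, Tan E y} (h : IsSasakiEinstein g nabla k) (x : M)
    (v w : Tan E x) : schouten nabla x v w = g.inner x v w := by
  have hx := mem_chart_source E x
  have h1 : ∀ v w : Tan E x, ricci nabla x v w = ((finrank ℝ E : ℝ) - 1) * g.inner x v w := by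
    intro v w
    rw [ricci_eq_ricciLM h.leviCivita.toIsTorsionFreeAffine hx,
      (sasakiChart h.leviCivita h.sasaki h.einstein x).ricciLM_eq ((chartAt E x).map_source hx),
      chartMetric_tanCoord g hx]
  have h2 : (2 : ℝ) ≤ finrank ℝ E := by exact_mod_cast h.two_le
  have h3 : (finrank ℝ E : ℝ) - 1 ≠ 0 := by linarith
  have h4 : (finrank ℝ E : ℝ) + 1 ≠ 0 := by linarith
  rw [schouten, h1, h1, g.symm x w v]
  field_simp

theorem tractorCoord_eq (hy : y ∈ (chartAt E x₀).source) :
    tractorCoord s x₀ y = tracCoord x₀ y (s y) := (tracCoord_apply hy (s y)).symm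

theorem topPart_eq (hy : y ∈ (chartAt E x₀).source) :
    topPart s x₀ y = tanVec x₀ y (tracCoord x₀ y (s y)).1 := by
  rw [topPart, tractorCoord_eq hy, tanVec_apply hy]

theorem bottomPart_eq (nabla : Connection E M) (hy : y ∈ (chartAt E x₀).source) :
    bottomPart nabla s x₀ y = (tracCoord x₀ y (s y)).2 -
      traceForm (christoffel nabla x₀) (chartAt E x₀ y) (tracCoord x₀ y (s y)).1 := by
  rw [bottomPart, tractorCoord_eq hy, topPart_eq hy, densityForm_eq_traceForm nabla hy,
    tanCoord_tanVec hy]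

theorem fieldCoord_topPart (hy : y ∈ (chartAt E x₀).source) (s : ∀ y : M, Tractor E y) :
    fieldCoord x₀ (topPart s x₀) =ᶠ[𝓝 (chartAt E x₀ y)] fun z ↦ (tracField x₀ s z).1 := by
  filter_upwards [eventually_target hy] with z hz
  have hz' := (chartAt E x₀).map_target hz
  rw [fieldCoord, topPart_eq hz', tanCoord_tanVec hz']
  rfl

theorem bottomPart_comp_chart (nabla : Connection E M) (hy : y ∈ (chartAt E x₀).source)
    (s : ∀ y : M, Tractor E y) : bottomPart nabla s x₀ ∘ (chartAt E x₀).symm =ᶠ[𝓝 (chartAt E x₀ y)]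
      fun z ↦ (tracField x₀ s z).2 - traceForm (christoffel nabla x₀) z (tracField x₀ s z).1 := by
  filter_upwards [eventually_target hy] with z hz
  have hz' := (chartAt E x₀).map_target hz
  rw [Function.comp_apply, bottomPart_eq nabla hz', (chartAt E x₀).right_inv hz]
  rfl

theorem differentiableAt_traceForm (h : CovariantDerivative.ContMDiffCovariantDerivative nabla ∞)
    (hy : y ∈ (chartAt E x₀).source) :
    DifferentiableAt ℝ (traceForm (christoffel nabla x₀)) (chartAt E x₀ y) :=
  (hasFDerivAt_of_contDiffOn (chartAt E x₀).open_target
    (contDiffOn_traceForm (contDiffOn_christoffel h x₀))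
    ((chartAt E x₀).map_source hy)).differentiableAt

theorem diffFieldAt_topPart (hy : y ∈ (chartAt E x₀).source) (hs : DiffTractorAt s y) :
    DiffFieldAt (topPart s x₀) y := by
  rw [diffFieldAt_iff hy, (fieldCoord_topPart hy s).differentiableAt_iff]
  exact ((diffTractorAt_iff_tracField hy).1 hs).fst

theorem mdifferentiableAt_bottomPart
    (h : CovariantDerivative.ContMDiffCovariantDerivative nabla ∞)
    (hy : y ∈ (chartAt E x₀).source) (hs : DiffTractorAt s y) :
    MDifferentiableAt 𝓘(ℝ, E) 𝓘(ℝ, ℝ) (bottomPart nabla s x₀) y := by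
  refine mdifferentiableAt_of_comp_chart_symm hy ?_
  rw [(bottomPart_comp_chart nabla hy s).differentiableAt_iff]
  have h1 := (diffTractorAt_iff_tracField hy).1 hs
  exact h1.snd.sub ((differentiableAt_traceForm h hy).clm_apply h1.fst)

/-- The tractor connection in the splitting. -/
theorem split_tractorDeriv {k : ∀ y : M, Tan E y} (h : IsSasakiEinstein g nabla k) {x : M}
    (hs : DiffTractorAt s x) (v : Tan E x) :
    split nabla g x (tractorDeriv nabla s x v) =
      (nabla (fun y ↦ (split nabla g y (s y)).1) x v + (split nabla g x (s x)).2 • v,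
        mvfderiv 𝓘(ℝ, E) (fun y ↦ (split nabla g y (s y)).2) x v -
          g.inner x v (split nabla g x (s x)).1) := by
  have hx := mem_chart_source E x
  have hLC := h.leviCivita
  let e : M → ℝ := fun y ↦ Real.exp (gramLog (chartMetric g x (chartAt E x y)))
  have he1 : e ∘ (chartAt E x).symm =ᶠ[𝓝 (chartAt E x x)]
      fun z ↦ Real.exp (gramLog (chartMetric g x z)) := by
    filter_upwards [eventually_target hx] with z hz
    simp only [e, Function.comp_apply, (chartAt E x).right_inv hz]
  have he2 := (hasFDerivAt_gramLog_chartMetric hLC hx).exp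
  have he3 : MDifferentiableAt 𝓘(ℝ, E) 𝓘(ℝ, ℝ) e x :=
    mdifferentiableAt_of_comp_chart_symm hx
      (he1.differentiableAt_iff.2 he2.differentiableAt)
  -- The metric density is parallel; its derivative therefore supplies exactly the terms by which ∇
  -- is coupled to ℰ(-1) in the definition of the tractor connection.
  have he4 : mvfderiv 𝓘(ℝ, E) e x v = -(e x * densityForm nabla x x v) := by
    rw [mvfderiv_eq_fderiv hx he3, he1.fderiv_eq, he2.fderiv, densityForm_eq_traceForm nabla hx]
    simp [e]
  have hX : ∀ᶠ y in 𝓝 x, (split nabla g y (s y)).1 = (e • topPart s x) y := by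
    filter_upwards [eventually_source hx] with y hy
    have h1 : (pairCoord nabla g x y (s y)).1 = tanCoord x y (split nabla g y (s y)).1 :=
      by rw [pairCoord_eq_split hLC hy]
    rw [← tanVec_tanCoord hy (split nabla g y (s y)).1, ← h1]
    simp only [pairCoord, ContinuousLinearMap.comp_apply, scaleMap_apply, Pi.smul_apply',
      Prod.smul_fst, map_smul]
    rw [topPart_eq hy]
  have hf : ∀ᶠ y in 𝓝 x, (split nabla g y (s y)).2 = (e * bottomPart nabla s x) y := by
    filter_upwards [eventually_source hx] with y hy
    have h1 : (pairCoord nabla g x y (s y)).2 = (split nabla g y (s y)).2 :=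
      by rw [pairCoord_eq_split hLC hy]
    rw [← h1, Pi.mul_apply, bottomPart_eq nabla hy]
    simp only [pairCoord, ContinuousLinearMap.comp_apply, scaleMap_apply, Prod.smul_snd]
    rfl
  have hdt := diffFieldAt_topPart hx hs
  have hdb := mdifferentiableAt_bottomPart hLC.smooth hx hs
  have hX' : nabla (fun y ↦ (split nabla g y (s y)).1) x v =
      e x • nabla (topPart s x) x v + -(e x * densityForm nabla x x v) • topPart s x x := by
    have h1 : DiffFieldAt (e • topPart s x) x := he3.smul_section hdt
    rw [← nabla_congr nabla h1 (hX.mono fun _ h ↦ h.symm), nabla_smul nabla hdt he3, he4]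
  have hf' : mvfderiv 𝓘(ℝ, E) (fun y ↦ (split nabla g y (s y)).2) x v =
      e x * mvfderiv 𝓘(ℝ, E) (bottomPart nabla s x) x v +
        -(e x * densityForm nabla x x v) * bottomPart nabla s x x := by
    have h1 : MDifferentiableAt 𝓘(ℝ, E) 𝓘(ℝ, ℝ) (e * bottomPart nabla s x) x := he3.mul hdb
    have h2 : mvfderiv 𝓘(ℝ, E) (fun y ↦ (split nabla g y (s y)).2) x =
        mvfderiv 𝓘(ℝ, E) (e * bottomPart nabla s x) x := by
      have h3 := Filter.EventuallyEq.mfderiv_eq (I := 𝓘(ℝ, E)) (I' := 𝓘(ℝ, ℝ)) hf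
      ext v
      exact DFunLike.congr_fun h3 v
    rw [h2, mvfderiv_mul he3 hdb]
    simp only [add_apply, smul_apply, smul_eq_mul, he4]
    ring
  rw [hX', hf', hX.self_of_nhds, hf.self_of_nhds]
  -- The tractor connection returns a tractor through its bundle coordinates. Passing to the
  -- splitting removes the shift by the density form and multiplies by the metric density.
  have key : ∀ (a : Tan E x) (b : ℝ), split nabla g x
      ((trivializationAt (E × ℝ) (Tractor E : M → Type _) x).symm x
        ((trivializationAt E (TangentSpace 𝓘(ℝ, E)) x).linearMapAt ℝ x a,
          b + densityForm nabla x x a)) = (e x • a, e x * b) := by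
    intro a b
    rw [← tracVec_apply hx, split_apply]
    change (tanVec x x (pairCoord nabla g x x (tracVec x x (tanCoord x x a, _))).1, _) = _
    simp only [pairCoord, ContinuousLinearMap.comp_apply]
    change (tanVec x x (scaleMap _ _ _ (tracCoord x x (tracVec x x (tanCoord x x a, _)))).1,
      (scaleMap _ _ _ (tracCoord x x (tracVec x x (tanCoord x x a, _)))).2) = _
    rw [tracCoord_tracVec hx, scaleMap_apply, densityForm_eq_traceForm nabla hx]
    simp [e, tanVec_tanCoord hx]
  refine (key _ _).trans ?_
  rw [schouten_eq_metric h]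
  ext1
  · simp only [Pi.mul_apply, smul_add, smul_sub, smul_smul, neg_smul]
    abel
  · simp only [Pi.smul_apply', map_smul, smul_eq_mul]
    ring

theorem sectionCoord_eq_split (hLC : IsLeviCivita g nabla) {z : E}
    (hz : z ∈ (chartAt E x₀).target) : sectionCoord nabla g x₀ s z =
      (fieldCoord x₀ (fun y ↦ (split nabla g y (s y)).1) z,
        (split nabla g ((chartAt E x₀).symm z) (s ((chartAt E x₀).symm z))).2) :=
  pairCoord_eq_split hLC ((chartAt E x₀).map_target hz) _

/-- The tractor connection in the chart at `x₀`. -/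
theorem pairCoord_tractorDeriv {k : ∀ y : M, Tan E y} (h : IsSasakiEinstein g nabla k)
    (hy : y ∈ (chartAt E x₀).source) (hs : DiffTractorAt s y) (v : Tan E y) :
    pairCoord nabla g x₀ y (tractorDeriv nabla s y v) =
      fderiv ℝ (sectionCoord nabla g x₀ s) (chartAt E x₀ y) (tanCoord x₀ y v) +
      coneForm (christoffel nabla x₀) (chartMetric g x₀) (chartAt E x₀ y) (tanCoord x₀ y v)
        (pairCoord nabla g x₀ y (s y)) := by
  have hLC := h.leviCivita
  have hd := (diffTractorAt_iff hLC hy).1 hs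
  have h1 : (fun z ↦ (sectionCoord nabla g x₀ s z).1) =ᶠ[𝓝 (chartAt E x₀ y)]
      fieldCoord x₀ (fun y ↦ (split nabla g y (s y)).1) := by
    filter_upwards [eventually_target hy] with z hz
    rw [sectionCoord_eq_split hLC hz]
  have h2 : (fun z ↦ (sectionCoord nabla g x₀ s z).2) =ᶠ[𝓝 (chartAt E x₀ y)]
      (fun y ↦ (split nabla g y (s y)).2) ∘ (chartAt E x₀).symm := by
    filter_upwards [eventually_target hy] with z hz
    rw [sectionCoord_eq_split hLC hz]
    rfl
  have hX : DiffFieldAt (fun y ↦ (split nabla g y (s y)).1) y :=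
    (diffFieldAt_iff hy).2 (h1.differentiableAt_iff.1 hd.fst)
  have hf : MDifferentiableAt 𝓘(ℝ, E) 𝓘(ℝ, ℝ) (fun y ↦ (split nabla g y (s y)).2) y :=
    mdifferentiableAt_of_comp_chart_symm hy (h2.differentiableAt_iff.1 hd.snd)
  rw [pairCoord_eq_split hLC hy, split_tractorDeriv h hs, pairCoord_eq_split hLC hy, coneForm_apply]
  simp only
  have e1 : fderiv ℝ (sectionCoord nabla g x₀ s) (chartAt E x₀ y) =
      (fderiv ℝ (fun z ↦ (sectionCoord nabla g x₀ s z).1) (chartAt E x₀ y)).prod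
        (fderiv ℝ (fun z ↦ (sectionCoord nabla g x₀ s z).2) (chartAt E x₀ y)) :=
    (hd.fst.hasFDerivAt.prodMk hd.snd.hasFDerivAt).fderiv
  rw [e1, h1.fderiv_eq, h2.fderiv_eq, map_add, map_smul, tanCoord_nabla nabla hy hX,
    mvfderiv_eq_fderiv hy hf, ← chartMetric_tanCoord g hy]
  ext1
  · simp only [ContinuousLinearMap.prod_apply, Prod.fst_add]
    abel
  · simp only [ContinuousLinearMap.prod_apply, Prod.snd_add]
    abel

end TractorDerivative

/-! ### Projective invariance of the tractor connection -/

section ProjectiveChange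

variable {E : Type*} [NormedAddCommGroup E] [NormedSpace ℝ E] [FiniteDimensional ℝ E]

/-- The bilinear form `∇Υ - Υ ⊗ Υ`, by which the projective Schouten tensor changes. -/
noncomputable def projForm (Γ : E → E →L[ℝ] E →L[ℝ] E) (U : E → E →L[ℝ] ℝ) (z : E) :
    E →ₗ[ℝ] E →ₗ[ℝ] ℝ :=
  LinearMap.mk₂ ℝ (fun v w ↦ fderiv ℝ U z v w - U z (Γ z v w) - U z v * U z w)
    (fun v v' w ↦ by simp only [map_add, add_apply]; ring)
    (fun c v w ↦ by simp only [map_smul, smul_apply, smul_eq_mul]; ring)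
    (fun v w w' ↦ by simp only [map_add]; ring)
    (fun c v w ↦ by simp only [map_smul, smul_eq_mul]; ring)

theorem projForm_apply (Γ : E → E →L[ℝ] E →L[ℝ] E) (U : E → E →L[ℝ] ℝ) (z v w : E) :
    projForm Γ U z v w = fderiv ℝ U z v w - U z (Γ z v w) - U z v * U z w := rfl

/-- The change of the curvature under a projective change of connection. -/
theorem curvLM_projective {Γ Γ' : E → E →L[ℝ] E →L[ℝ] E} {U : E → E →L[ℝ] ℝ} {z : E}
    (hΓ : DifferentiableAt ℝ Γ z) (hΓ' : DifferentiableAt ℝ Γ' z) (hU : DifferentiableAt ℝ U z)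
    (hs : ∀ u w, Γ z u w = Γ z w u)
    (he : ∀ᶠ y in 𝓝 z, ∀ u w, Γ' y u w = Γ y u w + U y u • w + U y w • u) (u v w : E) :
    curvLM Γ' z u v w = curvLM Γ z u v w +
      (projForm Γ U z u v - projForm Γ U z v u) • w + projForm Γ U z u w • v -
        projForm Γ U z v w • u := by
  have hd : ∀ u v w, fderiv ℝ Γ' z u v w =
      fderiv ℝ Γ z u v w + fderiv ℝ U z u v • w + fderiv ℝ U z u w • v := by
    intro u v w
    have h1 : (fun y ↦ Γ' y v w) =ᶠ[𝓝 z] fun y ↦ Γ y v w + U y v • w + U y w • v :=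
      he.mono fun y hy ↦ hy v w
    have h2 := (((hasFDerivAt_clm_apply_const (hΓ.clm_apply (differentiableAt_const v)) w).add
      ((hasFDerivAt_clm_apply_const hU v).smul_const w)).add
        ((hasFDerivAt_clm_apply_const hU w).smul_const v))
    rw [fderiv_clm_apply_const₂ hΓ', h1.fderiv_eq]
    refine (congrArg (fun L : E →L[ℝ] E ↦ L u) h2.fderiv).trans ?_
    simp only [add_apply, ContinuousLinearMap.smulRight_apply, ContinuousLinearMap.flip_apply]
    rw [← fderiv_clm_apply_const hΓ]
  have h0 := he.self_of_nhds
  simp only [curvLM_apply, connCurv, sub_apply, add_apply, mul_apply_eq_comp, hd, h0, map_add,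
    map_smul, projForm_apply, hs v u]
  module

/-- The change of the Ricci tensor under a projective change of connection. -/
theorem ricciLM_projective {Γ Γ' : E → E →L[ℝ] E →L[ℝ] E} {Q : E →ₗ[ℝ] E →ₗ[ℝ] ℝ} {z : E}
    (h : ∀ u v w, curvLM Γ' z u v w = curvLM Γ z u v w + (Q u v - Q v u) • w + Q u w • v -
      Q v w • u) (v w : E) :
    ricciLM Γ' z v w = ricciLM Γ z v w + Q w v - (finrank ℝ E : ℝ) * Q v w := by
  have h1 : (((curvLM Γ' z).flip v).flip w) = (((curvLM Γ z).flip v).flip w) +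
      (Q.flip v).smulRight w - (Q v).smulRight w + (Q.flip w).smulRight v -
        Q v w • LinearMap.id := by
    ext u
    simp only [LinearMap.flip_apply, h, LinearMap.add_apply, LinearMap.sub_apply,
      LinearMap.smulRight_apply, LinearMap.smul_apply, LinearMap.id_apply]
    module
  rw [ricciLM, h1]
  simp only [map_add, map_sub, map_smul, LinearMap.trace_smulRight, LinearMap.trace_id, smul_eq_mul,
    LinearMap.flip_apply, ricciLM]
  ring

variable {M : Type*} [TopologicalSpace M] [T2Space M] [ChartedSpace E M] [IsManifold 𝓘(ℝ, E) ∞ M]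

/-- The one-form of a projective change of connection, in the chart at `x₀`. -/
noncomputable def changeForm (nabla nabla' : Connection E M) (x₀ : M) (z : E) : E →L[ℝ] ℝ :=
  traceForm (christoffel nabla' x₀) z - traceForm (christoffel nabla x₀) z

variable {nabla nabla' : Connection E M} {x₀ y : M}

/-- Taking the trace over w of Υ(u) w + Υ(w) u gives (N + 1) Υ(u). Hence the 1-form is the
difference of the two trace forms, which makes its coordinate expression smooth without further
argument. -/
theorem christoffel_projective (h' : nabla' ∈ projectiveClass nabla) {z : E}
    (hz : z ∈ (chartAt E x₀).target) (u w : E) :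
    christoffel nabla' x₀ z u w = christoffel nabla x₀ z u w +
      changeForm nabla nabla' x₀ z u • w + changeForm nabla nabla' x₀ z w • u := by
  obtain ⟨-, U, -, hU⟩ := h'
  have hy := (chartAt E x₀).map_target hz
  have h1 : ∀ u w : E, christoffel nabla' x₀ z u w = christoffel nabla x₀ z u w +
      U _ (tanVec x₀ ((chartAt E x₀).symm z) u) • w +
        U _ (tanVec x₀ ((chartAt E x₀).symm z) w) • u := by
    intro u w
    have h2 := hU (chartField x₀ w) _ (smoothFieldAt_chartField hy w).diffFieldAt
      (chartField x₀ u ((chartAt E x₀).symm z))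
    have h3 := tanCoord_nabla_chartField nabla' hy u w
    have h4 := tanCoord_nabla_chartField nabla hy u w
    rw [h2, map_add, map_add, map_smul, map_smul, h4, (chartAt E x₀).right_inv hz] at h3
    simp only [chartField, tanCoord_tanVec hy] at h3
    exact h3.symm
  have h2 : ∀ u : E, changeForm nabla nabla' x₀ z u =
      U _ (tanVec x₀ ((chartAt E x₀).symm z) u) := by
    intro u
    have h3 : (christoffel nabla' x₀ z u : E →ₗ[ℝ] E) =
        (christoffel nabla x₀ z u : E →ₗ[ℝ] E) +
        U _ (tanVec x₀ ((chartAt E x₀).symm z) u) • LinearMap.id +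
          (U _ ∘ₗ (tanVec (E := E) x₀ ((chartAt E x₀).symm z)).toLinearMap).smulRight u := by
      ext w
      exact h1 u w
    have hN : (finrank ℝ E : ℝ) + 1 ≠ 0 := by positivity
    simp only [changeForm, traceForm, sub_apply, smul_apply, ContinuousLinearMap.comp_apply,
      traceCLM_apply, h3, map_add, map_smul, LinearMap.trace_id, LinearMap.trace_smulRight]
    simp only [smul_eq_mul, LinearMap.comp_apply, ContinuousLinearMap.coe_coe]
    field_simp
    ring
  rw [h1, h2, h2]

/-- Put Q = ∇Υ - Υ ⊗ Υ, which need not be symmetric. The Ricci tensor changes by Q(w,v) - N Q(v,w).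
In the combination N Ric(v,w) + Ric(w,v) the transposed terms cancel and (1 - N²) Q(v,w) remains. -/
theorem schouten_projective (hdim : 2 ≤ finrank ℝ E) (h : IsTorsionFreeAffine nabla)
    (h' : nabla' ∈ projectiveClass nabla) (hy : y ∈ (chartAt E x₀).source) (v w : Tan E y) :
    schouten nabla' y v w = schouten nabla y v w -
      projForm (christoffel nabla x₀) (changeForm nabla nabla' x₀) (chartAt E x₀ y)
        (tanCoord x₀ y v) (tanCoord x₀ y w) := by
  have hd := differentiableAt_christoffel (x₀ := x₀) h.smooth hy
  have hd' := differentiableAt_christoffel (x₀ := x₀) h'.1.smooth hy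
  have hU : DifferentiableAt ℝ (changeForm nabla nabla' x₀) (chartAt E x₀ y) :=
    (differentiableAt_traceForm h'.1.smooth hy).sub (differentiableAt_traceForm h.smooth hy)
  have h1 := ricciLM_projective (curvLM_projective hd hd' hU (christoffel_symm h hy) (by
    filter_upwards [eventually_target hy] with z hz using christoffel_projective h' hz))
  have h2 : (2 : ℝ) ≤ finrank ℝ E := by exact_mod_cast hdim
  have h3 : (finrank ℝ E : ℝ) - 1 ≠ 0 := by linarith
  have h4 : (finrank ℝ E : ℝ) + 1 ≠ 0 := by linarith
  rw [schouten, schouten, ricci_eq_ricciLM h hy, ricci_eq_ricciLM h hy,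
    ricci_eq_ricciLM h'.1 hy, ricci_eq_ricciLM h'.1 hy, h1, h1]
  field_simp
  ring

/-- The tractor connection depends only on the projective class. -/
theorem tractorDeriv_projective (hdim : 2 ≤ finrank ℝ E) (h : IsTorsionFreeAffine nabla)
    (h' : nabla' ∈ projectiveClass nabla) {x : M} {s : ∀ y : M, Tractor E y}
    (hs : DiffTractorAt s x) (v : Tan E x) :
    tractorDeriv nabla' s x v = tractorDeriv nabla s x v := by
  have hx := mem_chart_source E x
  have hd := differentiableAt_christoffel (x₀ := x) h.smooth hx
  have hU : DifferentiableAt ℝ (changeForm nabla nabla' x) (chartAt E x x) :=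
    (differentiableAt_traceForm h'.1.smooth hx).sub (differentiableAt_traceForm h.smooth hx)
  have ht := diffFieldAt_topPart hx hs
  have hb := mdifferentiableAt_bottomPart h.smooth hx hs
  have hb' := mdifferentiableAt_bottomPart h'.1.smooth hx hs
  have e1 : ∀ w : Tan E x, densityForm nabla' x x w = densityForm nabla x x w +
      changeForm nabla nabla' x (chartAt E x x) (tanCoord x x w) := by
    intro w
    rw [densityForm_eq_traceForm nabla' hx, densityForm_eq_traceForm nabla hx, changeForm,
      sub_apply]
    ring
  have e2 : bottomPart nabla' s x x = bottomPart nabla s x x -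
      changeForm nabla nabla' x (chartAt E x x) (tanCoord x x (topPart s x x)) := by
    rw [bottomPart, bottomPart, e1]
    ring
  have e3 : tanCoord x x (nabla' (topPart s x) x v) = tanCoord x x (nabla (topPart s x) x v) +
      changeForm nabla nabla' x (chartAt E x x) (tanCoord x x v) • tanCoord x x (topPart s x x) +
      changeForm nabla nabla' x (chartAt E x x) (tanCoord x x (topPart s x x)) •
        tanCoord x x v := by
    rw [tanCoord_nabla nabla' hx ht, tanCoord_nabla nabla hx ht,
      christoffel_projective h' ((chartAt E x).map_source hx)]
    abel
  have e4 : mvfderiv 𝓘(ℝ, E) (bottomPart nabla' s x) x v =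
      mvfderiv 𝓘(ℝ, E) (bottomPart nabla s x) x v -
        (fderiv ℝ (changeForm nabla nabla' x) (chartAt E x x) (tanCoord x x v)
          (tanCoord x x (topPart s x x)) + changeForm nabla nabla' x (chartAt E x x)
            (fderiv ℝ (fieldCoord x (topPart s x)) (chartAt E x x) (tanCoord x x v))) := by
    have h1 := (diffFieldAt_iff hx).1 ht
    have h2 : bottomPart nabla' s x ∘ (chartAt E x).symm =ᶠ[𝓝 (chartAt E x x)]
        fun z ↦ (bottomPart nabla s x ∘ (chartAt E x).symm) z -
          changeForm nabla nabla' x z (fieldCoord x (topPart s x) z) := by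
      filter_upwards [eventually_target hx] with z hz
      have hz' := (chartAt E x).map_target hz
      simp only [Function.comp_apply]
      rw [bottomPart, bottomPart, densityForm_eq_traceForm nabla' hz',
        densityForm_eq_traceForm nabla hz', (chartAt E x).right_inv hz, changeForm, sub_apply,
        fieldCoord]
      ring
    have h3 := (differentiableAt_comp_chart_symm hx hb).hasFDerivAt.sub
      (hU.hasFDerivAt.clm_apply h1.hasFDerivAt)
    rw [mvfderiv_eq_fderiv hx hb', mvfderiv_eq_fderiv hx hb, h2.fderiv_eq]
    refine (congrArg (fun L : E →L[ℝ] ℝ ↦ L (tanCoord x x v)) h3.fderiv).trans ?_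
    simp only [sub_apply, add_apply, ContinuousLinearMap.comp_apply,
      ContinuousLinearMap.flip_apply, fieldCoord_chartAt hx]
    ring
  have e5 := schouten_projective hdim h h' hx v (topPart s x x)
  rw [projForm_apply] at e5
  have e6 := tanCoord_nabla nabla hx ht v
  -- The tangential component is unchanged: ∇' contributes Υ(v) ν + Υ(ν) v, the weight of ℰ(-1)
  -- removes the first term, and the changed splitting removes the second.
  have ea : nabla' (topPart s x) x v - densityForm nabla' x x v • topPart s x x
        + bottomPart nabla' s x x • v =
      nabla (topPart s x) x v - densityForm nabla x x v • topPart s x x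
        + bottomPart nabla s x x • v := by
    have h1 : tanCoord x x (nabla' (topPart s x) x v - densityForm nabla' x x v • topPart s x x
        + bottomPart nabla' s x x • v) = tanCoord x x (nabla (topPart s x) x v -
          densityForm nabla x x v • topPart s x x + bottomPart nabla s x x • v) := by
      simp only [map_add, map_sub, map_smul, e1, e2, e3]
      module
    rw [← tanVec_tanCoord hx (_ + _), h1, tanVec_tanCoord hx]
  rw [tractorDeriv, tractorDeriv, ea]
  refine congrArg _ (Prod.ext rfl ?_)
  -- In the scalar coordinate, the derivative of Υ which comes from the changed splitting cancels
  -- the one in the change of the Schouten tensor. The remaining terms cancel against Υ evaluated on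
  -- the tangential component.
  rw [e1 (_ + _), e1, e2, e4, e5]
  simp only [map_add, map_sub, map_smul, smul_eq_mul, e6]
  ring

end ProjectiveChange

/-! ### The parallel complex structure and metric on the tractor bundle -/

section HermitianStructure

variable {E : Type*} [NormedAddCommGroup E] [NormedSpace ℝ E] [FiniteDimensional ℝ E]
variable {M : Type*} [TopologicalSpace M] [T2Space M] [ChartedSpace E M] [IsManifold 𝓘(ℝ, E) ∞ M]

/-- The complex structure `(X, f) ↦ (∇_X k + f k, - g(k, X))` of the tractor bundle. -/
noncomputable def tractorJ (nabla : Connection E M) (g : PseudoRiemannianMetric E M)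
    (k : ∀ y : M, Tan E y) (y : M) : Tractor E y →ₗ[ℝ] Tractor E y where
  toFun t := (split nabla g y).symm
    (nabla k y (split nabla g y t).1 + (split nabla g y t).2 • k y,
      -g.inner y (k y) (split nabla g y t).1)
  map_add' s t := by
    rw [← map_add, map_add (split nabla g y)]
    refine congrArg _ (Prod.ext ?_ ?_)
    · simp only [Prod.fst_add, Prod.snd_add, map_add, add_smul]
      abel
    · simp only [Prod.fst_add, Prod.snd_add, map_add]
      ring
  map_smul' c t := by
    rw [← map_smul, map_smul (split nabla g y)]
    refine congrArg _ (Prod.ext ?_ ?_)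
    · simp only [Prod.smul_fst, Prod.smul_snd, map_smul, smul_add, smul_smul, smul_eq_mul,
        RingHom.id_apply]
    · simp only [Prod.smul_fst, Prod.smul_snd, map_smul, smul_eq_mul, RingHom.id_apply]
      ring

/-- The metric `g(X, X') + f f'` of the tractor bundle. -/
noncomputable def tractorH (nabla : Connection E M) (g : PseudoRiemannianMetric E M) (y : M) :
    Tractor E y →ₗ[ℝ] Tractor E y →ₗ[ℝ] ℝ :=
  LinearMap.mk₂ ℝ (fun s t ↦ g.inner y (split nabla g y s).1 (split nabla g y t).1 +
      (split nabla g y s).2 * (split nabla g y t).2)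
    (fun s s' t ↦ by simp only [map_add, Prod.fst_add, Prod.snd_add, add_apply]; ring)
    (fun c s t ↦ by
      simp only [map_smul, Prod.smul_fst, Prod.smul_snd, smul_apply, smul_eq_mul]; ring)
    (fun s t t' ↦ by simp only [map_add, Prod.fst_add, Prod.snd_add]; ring)
    (fun c s t ↦ by simp only [map_smul, Prod.smul_fst, Prod.smul_snd, smul_eq_mul]; ring)

variable {nabla : Connection E M} {g : PseudoRiemannianMetric E M} {k : ∀ y : M, Tan E y}
variable {x₀ y : M}

theorem pairCoord_injective (hy : y ∈ (chartAt E x₀).source) {s t : Tractor E y}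
    (h : pairCoord nabla g x₀ y s = pairCoord nabla g x₀ y t) : s = t := by
  rw [← pairVec_pairCoord nabla g hy s, h, pairVec_pairCoord nabla g hy]

theorem IsSasakiEinstein.chart (h : IsSasakiEinstein g nabla k) (x₀ : M) :
    SasakiChart (chartAt E x₀).target (christoffel nabla x₀) (chartMetric g x₀)
      (fieldCoord x₀ k) :=
  sasakiChart h.leviCivita h.sasaki h.einstein x₀

theorem pairCoord_tractorJ (h : IsSasakiEinstein g nabla k) (hy : y ∈ (chartAt E x₀).source)
    (t : Tractor E y) : pairCoord nabla g x₀ y (tractorJ nabla g k y t) =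
      coneJ (christoffel nabla x₀) (chartMetric g x₀) (fieldCoord x₀ k) (chartAt E x₀ y)
        (pairCoord nabla g x₀ y t) := by
  have hk : SmoothFieldAt k y := h.sasaki.killing.1.contMDiffAt
  rw [pairCoord_eq_split h.leviCivita hy, pairCoord_eq_split h.leviCivita hy, coneJ_apply]
  have h1 : split nabla g y (tractorJ nabla g k y t) =
      (nabla k y (split nabla g y t).1 + (split nabla g y t).2 • k y,
      -g.inner y (k y) (split nabla g y t).1) := (split nabla g y).apply_symm_apply _
  rw [h1, fieldCoord_chartAt hy, chartMetric_tanCoord g hy,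
    ← tanCoord_nabla_eq_covField nabla hy hk.diffFieldAt, map_add, map_smul]

theorem tractorH_eq_coneH (hLC : IsLeviCivita g nabla) (hy : y ∈ (chartAt E x₀).source)
    (s t : Tractor E y) : tractorH nabla g y s t =
      coneH (chartMetric g x₀) (chartAt E x₀ y) (pairCoord nabla g x₀ y s)
        (pairCoord nabla g x₀ y t) := by
  rw [pairCoord_eq_split hLC hy, pairCoord_eq_split hLC hy, coneH, chartMetric_tanCoord g hy]
  rfl

theorem tractorJ_tractorJ (h : IsSasakiEinstein g nabla k) (t : Tractor E y) :
    tractorJ nabla g k y (tractorJ nabla g k y t) = -t := by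
  have hy := mem_chart_source E y
  refine pairCoord_injective (nabla := nabla) (g := g) hy ?_
  rw [pairCoord_tractorJ h hy, pairCoord_tractorJ h hy, map_neg]
  exact DFunLike.congr_fun ((h.chart y).coneJ_mul_self ((chartAt E y).map_source hy)) _

theorem tractorH_tractorJ (h : IsSasakiEinstein g nabla k) (s t : Tractor E y) :
    tractorH nabla g y (tractorJ nabla g k y s) (tractorJ nabla g k y t) =
      tractorH nabla g y s t := by
  have hy := mem_chart_source E y
  rw [tractorH_eq_coneH h.leviCivita hy, pairCoord_tractorJ h hy, pairCoord_tractorJ h hy,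
    (h.chart y).coneH_coneJ ((chartAt E y).map_source hy), ← tractorH_eq_coneH h.leviCivita hy]

theorem tractorH_symm (s t : Tractor E y) : tractorH nabla g y s t = tractorH nabla g y t s := by
  change g.inner y _ _ + _ = g.inner y _ _ + _
  rw [g.symm, mul_comm]

theorem tractorH_nondegenerate (s : Tractor E y) (hs : ∀ t, tractorH nabla g y t s = 0) :
    s = 0 := by
  have h1 : ∀ w : Tan E y × ℝ, g.inner y w.1 (split nabla g y s).1 +
      w.2 * (split nabla g y s).2 = 0 := by
    intro w
    have h2 := hs ((split nabla g y).symm w)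
    change g.inner y (split nabla g y ((split nabla g y).symm w)).1 _ +
      (split nabla g y ((split nabla g y).symm w)).2 * _ = 0 at h2
    rwa [LinearEquiv.apply_symm_apply] at h2
  refine (split nabla g y).map_eq_zero_iff.1 (Prod.ext ?_ ?_)
  · refine g.nondegenerate y _ fun w ↦ ?_
    have h2 := h1 (w, 0)
    rw [g.symm]
    simpa using h2
  · simpa using h1 (0, 1)

variable {s t : ∀ y : M, Tractor E y}

theorem sectionCoord_tractorJ (h : IsSasakiEinstein g nabla k) (hy : y ∈ (chartAt E x₀).source) :
    sectionCoord nabla g x₀ (fun y ↦ tractorJ nabla g k y (s y)) =ᶠ[𝓝 (chartAt E x₀ y)]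
      fun z ↦ coneJ (christoffel nabla x₀) (chartMetric g x₀) (fieldCoord x₀ k) z
        (sectionCoord nabla g x₀ s z) := by
  filter_upwards [eventually_target hy] with z hz
  rw [sectionCoord, pairCoord_tractorJ h ((chartAt E x₀).map_target hz),
    (chartAt E x₀).right_inv hz]
  rfl

theorem smoothTractorAt_tractorJ (h : IsSasakiEinstein g nabla k) (hs : SmoothTractorAt s y) :
    SmoothTractorAt (fun y ↦ tractorJ nabla g k y (s y)) y := by
  have hy := mem_chart_source E y
  rw [smoothTractorAt_iff h.leviCivita hy] at hs ⊢
  exact ((((h.chart y).smooth_coneJ.contDiffAt (eventually_target hy)).clm_apply hs)).congr_of_eventuallyEq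
    (sectionCoord_tractorJ h hy)

theorem tractorDeriv_tractorJ (h : IsSasakiEinstein g nabla k) (hs : DiffTractorAt s y)
    (v : Tan E y) : tractorDeriv nabla (fun y ↦ tractorJ nabla g k y (s y)) y v =
      tractorJ nabla g k y (tractorDeriv nabla s y v) := by
  have hy := mem_chart_source E y
  have hyt := (chartAt E y).map_source hy
  have hd := (diffTractorAt_iff h.leviCivita hy).1 hs
  have hJ := (hasFDerivAt_of_contDiffOn (h.chart y).isOpen (h.chart y).smooth_coneJ hyt)
  have hs' : DiffTractorAt (fun y ↦ tractorJ nabla g k y (s y)) y :=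
    (diffTractorAt_iff h.leviCivita hy).2 ((sectionCoord_tractorJ h hy).differentiableAt_iff.2
      (hJ.differentiableAt.clm_apply hd))
  refine pairCoord_injective (nabla := nabla) (g := g) hy ?_
  rw [pairCoord_tractorJ h hy, pairCoord_tractorDeriv h hy hs', pairCoord_tractorDeriv h hy hs,
    (sectionCoord_tractorJ h hy).fderiv_eq, (hJ.clm_apply hd.hasFDerivAt).fderiv,
    pairCoord_tractorJ h hy, ← sectionCoord_chartAt nabla g hy]
  simp only [add_apply, ContinuousLinearMap.comp_apply, ContinuousLinearMap.flip_apply, map_add,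
    (h.chart y).fderiv_coneJ hyt, sub_apply, mul_apply_eq_comp]
  abel

theorem tractorH_comp_chart (hLC : IsLeviCivita g nabla) (hy : y ∈ (chartAt E x₀).source)
    (s t : ∀ y : M, Tractor E y) :
    (fun y ↦ tractorH nabla g y (s y) (t y)) ∘ (chartAt E x₀).symm =ᶠ[𝓝 (chartAt E x₀ y)]
      fun z ↦ coneH (chartMetric g x₀) z (sectionCoord nabla g x₀ s z)
        (sectionCoord nabla g x₀ t z) := by
  filter_upwards [eventually_target hy] with z hz
  rw [Function.comp_apply, tractorH_eq_coneH hLC ((chartAt E x₀).map_target hz),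
    (chartAt E x₀).right_inv hz]
  rfl

theorem contMDiffAt_tractorH (h : IsSasakiEinstein g nabla k) (hs : SmoothTractorAt s y)
    (ht : SmoothTractorAt t y) :
    ContMDiffAt 𝓘(ℝ, E) 𝓘(ℝ, ℝ) ∞ (fun y ↦ tractorH nabla g y (s y) (t y)) y := by
  have hy := mem_chart_source E y
  rw [smoothTractorAt_iff h.leviCivita hy] at hs ht
  refine contMDiffAt_of_comp_chart_symm (n := ⊤) hy (ContDiffAt.congr_of_eventuallyEq ?_
    (tractorH_comp_chart h.leviCivita hy s t))
  exact ((((h.chart y).smooth_G.contDiffAt (eventually_target hy)).clm_apply hs.fst).clm_apply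
    ht.fst).add (hs.snd.mul ht.snd)

theorem mvfderiv_tractorH (h : IsSasakiEinstein g nabla k) (hs : DiffTractorAt s y)
    (ht : DiffTractorAt t y) (v : Tan E y) :
    mvfderiv 𝓘(ℝ, E) (fun y ↦ tractorH nabla g y (s y) (t y)) y v =
      tractorH nabla g y (tractorDeriv nabla s y v) (t y) +
        tractorH nabla g y (s y) (tractorDeriv nabla t y v) := by
  have hy := mem_chart_source E y
  have hyt := (chartAt E y).map_source hy
  have hds := (diffTractorAt_iff h.leviCivita hy).1 hs
  have hdt := (diffTractorAt_iff h.leviCivita hy).1 ht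
  have h1 := (h.chart y).hasFDerivAt_coneH (c := fun z ↦ z) hyt rfl (hasFDerivAt_id _) hds.hasFDerivAt
    hdt.hasFDerivAt (tanCoord y y v)
  have h2 := tractorH_comp_chart h.leviCivita hy s t
  rw [mvfderiv_eq_fderiv hy (mdifferentiableAt_of_comp_chart_symm hy
    (h2.differentiableAt_iff.2 h1.1)), h2.fderiv_eq, tractorH_eq_coneH h.leviCivita hy,
    tractorH_eq_coneH h.leviCivita hy, pairCoord_tractorDeriv h hy hs,
    pairCoord_tractorDeriv h hy ht, ← sectionCoord_chartAt nabla g hy,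
    ← sectionCoord_chartAt nabla g hy]
  exact h1.2

end HermitianStructure

/-! ### Parallel forms on the tractor bundle from coordinate forms -/

section ParallelForms

/-- The parameter space is arbitrary so that one rule serves twice: with P = E for sections over a
chart, and with P = ℝ for fields along a curve. -/
theorem IsParallelOn.hasFDerivAt_comp {E F P : Type*} [NormedAddCommGroup E] [NormedSpace ℝ E]
    [NormedAddCommGroup F] [NormedSpace ℝ F] [NormedAddCommGroup P] [NormedSpace ℝ P]
    {A : E → E →L[ℝ] F →L[ℝ] F} {m : ℕ} {ψ : E → F [⋀^Fin m]→ₗ[ℝ] ℂ} {B : Set E}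
    (h : IsParallelOn A ψ B) (hB : IsOpen B) {c : P → E} {X : P → Fin m → F} {p : P}
    (hp : c p ∈ B) {c' : P →L[ℝ] E} {X' : P →L[ℝ] Fin m → F}
    (hc : HasFDerivAt c c' p) (hX : HasFDerivAt X X' p) (u : P) :
    DifferentiableAt ℝ (fun q ↦ ψ (c q) (X q)) p ∧
    fderiv ℝ (fun q ↦ ψ (c q) (X q)) p u =
      ∑ j, ψ (c p) (Function.update (X p) j (X' u j + A (c p) (c' u) (X p j))) := by
  have h1 := hasFDerivAt_of_contDiffOn (hB.prod isOpen_univ) h.smooth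
    (z := (c p, X p)) ⟨hp, trivial⟩
  have h2 := HasFDerivAt.comp (g := fun p : E × (Fin m → F) ↦ ψ p.1 p.2)
    (f := fun q ↦ (c q, X q)) p h1 (hc.prodMk hX)
  refine ⟨h2.differentiableAt, ?_⟩
  refine (congrArg (fun T : P →L[ℝ] ℂ ↦ T u) h2.fderiv).trans ?_
  exact h.parallel (c p) hp (X p) (c' u) (X' u)

variable {E : Type*} [NormedAddCommGroup E] [NormedSpace ℝ E] [FiniteDimensional ℝ E]
variable {M : Type*} [TopologicalSpace M] [T2Space M] [ChartedSpace E M] [IsManifold 𝓘(ℝ, E) ∞ M]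

/-- The form field on the tractor bundle which is given by `ψ` in the chart at `x₀`. -/
noncomputable def pullForm (nabla : Connection E M) (g : PseudoRiemannianMetric E M) (x₀ : M)
    {m : ℕ} (ψ : E → (E × ℝ) [⋀^Fin m]→ₗ[ℝ] ℂ) (y : M) : Tractor E y [⋀^Fin m]→ₗ[ℝ] ℂ :=
  (ψ (chartAt E x₀ y)).compLinearMap (pairCoord nabla g x₀ y).toLinearMap

variable {nabla : Connection E M} {g : PseudoRiemannianMetric E M} {k : ∀ y : M, Tan E y}
variable {x₀ y : M} {m : ℕ} {ψ : E → (E × ℝ) [⋀^Fin m]→ₗ[ℝ] ℂ} {B : Set E}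

theorem pullForm_apply (u : Fin m → Tractor E y) : pullForm nabla g x₀ ψ y u =
    ψ (chartAt E x₀ y) (fun i ↦ pairCoord nabla g x₀ y (u i)) := rfl

theorem isComplexForm_pullForm (h : IsSasakiEinstein g nabla k) (hy : y ∈ (chartAt E x₀).source)
    (hψ : IsComplexForm (coneJ (christoffel nabla x₀) (chartMetric g x₀) (fieldCoord x₀ k)
      (chartAt E x₀ y) : (E × ℝ) →ₗ[ℝ] E × ℝ) (ψ (chartAt E x₀ y))) :
    IsComplexForm (tractorJ nabla g k y) (pullForm nabla g x₀ ψ y) := by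
  intro u i
  rw [pullForm_apply, pullForm_apply, ← hψ]
  congr 1
  ext1 j
  rcases eq_or_ne j i with rfl | hj
  · rw [Function.update_self, Function.update_self, pairCoord_tractorJ h hy]
    rfl
  · rw [Function.update_of_ne hj, Function.update_of_ne hj]

theorem pullForm_ne_zero (hy : y ∈ (chartAt E x₀).source) (hψ : ψ (chartAt E x₀ y) ≠ 0) :
    pullForm nabla g x₀ ψ y ≠ 0 := by
  intro h0
  refine hψ (AlternatingMap.ext fun u ↦ ?_)
  have h1 := DFunLike.congr_fun h0 (fun i ↦ pairVec nabla g x₀ y (u i))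
  rw [pullForm_apply] at h1
  simp only [pairCoord_pairVec nabla g hy] at h1
  exact h1

theorem pullForm_comp_chart (hy : y ∈ (chartAt E x₀).source) (s : Fin m → ∀ y : M, Tractor E y) :
    (fun y ↦ pullForm nabla g x₀ ψ y (fun i ↦ s i y)) ∘ (chartAt E x₀).symm
      =ᶠ[𝓝 (chartAt E x₀ y)] fun z ↦ ψ z (fun i ↦ sectionCoord nabla g x₀ (s i) z) := by
  filter_upwards [eventually_target hy] with z hz
  rw [Function.comp_apply, pullForm_apply, (chartAt E x₀).right_inv hz]
  rfl

variable {s : Fin m → ∀ y : M, Tractor E y}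

theorem contMDiffAt_pullForm (h : IsSasakiEinstein g nabla k) (hB : IsOpen B)
    (hψ : IsParallelOn (coneForm (christoffel nabla x₀) (chartMetric g x₀)) ψ B)
    (hy : y ∈ (chartAt E x₀).source) (hyB : chartAt E x₀ y ∈ B)
    (hs : ∀ i, SmoothTractorAt (s i) y) :
    ContMDiffAt 𝓘(ℝ, E) 𝓘(ℝ, ℂ) ∞ (fun y ↦ pullForm nabla g x₀ ψ y (fun i ↦ s i y)) y := by
  refine contMDiffAt_of_comp_chart_symm (n := ⊤) hy (ContDiffAt.congr_of_eventuallyEq ?_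
    (pullForm_comp_chart hy s))
  have h1 : ContDiffAt ℝ ∞ (fun z ↦ (z, fun i ↦ sectionCoord nabla g x₀ (s i) z))
      (chartAt E x₀ y) :=
    contDiffAt_id.prodMk (contDiffAt_pi.2 fun i ↦ (smoothTractorAt_iff h.leviCivita hy).1 (hs i))
  exact ContDiffAt.comp (g := fun p : E × (Fin m → E × ℝ) ↦ ψ p.1 p.2) _
    (hψ.smooth.contDiffAt ((hB.prod isOpen_univ).mem_nhds ⟨hyB, trivial⟩)) h1

/-- In the chart, the derivative of the components plus the cone form is the tractor derivative, by
`pairCoord_tractorDeriv`. Parallelism of the coordinate form then carries over to the bundle. -/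
theorem mvfderiv_pullForm (h : IsSasakiEinstein g nabla k) (hB : IsOpen B)
    (hψ : IsParallelOn (coneForm (christoffel nabla x₀) (chartMetric g x₀)) ψ B)
    (hy : y ∈ (chartAt E x₀).source) (hyB : chartAt E x₀ y ∈ B)
    (hs : ∀ i, DiffTractorAt (s i) y) (v : Tan E y) :
    mvfderiv 𝓘(ℝ, E) (fun y ↦ pullForm nabla g x₀ ψ y (fun i ↦ s i y)) y v =
      ∑ i, pullForm nabla g x₀ ψ y
        (Function.update (fun j ↦ s j y) i (tractorDeriv nabla (s i) y v)) := by
  have hd := fun i ↦ (diffTractorAt_iff h.leviCivita hy).1 (hs i)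
  have h1 := hψ.hasFDerivAt_comp hB (c := fun z ↦ z) hyB (hasFDerivAt_id _)
    (hasFDerivAt_pi.2 fun i ↦ (hd i).hasFDerivAt) (tanCoord x₀ y v)
  have h2 := pullForm_comp_chart (nabla := nabla) (g := g) (ψ := ψ) hy s
  rw [mvfderiv_eq_fderiv hy (mdifferentiableAt_of_comp_chart_symm hy
    (h2.differentiableAt_iff.2 h1.1)), h2.fderiv_eq, h1.2]
  refine Finset.sum_congr rfl fun i _ ↦ ?_
  rw [pullForm_apply]
  congr 1
  ext1 j
  rcases eq_or_ne j i with rfl | hj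
  · rw [Function.update_self, Function.update_self, pairCoord_tractorDeriv h hy (hs j),
      ← sectionCoord_chartAt nabla g hy]
    rfl
  · rw [Function.update_of_ne hj, Function.update_of_ne hj, sectionCoord_chartAt nabla g hy]

end ParallelForms

/-! ### Parallel transport along curves in a fixed chart -/

section Curves

/-- A continuous function on `[0, 1]` whose derivative vanishes off a finite set has equal values at
the end points. -/
theorem eq_of_hasDerivAt_zero_off_finset {F : Type*} [NormedAddCommGroup F] [NormedSpace ℝ F]
    [CompleteSpace F] {φ : ℝ → F} {S : Finset ℝ} (hc : ContinuousOn φ (Set.Icc 0 1))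
    (hd : ∀ t ∈ Set.Ioo (0 : ℝ) 1, t ∉ S → HasDerivAt φ 0 t) : φ 1 = φ 0 := by
  have h1 := MeasureTheory.integral_eq_of_hasDerivAt_off_countable_of_le φ (fun _ ↦ 0) zero_le_one
    S.countable_toSet hc (fun t ht ↦ hd t ht.1 ht.2) intervalIntegrable_const
  rw [intervalIntegral.integral_zero] at h1
  exact (sub_eq_zero.1 h1.symm)

variable {E : Type*} [NormedAddCommGroup E] [NormedSpace ℝ E] [FiniteDimensional ℝ E]
variable {M : Type*} [TopologicalSpace M] [T2Space M] [ChartedSpace E M] [IsManifold 𝓘(ℝ, E) ∞ M]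

/-- A time off the finite set S has a closed interval around it which lies in (0, 1) and misses S,
and on this interval the curve is C¹. -/
theorem PiecewiseC1.mdifferentiableAt {S : Finset ℝ} {c : ℝ → M} (h : PiecewiseC1 E S c) {t : ℝ}
    (ht : t ∈ Set.Ioo (0 : ℝ) 1) (htS : t ∉ S) : MDifferentiableAt 𝓘(ℝ, ℝ) 𝓘(ℝ, E) c t := by
  have h1 : Set.Ioo (0 : ℝ) 1 ∩ (S : Set ℝ)ᶜ ∈ 𝓝 t :=
    Filter.inter_mem (Ioo_mem_nhds ht.1 ht.2) (S.finite_toSet.isClosed.isOpen_compl.mem_nhds htS)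
  obtain ⟨ε, hε, hsub⟩ := Metric.nhds_basis_closedBall.mem_iff.1 h1
  rw [Real.closedBall_eq_Icc] at hsub
  have h2 := (hsub ⟨le_rfl, by linarith⟩).1
  have h3 := (hsub ⟨by linarith, le_rfl⟩).1
  have h4 := h.2 (t - ε) (t + ε) h2.1.le (by linarith) h3.2.le
    fun r hr hr' ↦ (hsub ⟨hr'.1.le, hr'.2.le⟩).2 hr
  exact (h4.contMDiffAt (Icc_mem_nhds (by linarith) (by linarith))).mdifferentiableAt one_ne_zero

variable {nabla nabla' : Connection E M} {g : PseudoRiemannianMetric E M} {k : ∀ y : M, Tan E y}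
variable {x₀ y x₁ : M}

theorem smoothTractorAt_tracVec (hy : y ∈ (chartAt E x₁).source) (w : E × ℝ) :
    SmoothTractorAt (fun y ↦ tracVec x₁ y w) y := by
  rw [smoothTractorAt_iff_tracField hy]
  refine contDiffAt_const (c := w) |>.congr_of_eventuallyEq ?_
  filter_upwards [eventually_target hy] with z hz
  exact tracCoord_tracVec ((chartAt E x₁).map_target hz) w

/-- The change from bundle coordinates at `x₁` to the components in the splitting at `x₀`. -/
noncomputable def pairChange (nabla : Connection E M) (g : PseudoRiemannianMetric E M) (x₀ x₁ : M)
    (z : E) : E × ℝ →L[ℝ] E × ℝ :=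
  pairCoord nabla g x₀ ((chartAt E x₀).symm z) ∘L tracVec x₁ ((chartAt E x₀).symm z)

theorem differentiableAt_pairChange (hLC : IsLeviCivita g nabla)
    (hy : y ∈ (chartAt E x₀).source) (hy' : y ∈ (chartAt E x₁).source) :
    DifferentiableAt ℝ (pairChange nabla g x₀ x₁) (chartAt E x₀ y) := by
  have ho : IsOpen ((chartAt E x₀).target ∩ (chartAt E x₀).symm ⁻¹' (chartAt E x₁).source) :=
    (chartAt E x₀).symm.isOpen_inter_preimage (chartAt E x₁).open_source
  have h1 : ContDiffOn ℝ ∞ (pairChange nabla g x₀ x₁)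
      ((chartAt E x₀).target ∩ (chartAt E x₀).symm ⁻¹' (chartAt E x₁).source) := by
    refine contDiffOn_clm_apply.2 fun w z hz ↦ ContDiffAt.contDiffWithinAt ?_
    have h2 := (smoothTractorAt_iff hLC ((chartAt E x₀).map_target hz.1)).1
      (smoothTractorAt_tracVec hz.2 w)
    rwa [(chartAt E x₀).right_inv hz.1] at h2
  refine (hasFDerivAt_of_contDiffOn ho h1 ⟨(chartAt E x₀).map_source hy, ?_⟩).differentiableAt
  rwa [Set.mem_preimage, (chartAt E x₀).left_inv hy]

theorem diffTractorAt_extend (u : Tractor E y) : DiffTractorAt (FiberBundle.extend (E × ℝ) u) y := by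
  obtain ⟨s, hs, h⟩ := FiberBundle.exists_contMDiffOn_extend 𝓘(ℝ, E) (E × ℝ) (k := ∞) u
  exact (h.contMDiffAt hs).mdifferentiableAt (by simp)

theorem smoothTractorNear_extend (u : Tractor E y) :
    ∀ᶠ z in 𝓝 y, SmoothTractorAt (FiberBundle.extend (E × ℝ) u) z := by
  obtain ⟨s, hs, h⟩ := FiberBundle.exists_contMDiffOn_extend 𝓘(ℝ, E) (E × ℝ) (k := ∞) u
  filter_upwards [eventually_mem_nhds_iff.2 hs] with z hz using h.contMDiffAt hz

/-- `FiberBundle.extend` has constant coordinates in the bundle chart at y, which is the kind of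
section entering the definition of a parallel field along a curve. -/
theorem sectionCoord_extend (hy : y ∈ (chartAt E x₀).source) (u : Tractor E y) :
    sectionCoord nabla g x₀ (FiberBundle.extend (E × ℝ) u) =ᶠ[𝓝 (chartAt E x₀ y)]
      fun z ↦ pairChange nabla g x₀ y z (tracCoord y y u) := by
  have h1 : ContinuousAt (chartAt E x₀).symm (chartAt E x₀ y) :=
    (chartAt E x₀).continuousAt_symm ((chartAt E x₀).map_source hy)
  rw [ContinuousAt, (chartAt E x₀).left_inv hy] at h1
  filter_upwards [h1.eventually (eventually_source (mem_chart_source E y))] with z hz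
  rw [sectionCoord, pairChange, ContinuousLinearMap.comp_apply, tracVec_apply hz,
    tracCoord_apply (mem_chart_source E y)]
  rfl

theorem hasDerivAt_chartAt_comp {c : ℝ → M} {t : ℝ}
    (hc : MDifferentiableAt 𝓘(ℝ, ℝ) 𝓘(ℝ, E) c t) (hy : c t ∈ (chartAt E x₀).source) :
    HasDerivAt (fun r ↦ chartAt E x₀ (c r))
      (tanCoord x₀ (c t) (mfderiv 𝓘(ℝ, ℝ) 𝓘(ℝ, E) c t (1 : ℝ))) t := by
  have h2 := ((contMDiffAt_chartAt hy).mdifferentiableAt (by simp)).hasMFDerivAt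
  have h3 := h2.comp t hc.hasMFDerivAt
  rw [mfderiv_chartAt hy] at h3
  have h4 : HasFDerivAt (F := E) (fun r ↦ chartAt E x₀ (c r))
      ((tanCoord x₀ (c t)).comp (mfderiv 𝓘(ℝ, ℝ) 𝓘(ℝ, E) c t) : ℝ →L[ℝ] E) t :=
    hasMFDerivAt_iff_hasFDerivAt.1 h3
  exact h4.hasDerivAt

theorem hasDerivAt_clm_comp_apply {F : Type*} [NormedAddCommGroup F] [NormedSpace ℝ F]
    {Φ : E → F →L[ℝ] F} {x : ℝ → E} {T : ℝ → F} {x' : E} {T' : F} {t : ℝ}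
    (hΦ : DifferentiableAt ℝ Φ (x t)) (hx : HasDerivAt x x' t) (hT : HasDerivAt T T' t) :
    HasDerivAt (fun r ↦ Φ (x r) (T r)) (fderiv ℝ Φ (x t) x' (T t) + Φ (x t) T') t :=
  (hΦ.hasFDerivAt.comp_hasDerivAt t hx).clm_apply hT

/-- The transport equation at time t is written in the bundle chart centred at the point of the
curve at that time. The product rule for `pairChange` rewrites it in the chart at x₀, which stays
fixed as t varies. -/
theorem hasDerivAt_pairCoord_of_trivialization (hLC : IsLeviCivita g nabla)
    {V : ℝ → TotalSpace (E × ℝ) (Tractor E : M → Type _)} {t : ℝ} {c' : E}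
    (hy : (V t).proj ∈ (chartAt E x₀).source) (hc : ContinuousAt (fun r ↦ (V r).proj) t)
    (hc' : HasDerivAt (fun r ↦ chartAt E x₀ (V r).proj) c' t) {D : Tractor E (V t).proj}
    (hT : HasDerivAt
      (fun r ↦ (trivializationAt (E × ℝ) (Tractor E : M → Type _) (V t).proj (V r)).2)
      (-tracCoord (V t).proj (V t).proj D) t) :
    HasDerivAt (fun r ↦ pairCoord nabla g x₀ (V r).proj (V r).2)
      (fderiv ℝ (pairChange nabla g x₀ (V t).proj) (chartAt E x₀ (V t).proj) c'
        (tracCoord (V t).proj (V t).proj (V t).2) - pairCoord nabla g x₀ (V t).proj D) t := by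
  have hyy := mem_chart_source E (V t).proj
  have h3 := differentiableAt_pairChange hLC hy hyy
  have h4 := hasDerivAt_clm_comp_apply h3 hc' hT
  have h7 : ∀ᶠ r in 𝓝 t, (V r).proj ∈ (chartAt E x₀).source ∧
      (V r).proj ∈ (chartAt E (V t).proj).source :=
    (hc.eventually (eventually_source hy)).and (hc.eventually (eventually_source hyy))
  have h8 : ∀ u : Tractor E (V t).proj, pairChange nabla g x₀ (V t).proj
      (chartAt E x₀ (V t).proj) (tracCoord (V t).proj (V t).proj u) =
        pairCoord nabla g x₀ (V t).proj u := by
    intro u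
    rw [pairChange, (chartAt E x₀).left_inv hy, ContinuousLinearMap.comp_apply,
      tracVec_tracCoord hyy]
  refine (h4.congr_of_eventuallyEq ?_).congr_deriv ?_
  · filter_upwards [h7] with r hr
    change _ = pairChange nabla g x₀ (V t).proj (chartAt E x₀ (V r).proj) _
    rw [pairChange, (chartAt E x₀).left_inv hr.1, ContinuousLinearMap.comp_apply]
    refine congrArg _ ?_
    refine Eq.trans ?_ (congrArg (tracVec (V t).proj (V r).proj) (tracCoord_apply hr.2 (V r).2))
    rw [tracVec_tracCoord hr.2]
  · rw [map_neg, h8, ← sub_eq_add_neg]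
    exact congrArg (fun w ↦ fderiv ℝ (pairChange nabla g x₀ (V t).proj) (chartAt E x₀ (V t).proj)
      c' w - _) (tracCoord_apply hyy (V t).2).symm

/-- The equation of parallel transport in the chart at `x₀`. -/
theorem hasDerivAt_pairCoord (h : IsSasakiEinstein g nabla k) (h' : nabla' ∈ projectiveClass nabla)
    {S : Finset ℝ} {V : ℝ → TotalSpace (E × ℝ) (Tractor E : M → Type _)}
    (hV : IsParallelAlong nabla' S V) {t : ℝ} (ht : t ∈ Set.Ioo (0 : ℝ) 1) (htS : t ∉ S)
    (hc : MDifferentiableAt 𝓘(ℝ, ℝ) 𝓘(ℝ, E) (fun r ↦ (V r).proj) t)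
    (hy : (V t).proj ∈ (chartAt E x₀).source) :
    HasDerivAt (fun r ↦ pairCoord nabla g x₀ (V r).proj (V r).2)
      (-coneForm (christoffel nabla x₀) (chartMetric g x₀) (chartAt E x₀ (V t).proj)
        (tanCoord x₀ (V t).proj (mfderiv 𝓘(ℝ, ℝ) 𝓘(ℝ, E) (fun r ↦ (V r).proj) t (1 : ℝ)))
        (pairCoord nabla g x₀ (V t).proj (V t).2)) t := by
  have hyy := mem_chart_source E (V t).proj
  have hext := diffTractorAt_extend (V t).2
  have hx := hasDerivAt_chartAt_comp hc hy
  have h1 := hasDerivAt_pairCoord_of_trivialization (nabla := nabla) (g := g) h.leviCivita hy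
    hc.continuousAt hx ((hV.2 t ht htS).congr_deriv (congrArg Neg.neg (tracCoord_apply hyy _).symm))
  refine h1.congr_deriv ?_
  -- The derivative of `pairChange` occurs twice, once from the change of bundle chart and once from
  -- the tractor derivative of the section that is constant in the bundle chart. It cancels, and
  -- only the cone form is left.
  rw [tractorDeriv_projective h.two_le h.leviCivita.toIsTorsionFreeAffine h' hext,
    pairCoord_tractorDeriv h hy hext, (sectionCoord_extend hy (V t).2).fderiv_eq,
    (hasFDerivAt_clm_apply_const (differentiableAt_pairChange h.leviCivita hy hyy) _).fderiv,
    FiberBundle.extend_apply_self, ContinuousLinearMap.flip_apply]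
  abel

theorem continuousWithinAt_pairCoord (hLC : IsLeviCivita g nabla)
    {V : ℝ → TotalSpace (E × ℝ) (Tractor E : M → Type _)} {s : Set ℝ} {t : ℝ}
    (hV : ContinuousWithinAt V s t) (hy : (V t).proj ∈ (chartAt E x₀).source) :
    ContinuousWithinAt (fun r ↦ pairCoord nabla g x₀ (V r).proj (V r).2) s t ∧
      ContinuousWithinAt (fun r ↦ chartAt E x₀ (V r).proj) s t := by
  have h1 : ContinuousWithinAt (fun r ↦ (V r).proj) s t :=
    (FiberBundle.continuous_proj (E × ℝ) (Tractor E : M → Type _)).continuousAt.comp_continuousWithinAt hV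
  have h2 : ContinuousWithinAt (fun r ↦ chartAt E x₀ (V r).proj) s t :=
    ContinuousAt.comp_continuousWithinAt (f := fun r ↦ (V r).proj)
      ((chartAt E x₀).continuousAt hy) h1
  have h3 : ContinuousWithinAt
      (fun r ↦ (trivializationAt (E × ℝ) (Tractor E : M → Type _) x₀ (V r)).2) s t :=
    (ContinuousAt.comp_continuousWithinAt ((trivializationAt (E × ℝ) (Tractor E : M → Type _)
      x₀).continuousAt ((trivializationAt (E × ℝ) (Tractor E : M → Type _) x₀).mem_source.2
        (mem_tractor_baseSet hy))) hV).snd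
  have h4 := (ContinuousAt.comp_continuousWithinAt (f := fun r ↦ chartAt E x₀ (V r).proj)
    (contDiffAt_scaleMap hLC hy).1.continuousAt h2).clm_apply h3
  refine ⟨h4.congr_of_eventuallyEq ?_ ?_, h2⟩
  · filter_upwards [h1.eventually (eventually_source hy)] with r hr
    rw [pairCoord, ContinuousLinearMap.comp_apply, tracCoord_apply hr]
    rfl
  · rw [pairCoord, ContinuousLinearMap.comp_apply, tracCoord_apply hy]
    rfl

end Curves

/-! ### Local parallel volume forms and their ratios -/

section LocalVolumes

variable {E : Type*} [NormedAddCommGroup E] [NormedSpace ℝ E] [FiniteDimensional ℝ E]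
variable {M : Type*} [TopologicalSpace M] [T2Space M] [ChartedSpace E M] [IsManifold 𝓘(ℝ, E) ∞ M]

/-- Two complex functions with proportional values and proportional differentials have a locally
constant ratio. -/
theorem eventually_eq_ratio {f f' c : M → ℂ} {y : M}
    (hf : ∀ᶠ z in 𝓝 y, MDifferentiableAt 𝓘(ℝ, E) 𝓘(ℝ, ℂ) f z)
    (hf' : ∀ᶠ z in 𝓝 y, MDifferentiableAt 𝓘(ℝ, E) 𝓘(ℝ, ℂ) f' z) (h0 : f' y ≠ 0)
    (h : ∀ᶠ z in 𝓝 y, f z = c z * f' z ∧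
      ∀ v : Tan E z, mvfderiv 𝓘(ℝ, E) f z v = c z * mvfderiv 𝓘(ℝ, E) f' z v) :
    ∀ᶠ z in 𝓝 y, c z = c y := by
  have hy := mem_chart_source E y
  have h1 : ∀ᶠ z in 𝓝 y, f' z ≠ 0 :=
    hf'.self_of_nhds.continuousAt.eventually (isOpen_compl_singleton.mem_nhds h0)
  have h2 := hf.and (hf'.and (h1.and h))
  have h3 : ContinuousAt (chartAt E y).symm (chartAt E y y) :=
    (chartAt E y).continuousAt_symm ((chartAt E y).map_source hy)
  have h4 := h3.tendsto
  rw [(chartAt E y).left_inv hy] at h4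
  obtain ⟨ε, hε, hB⟩ := Metric.eventually_nhds_iff_ball.1
    ((h4.eventually h2).and (eventually_target hy))
  -- The quotient f / f' has zero derivative on a ball. No regularity of c itself is needed, since c
  -- coincides with this quotient.
  have h5 : ∀ z ∈ Metric.ball (chartAt E y y) ε, HasFDerivAt
      (fun z ↦ (f ∘ (chartAt E y).symm) z / (f' ∘ (chartAt E y).symm) z) (0 : E →L[ℝ] ℂ) z := by
    intro z hz
    obtain ⟨⟨hz1, hz2, hz3, hz4, hz5⟩, hzt⟩ := hB z hz
    have hzs := (chartAt E y).map_target hzt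
    have d1 := (differentiableAt_comp_chart_symm hzs hz1).hasFDerivAt
    have d2 := (differentiableAt_comp_chart_symm hzs hz2).hasFDerivAt
    rw [(chartAt E y).right_inv hzt] at d1 d2
    have e1 : ∀ v : E, fderiv ℝ (f ∘ (chartAt E y).symm) z v = c ((chartAt E y).symm z) *
        fderiv ℝ (f' ∘ (chartAt E y).symm) z v := by
      intro v
      have := hz5 (tanVec y _ v)
      rwa [mvfderiv_eq_fderiv hzs hz1, mvfderiv_eq_fderiv hzs hz2, tanCoord_tanVec hzs,
        (chartAt E y).right_inv hzt] at this
    have d3 := d1.mul' ((hasFDerivAt_inv' (𝕜 := ℝ) hz3).comp z d2)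
    simp only [div_eq_mul_inv]
    refine d3.congr_fderiv (ContinuousLinearMap.ext fun v ↦ ?_)
    simp [e1, hz4]
    field_simp
    ring
  have h6 : ∀ z ∈ Metric.ball (chartAt E y y) ε, c ((chartAt E y).symm z) = c y := by
    have h7 : ∀ z ∈ Metric.ball (chartAt E y y) ε, (f ∘ (chartAt E y).symm) z /
        (f' ∘ (chartAt E y).symm) z = c ((chartAt E y).symm z) := by
      intro z hz
      obtain ⟨⟨hz1, hz2, hz3, hz4, hz5⟩, hzt⟩ := hB z hz
      rw [Function.comp_apply, Function.comp_apply, hz4, mul_div_cancel_right₀ _ hz3]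
    intro z hz
    have h8 := Metric.isOpen_ball.is_const_of_fderiv_eq_zero (𝕜 := ℝ)
      (convex_ball _ _).isPreconnected
      (fun z hz ↦ (h5 z hz).differentiableAt.differentiableWithinAt)
      (fun z hz ↦ (h5 z hz).fderiv) hz (Metric.mem_ball_self hε)
    rw [h7 z hz, h7 _ (Metric.mem_ball_self hε), (chartAt E y).left_inv hy] at h8
    exact h8
  filter_upwards [eventually_source hy, ((chartAt E y).continuousAt hy).eventually
    (Metric.ball_mem_nhds _ hε)] with z hz hz'
  have := h6 _ hz'
  rwa [(chartAt E y).left_inv hz] at this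

/-- `ψ` is the coordinate expression on `B` of a parallel complex volume form, in the chart
at `x₀`. -/
structure IsLocalVolume (g : PseudoRiemannianMetric E M) (nabla : Connection E M)
    (k : ∀ y : M, Tan E y) (x₀ : M) {m : ℕ} (ψ : E → (E × ℝ) [⋀^Fin m]→ₗ[ℝ] ℂ) (B : Set E) :
    Prop where
  isOpen : IsOpen B
  parallel : IsParallelOn (coneForm (christoffel nabla x₀) (chartMetric g x₀)) ψ B
  complex : ∀ z ∈ B, IsComplexForm (coneJ (christoffel nabla x₀) (chartMetric g x₀)
    (fieldCoord x₀ k) z : (E × ℝ) →ₗ[ℝ] E × ℝ) (ψ z)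
  ne_zero : ∀ z ∈ B, ψ z ≠ 0

/-- The points of the chart at `x₀` with coordinates in `B`. -/
def chartDomain (x₀ : M) (B : Set E) : Set M := (chartAt E x₀).source ∩ chartAt E x₀ ⁻¹' B

variable {nabla nabla' : Connection E M} {g : PseudoRiemannianMetric E M} {k : ∀ y : M, Tan E y}
variable {m : ℕ}

theorem IsSasakiEinstein.exists_isLocalVolume (h : IsSasakiEinstein g nabla k)
    (hm : finrank ℝ E + 1 = 2 * m) (x₀ : M) : ∃ (ψ : E → (E × ℝ) [⋀^Fin m]→ₗ[ℝ] ℂ) (B : Set E),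
      IsLocalVolume g nabla k x₀ ψ B ∧ chartAt E x₀ x₀ ∈ B := by
  obtain ⟨B, -, hB, hx, ψ, hψ, hψ'⟩ := (h.chart x₀).exists_volume hm
    ((chartAt E x₀).map_source (mem_chart_source E x₀))
  exact ⟨ψ, B, ⟨hB, hψ, fun z hz ↦ (hψ' z hz).1, fun z hz ↦ (hψ' z hz).2⟩, hx⟩

theorem finrank_tractor (nabla : Connection E M) (g : PseudoRiemannianMetric E M) (y : M) :
    finrank ℝ (Tractor E y) = finrank ℝ E + 1 := by
  have h1 : finrank ℝ (Tan E y × ℝ) = finrank ℝ (E × ℝ) := rfl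
  rw [(split nabla g y).finrank_eq, h1, finrank_prod, finrank_self]

variable {x₀ x₁ y : M} {ψ ψ' : E → (E × ℝ) [⋀^Fin m]→ₗ[ℝ] ℂ} {B B' : Set E}

theorem IsLocalVolume.isOpen_chartDomain (h : IsLocalVolume g nabla k x₀ ψ B) :
    IsOpen (chartDomain x₀ B) := (chartAt E x₀).isOpen_inter_preimage h.isOpen

theorem IsLocalVolume.pullForm_ne_zero (h : IsLocalVolume g nabla k x₀ ψ B)
    (hy : y ∈ chartDomain x₀ B) : pullForm nabla g x₀ ψ y ≠ 0 :=
  ProjTractor.pullForm_ne_zero hy.1 (h.ne_zero _ hy.2)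

theorem IsSasakiEinstein.exists_smul_pullForm (hS : IsSasakiEinstein g nabla k)
    (hm : finrank ℝ E + 1 = 2 * m) (h : IsLocalVolume g nabla k x₀ ψ B)
    (hy : y ∈ chartDomain x₀ B) {Ψ : Tractor E y [⋀^Fin m]→ₗ[ℝ] ℂ}
    (hΨ : IsComplexForm (tractorJ nabla g k y) Ψ) :
    ∃ c : ℂ, Ψ = c • pullForm nabla g x₀ ψ y :=
  have : FiniteDimensional ℝ (Tan E y × ℝ) := inferInstanceAs (FiniteDimensional ℝ (E × ℝ))
  have : FiniteDimensional ℝ (Tractor E y) := Module.Finite.equiv (split nabla g y).symm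
  hΨ.exists_smul (fun t ↦ tractorJ_tractorJ hS t) (by rw [finrank_tractor nabla g, hm])
    (isComplexForm_pullForm hS hy.1 (h.complex _ hy.2)) (h.pullForm_ne_zero hy)

/-- Two local parallel volume forms differ by a locally constant factor. -/
theorem IsLocalVolume.exists_eventually_eq_smul (hS : IsSasakiEinstein g nabla k)
    (hm : finrank ℝ E + 1 = 2 * m) (h : IsLocalVolume g nabla k x₀ ψ B)
    (h' : IsLocalVolume g nabla k x₁ ψ' B') (hy : y ∈ chartDomain x₀ B)
    (hy' : y ∈ chartDomain x₁ B') :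
    ∃ c : ℂ, ∀ᶠ z in 𝓝 y, pullForm nabla g x₀ ψ z = c • pullForm nabla g x₁ ψ' z := by
  -- At each point the complex forms of top degree are a line, which determines the factor
  -- pointwise. The membership condition stands inside so that the chosen factor is a function on
  -- all of M.
  have h1 : ∀ z : M, ∃ c : ℂ, z ∈ chartDomain x₀ B ∩ chartDomain x₁ B' →
      pullForm nabla g x₀ ψ z = c • pullForm nabla g x₁ ψ' z := by
    intro z
    by_cases hz : z ∈ chartDomain x₀ B ∩ chartDomain x₁ B'
    · obtain ⟨c, hc⟩ := hS.exists_smul_pullForm hm h' hz.2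
        (isComplexForm_pullForm hS hz.1.1 (h.complex _ hz.1.2))
      exact ⟨c, fun _ ↦ hc⟩
    · exact ⟨0, fun hz' ↦ absurd hz' hz⟩
  choose c hc using h1
  -- Both forms are evaluated on extensions of vectors on which the second does not vanish. Being
  -- parallel, they give functions whose values and differentials have the same ratio c, so
  -- `eventually_eq_ratio` applies.
  obtain ⟨u, hu⟩ : ∃ u, pullForm nabla g x₁ ψ' y u ≠ 0 := by
    by_contra! h0
    exact h'.pullForm_ne_zero hy' (AlternatingMap.ext h0)
  have hs : ∀ᶠ z in 𝓝 y, ∀ i, SmoothTractorAt (FiberBundle.extend (E × ℝ) (u i)) z :=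
    Filter.eventually_all.2 fun i ↦ smoothTractorNear_extend (u i)
  have hU := (h.isOpen_chartDomain.inter h'.isOpen_chartDomain).eventually_mem ⟨hy, hy'⟩
  have h2 := eventually_eq_ratio (c := c)
    (f := fun z ↦ pullForm nabla g x₀ ψ z (fun i ↦ FiberBundle.extend (E × ℝ) (u i) z))
    (f' := fun z ↦ pullForm nabla g x₁ ψ' z (fun i ↦ FiberBundle.extend (E × ℝ) (u i) z))
    (y := y) (by
      filter_upwards [hs, hU] with z hz hzU using (contMDiffAt_pullForm hS h.isOpen h.parallel
        hzU.1.1 hzU.1.2 hz).mdifferentiableAt (by simp)) (by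
      filter_upwards [hs, hU] with z hz hzU using (contMDiffAt_pullForm hS h'.isOpen h'.parallel
        hzU.2.1 hzU.2.2 hz).mdifferentiableAt (by simp))
    (by simpa only [FiberBundle.extend_apply_self] using hu) (by
      filter_upwards [hs, hU] with z hz hzU
      refine ⟨by rw [hc z hzU]; rfl, fun v ↦ ?_⟩
      rw [mvfderiv_pullForm hS h.isOpen h.parallel hzU.1.1 hzU.1.2 (fun i ↦ (hz i).diffTractorAt),
        mvfderiv_pullForm hS h'.isOpen h'.parallel hzU.2.1 hzU.2.2
          (fun i ↦ (hz i).diffTractorAt), Finset.mul_sum]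
      refine Finset.sum_congr rfl fun i _ ↦ ?_
      rw [hc z hzU]
      rfl)
  refine ⟨c y, ?_⟩
  filter_upwards [h2, hU] with z hz hzU
  rw [hc z hzU, hz]

end LocalVolumes

/-! ### The covering space of local parallel volume forms -/

/-- The nonzero complex numbers with the discrete topology. -/
def DiscreteUnits : Type := ℂˣ

instance : TopologicalSpace DiscreteUnits := ⊥

instance : DiscreteTopology DiscreteUnits := ⟨rfl⟩

/-- The underlying complex number. -/
def DiscreteUnits.val (a : DiscreteUnits) : ℂ := Units.val (α := ℂ) a

theorem DiscreteUnits.val_ne_zero (a : DiscreteUnits) : a.val ≠ 0 := Units.ne_zero (M₀ := ℂ) a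

/-- Multiplication of discrete units. -/
def DiscreteUnits.mul (a b : DiscreteUnits) : DiscreteUnits := Mul.mul (α := ℂˣ) a b

theorem DiscreteUnits.val_mul (a b : DiscreteUnits) : (a.mul b).val = a.val * b.val :=
  Units.val_mul (α := ℂ) a b

theorem DiscreteUnits.ext {a b : DiscreteUnits} (h : a.val = b.val) : a = b := Units.ext (α := ℂ) h

section Covering

variable {E : Type*} [NormedAddCommGroup E] [NormedSpace ℝ E] [FiniteDimensional ℝ E]
variable {M : Type*} [TopologicalSpace M] [T2Space M] [ChartedSpace E M] [IsManifold 𝓘(ℝ, E) ∞ M]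

/-- Local parallel complex volume forms around all points of the manifold. -/
structure VolumeAtlas (g : PseudoRiemannianMetric E M) (nabla : Connection E M)
    (k : ∀ y : M, Tan E y) (m : ℕ) where
  form : M → E → (E × ℝ) [⋀^Fin m]→ₗ[ℝ] ℂ
  domain : M → Set E
  isLocalVolume : ∀ x, IsLocalVolume g nabla k x (form x) (domain x)
  mem_domain : ∀ x, chartAt E x x ∈ domain x
  sasakiEinstein : IsSasakiEinstein g nabla k
  finrank_eq : finrank ℝ E + 1 = 2 * m

theorem IsSasakiEinstein.nonempty_volumeAtlas {g : PseudoRiemannianMetric E M}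
    {nabla : Connection E M} {k : ∀ y : M, Tan E y} (h : IsSasakiEinstein g nabla k) {m : ℕ}
    (hm : finrank ℝ E + 1 = 2 * m) : Nonempty (VolumeAtlas g nabla k m) := by
  choose ψ B h1 h2 using fun x ↦ h.exists_isLocalVolume hm x
  exact ⟨⟨ψ, B, h1, h2, h, hm⟩⟩

namespace VolumeAtlas

variable {g : PseudoRiemannianMetric E M} {nabla : Connection E M} {k : ∀ y : M, Tan E y} {m : ℕ}
variable (𝒜 : VolumeAtlas g nabla k m)

/-- The local parallel volume form around `a`. -/
noncomputable def localForm (a y : M) : Tractor E y [⋀^Fin m]→ₗ[ℝ] ℂ :=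
  pullForm nabla g a (𝒜.form a) y

/-- The domain of the local parallel volume form around `a`. -/
def source (a : M) : Set M := chartDomain a (𝒜.domain a)

theorem isOpen_source (a : M) : IsOpen (𝒜.source a) := (𝒜.isLocalVolume a).isOpen_chartDomain

theorem mem_source (a : M) : a ∈ 𝒜.source a := ⟨mem_chart_source E a, 𝒜.mem_domain a⟩

variable {𝒜}
variable {a b c y : M}

theorem localForm_ne_zero (hy : y ∈ 𝒜.source a) : 𝒜.localForm a y ≠ 0 :=
  (𝒜.isLocalVolume a).pullForm_ne_zero hy

theorem isComplexForm_localForm (hy : y ∈ 𝒜.source a) :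
    IsComplexForm (tractorJ nabla g k y) (𝒜.localForm a y) :=
  isComplexForm_pullForm 𝒜.sasakiEinstein hy.1 ((𝒜.isLocalVolume a).complex _ hy.2)

theorem exists_eventually_eq_smul (ha : y ∈ 𝒜.source a) (hb : y ∈ 𝒜.source b) :
    ∃ u : DiscreteUnits, ∀ᶠ z in 𝓝 y, 𝒜.localForm a z = u.val • 𝒜.localForm b z := by
  obtain ⟨c, hc⟩ := (𝒜.isLocalVolume a).exists_eventually_eq_smul 𝒜.sasakiEinstein 𝒜.finrank_eq
    (𝒜.isLocalVolume b) ha hb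
  have h0 : c ≠ 0 := by
    rintro rfl
    exact 𝒜.localForm_ne_zero ha (hc.self_of_nhds.trans (zero_smul _ _))
  exact ⟨Units.mk0 c h0, hc⟩

theorem exists_eq_smul (a b y : M) : ∃ u : DiscreteUnits,
    y ∈ 𝒜.source a → y ∈ 𝒜.source b → 𝒜.localForm a y = u.val • 𝒜.localForm b y := by
  by_cases h : y ∈ 𝒜.source a ∧ y ∈ 𝒜.source b
  · obtain ⟨u, hu⟩ := exists_eventually_eq_smul h.1 h.2
    exact ⟨u, fun _ _ ↦ hu.self_of_nhds⟩
  · exact ⟨(1 : ℂˣ), fun h1 h2 ↦ absurd ⟨h1, h2⟩ h⟩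

variable (𝒜) in
/-- The ratio of two local parallel volume forms. -/
noncomputable def ratio (a b y : M) : DiscreteUnits := (𝒜.exists_eq_smul a b y).choose

theorem localForm_eq_ratio_smul (ha : y ∈ 𝒜.source a) (hb : y ∈ 𝒜.source b) :
    𝒜.localForm a y = (𝒜.ratio a b y).val • 𝒜.localForm b y :=
  (𝒜.exists_eq_smul a b y).choose_spec ha hb

theorem ratio_eq_of_eq_smul (ha : y ∈ 𝒜.source a) (hb : y ∈ 𝒜.source b) {c : ℂ}
    (h : 𝒜.localForm a y = c • 𝒜.localForm b y) : (𝒜.ratio a b y).val = c := by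
  rw [localForm_eq_ratio_smul ha hb] at h
  exact smul_left_injective ℂ (𝒜.localForm_ne_zero hb) h

variable (𝒜) in
/-- The covering space of the local parallel volume forms that are constant multiples of those of
the atlas. -/
noncomputable def core : FiberBundleCore M M DiscreteUnits where
  baseSet := 𝒜.source
  isOpen_baseSet := 𝒜.isOpen_source
  indexAt := id
  mem_baseSet_at := 𝒜.mem_source
  -- A point with coordinate u over a stands for u times the local form around a, which is u times
  -- the ratio times the local form around b.
  coordChange a b y u := (𝒜.ratio a b y).mul u
  coordChange_self a y hy u := by
    refine DiscreteUnits.ext ?_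
    rw [DiscreteUnits.val_mul, ratio_eq_of_eq_smul hy hy (one_smul ℂ _).symm, one_mul]
  continuousOn_coordChange a b := by
    rintro ⟨y, u⟩ ⟨⟨ha, hb⟩, -⟩
    refine ContinuousAt.continuousWithinAt ?_
    obtain ⟨c, hc⟩ := exists_eventually_eq_smul ha hb
    refine (continuousAt_const (y := (𝒜.ratio a b y).mul u)).congr ?_
    have h1 : ∀ᶠ p : M × DiscreteUnits in 𝓝 (y, u), p.2 = u :=
      (continuousAt_snd (p := (y, u))).eventually (isOpen_discrete {u} |>.mem_nhds rfl)
    have h2 := (hc.and (((𝒜.isOpen_source a).eventually_mem ha).and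
      ((𝒜.isOpen_source b).eventually_mem hb)))
    filter_upwards [h1, (continuousAt_fst (p := (y, u))).eventually h2] with p hp1 hp2
    refine DiscreteUnits.ext ?_
    rw [hp1, DiscreteUnits.val_mul, DiscreteUnits.val_mul,
      ratio_eq_of_eq_smul ha hb hc.self_of_nhds, ratio_eq_of_eq_smul hp2.2.1 hp2.2.2 hp2.1]
  coordChange_comp a b c y hy u := by
    refine DiscreteUnits.ext ?_
    rw [DiscreteUnits.val_mul, DiscreteUnits.val_mul, DiscreteUnits.val_mul, ← mul_assoc]
    congr 1
    refine (ratio_eq_of_eq_smul hy.1.1 hy.2 ?_).symm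
    rw [localForm_eq_ratio_smul hy.1.1 hy.1.2, localForm_eq_ratio_smul hy.1.2 hy.2, smul_smul,
      mul_comm]

/-- The coefficient of a point `p` of the covering space with respect to the local form around its
base point. -/
noncomputable def coeff (p : 𝒜.core.TotalSpace) : ℂ := DiscreteUnits.val p.2

theorem coeff_ne_zero (p : 𝒜.core.TotalSpace) : coeff p ≠ 0 := DiscreteUnits.val_ne_zero _

/-- The local form corresponding to a continuous family of points of the covering space. -/
theorem eventually_coeff_smul {X : Type*} [TopologicalSpace X] {q : X → 𝒜.core.TotalSpace}
    {s : Set X} {t : X} (hq : ContinuousWithinAt q s t) : ∀ᶠ r in 𝓝[s] t,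
      ∀ y z : M, (q t).proj = y → (q r).proj = z →
        coeff (q r) • 𝒜.localForm z z = coeff (q t) • 𝒜.localForm y z := by
  have hb := 𝒜.mem_source (q t).proj
  have h1 : ContinuousWithinAt (fun r ↦ (𝒜.core.localTriv (q t).proj (q r)).2) s t :=
    (ContinuousAt.comp_continuousWithinAt
      ((𝒜.core.localTriv (q t).proj).continuousAt
        ((𝒜.core.mem_localTriv_source _ _).2 hb)) hq).snd
  have h2 : ∀ᶠ r in 𝓝[s] t, (q r).proj ∈ 𝒜.source (q t).proj :=
    (ContinuousAt.comp_continuousWithinAt (FiberBundle.continuous_proj DiscreteUnits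
      𝒜.core.Fiber).continuousAt hq).eventually ((𝒜.isOpen_source _).eventually_mem hb)
  -- The fibre coordinate in the trivialisation around the point of q at time t is continuous with
  -- values in a discrete space, so it is locally constant.
  filter_upwards [h1.eventually (isOpen_discrete {_} |>.mem_nhds rfl), h2] with r hr hr2
  rintro _ _ rfl rfl
  have h3 : (𝒜.ratio (q r).proj (q t).proj (q r).proj).mul (q r).2 =
    (𝒜.ratio (q t).proj (q t).proj (q t).proj).mul (q t).2 := hr
  have h4 : (𝒜.ratio (q r).proj (q t).proj (q r).proj).val * coeff (q r) =
      (𝒜.ratio (q t).proj (q t).proj (q t).proj).val * coeff (q t) :=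
    (DiscreteUnits.val_mul _ _).symm.trans
      ((congrArg DiscreteUnits.val h3).trans (DiscreteUnits.val_mul _ _))
  rw [ratio_eq_of_eq_smul hb hb (one_smul ℂ _).symm, one_mul] at h4
  rw [localForm_eq_ratio_smul (𝒜.mem_source (q r).proj) hr2, smul_smul, mul_comm, h4]

theorem isCoveringMap : IsCoveringMap (TotalSpace.proj : 𝒜.core.TotalSpace → M) :=
  FiberBundle.isCoveringMap (F := DiscreteUnits) (E := 𝒜.core.Fiber)

variable (𝒜) in
/-- On a simply connected manifold there is a global parallel volume form. -/
theorem exists_global [SimplyConnectedSpace M] : ∃ Ψ : ∀ y : M, Tractor E y [⋀^Fin m]→ₗ[ℝ] ℂ,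
    ∀ y : M, ∃ c : ℂ, c ≠ 0 ∧ ∀ᶠ z in 𝓝 y, Ψ z = c • 𝒜.localForm y z := by
  have : LocallyPathConnectedSpace M := ChartedSpace.locallyPathConnectedSpace E M
  obtain ⟨x⟩ : Nonempty M := inferInstance
  -- The identity of the simply connected, locally path connected space M lifts through the
  -- covering, and such a lift is a continuous section.
  obtain ⟨q, ⟨-, hq⟩, -⟩ := 𝒜.isCoveringMap.existsUnique_continuousMap_lifts (ContinuousMap.id M) x
    ⟨x, (1 : ℂˣ)⟩ rfl
  have hq' : ∀ y, (q y).proj = y := fun y ↦ congrFun hq y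
  refine ⟨fun y ↦ coeff (q y) • 𝒜.localForm y y, fun y ↦ ⟨coeff (q y), coeff_ne_zero _, ?_⟩⟩
  have h1 := eventually_coeff_smul (q.continuous.continuousAt (x := y)).continuousWithinAt
    (s := Set.univ)
  rw [nhdsWithin_univ] at h1
  filter_upwards [h1] with z hz using hz y z (hq' y) (hq' z)

/-- The monodromy around a null-homotopic loop is trivial. -/
theorem exists_lift {x : M} (c : Path x x) (hc : c.Homotopic (Path.refl x)) :
    ∃ q : ℝ → ℂ, q 0 = q 1 ∧ (∀ t, q t ≠ 0) ∧ ∀ t ∈ Set.Icc (0 : ℝ) 1,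
      ∀ᶠ r in 𝓝[Set.Icc 0 1] t,
        q r • 𝒜.localForm (c.extend r) (c.extend r) =
          q t • 𝒜.localForm (c.extend t) (c.extend r) := by
  let e : 𝒜.core.TotalSpace := ⟨x, (1 : ℂˣ)⟩
  have h0 : c.toContinuousMap 0 = e.proj := c.source
  -- Homotopic paths have lifts with the same end point. The constant path lifts to a constant path,
  -- hence the lift of c is closed.
  have h1 := 𝒜.isCoveringMap.liftPath_apply_one_eq_of_homotopicRel hc e h0 rfl
  have h2 : 𝒜.isCoveringMap.liftPath (Path.refl x).toContinuousMap e rfl = .const _ e :=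
    𝒜.isCoveringMap.liftPath_const (x := x) (e := e) rfl
  let γ := 𝒜.isCoveringMap.liftPath c.toContinuousMap e h0
  have h3 : γ 0 = γ 1 := by
    change γ 0 = 𝒜.isCoveringMap.liftPath c.toContinuousMap e h0 1
    rw [h1, h2]
    exact 𝒜.isCoveringMap.liftPath_zero _ _ h0
  have h4 : ∀ t, (γ t).proj = c t :=
    fun t ↦ congrFun (𝒜.isCoveringMap.liftPath_lifts c.toContinuousMap e h0) t
  let q : ℝ → 𝒜.core.TotalSpace := fun t ↦ γ (Set.projIcc 0 1 zero_le_one t)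
  have hq : Continuous q := γ.continuous.comp continuous_projIcc
  have h5 : ∀ t, (q t).proj = c.extend t := fun t ↦ h4 _
  refine ⟨fun t ↦ coeff (q t), ?_, fun t ↦ coeff_ne_zero _, fun t ht ↦ ?_⟩
  · simp only [q, Set.projIcc_left, Set.projIcc_right]
    exact congrArg coeff h3
  · filter_upwards [eventually_coeff_smul (hq.continuousAt (x := t)).continuousWithinAt] with r hr
    exact hr _ _ (h5 t) (h5 r)

end VolumeAtlas

end Covering

/-! ### Conservation laws for parallel tractor fields along a curve -/

section Holonomy

variable {E : Type*} [NormedAddCommGroup E] [NormedSpace ℝ E] [FiniteDimensional ℝ E]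
variable {M : Type*} [TopologicalSpace M] [T2Space M] [ChartedSpace E M] [IsManifold 𝓘(ℝ, E) ∞ M]

/-- The tractor field `v` along the piecewise `C¹` curve `c` satisfies the equation of parallel
transport in all charts. -/
structure IsParallelField (g : PseudoRiemannianMetric E M) (nabla : Connection E M) (S : Finset ℝ)
    (c : ℝ → M) (v : ∀ t, Tractor E (c t)) : Prop where
  continuousWithinAt : ∀ t ∈ Set.Icc (0 : ℝ) 1, ∀ x₀, c t ∈ (chartAt E x₀).source →
    ContinuousWithinAt (fun r ↦ pairCoord nabla g x₀ (c r) (v r)) (Set.Icc 0 1) t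
  hasDerivAt : ∀ t ∈ Set.Ioo (0 : ℝ) 1, t ∉ S → ∀ x₀, c t ∈ (chartAt E x₀).source →
    HasDerivAt (fun r ↦ pairCoord nabla g x₀ (c r) (v r))
      (-coneForm (christoffel nabla x₀) (chartMetric g x₀) (chartAt E x₀ (c t))
        (tanCoord x₀ (c t) (mfderiv 𝓘(ℝ, ℝ) 𝓘(ℝ, E) c t (1 : ℝ)))
        (pairCoord nabla g x₀ (c t) (v t))) t

variable {nabla nabla' : Connection E M} {g : PseudoRiemannianMetric E M} {k : ∀ y : M, Tan E y}
variable {S : Finset ℝ} {c : ℝ → M} {v w : ∀ t, Tractor E (c t)} {m : ℕ}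

theorem IsParallelAlong.isParallelField (h : IsSasakiEinstein g nabla k)
    (h' : nabla' ∈ projectiveClass nabla) (hc : PiecewiseC1 E S c)
    (hV : IsParallelAlong nabla' S (fun t ↦ TotalSpace.mk' (E × ℝ) (c t) (v t))) :
    IsParallelField g nabla S c v where
  continuousWithinAt t ht _ hx :=
    (continuousWithinAt_pairCoord h.leviCivita (hV.1 t ht) hx).1
  hasDerivAt _ ht htS _ hx :=
    hasDerivAt_pairCoord h h' hV ht htS (hc.mdifferentiableAt ht htS) hx

theorem PiecewiseC1.eventually_source (hc : PiecewiseC1 E S c) {t : ℝ} (ht : t ∈ Set.Icc (0 : ℝ) 1)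
    {x₀ : M} (hx : c t ∈ (chartAt E x₀).source) :
    ∀ᶠ r in 𝓝[Set.Icc 0 1] t, c r ∈ (chartAt E x₀).source :=
  (hc.1 t ht).eventually (ProjTractor.eventually_source hx)

theorem PiecewiseC1.continuousWithinAt_chartAt (hc : PiecewiseC1 E S c) {t : ℝ}
    (ht : t ∈ Set.Icc (0 : ℝ) 1) {x₀ : M} (hx : c t ∈ (chartAt E x₀).source) :
    ContinuousWithinAt (fun r ↦ chartAt E x₀ (c r)) (Set.Icc 0 1) t :=
  ContinuousAt.comp_continuousWithinAt ((chartAt E x₀).continuousAt hx) (hc.1 t ht)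

theorem Ioo_subset_nhds_Icc {p : ℝ → Prop} {t : ℝ} (ht : t ∈ Set.Ioo (0 : ℝ) 1)
    (h : ∀ᶠ r in 𝓝[Set.Icc 0 1] t, p r) : ∀ᶠ r in 𝓝 t, p r := by
  rwa [nhdsWithin_eq_nhds.2 (Icc_mem_nhds ht.1 ht.2)] at h

/-- J is parallel: with dJ = [J, A], applying J to a solution of v' = -A v gives another solution.
-/
theorem IsParallelField.tractorJ (h : IsSasakiEinstein g nabla k) (hc : PiecewiseC1 E S c)
    (hv : IsParallelField g nabla S c v) :
    IsParallelField g nabla S c (fun t ↦ tractorJ nabla g k (c t) (v t)) where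
  continuousWithinAt t ht x₀ hx := by
    have h1 := ((h.chart x₀).smooth_coneJ.contDiffAt (eventually_target hx)).continuousAt
    refine ((ContinuousAt.comp_continuousWithinAt
      (f := fun r ↦ chartAt E x₀ (c r)) h1 (hc.continuousWithinAt_chartAt ht hx)).clm_apply
      (hv.continuousWithinAt t ht x₀ hx)).congr_of_eventuallyEq ?_ ?_
    · filter_upwards [hc.eventually_source ht hx] with r hr using pairCoord_tractorJ h hr _
    · exact pairCoord_tractorJ h hx _
  hasDerivAt t ht htS x₀ hx := by
    have hxt := (chartAt E x₀).map_source hx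
    have h1 := (hasFDerivAt_of_contDiffOn (h.chart x₀).isOpen (h.chart x₀).smooth_coneJ
      hxt).differentiableAt
    have h2 := hasDerivAt_clm_comp_apply h1
      (hasDerivAt_chartAt_comp (hc.mdifferentiableAt ht htS) hx) (hv.hasDerivAt t ht htS x₀ hx)
    refine (h2.congr_of_eventuallyEq ?_).congr_deriv ?_
    · filter_upwards [Ioo_subset_nhds_Icc ht (hc.eventually_source ⟨ht.1.le, ht.2.le⟩ hx)] with r hr
        using pairCoord_tractorJ h hr _
    · rw [(h.chart x₀).fderiv_coneJ hxt, pairCoord_tractorJ h hx]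
      simp only [sub_apply, mul_apply_eq_comp, map_neg]
      abel

/-- As h is parallel, its value on two parallel fields has zero derivative off the finite set S.
Continuity bridges the exceptional times. -/
theorem IsParallelField.tractorH_eq (h : IsSasakiEinstein g nabla k) (hc : PiecewiseC1 E S c)
    (hv : IsParallelField g nabla S c v) (hw : IsParallelField g nabla S c w) :
    tractorH nabla g (c 1) (v 1) (w 1) = tractorH nabla g (c 0) (v 0) (w 0) := by
  refine eq_of_hasDerivAt_zero_off_finset (S := S) (φ := fun t ↦ tractorH nabla g (c t) (v t) (w t))
    (fun t ht ↦ ?_) (fun t ht htS ↦ ?_)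
  · have hx := mem_chart_source E (c t)
    have h1 := ((h.chart (c t)).smooth_G.contDiffAt (eventually_target hx)).continuousAt
    have hv' := hv.continuousWithinAt t ht (c t) hx
    have hw' := hw.continuousWithinAt t ht (c t) hx
    refine (((ContinuousAt.comp_continuousWithinAt (f := fun r ↦ chartAt E (c t) (c r)) h1
      (hc.continuousWithinAt_chartAt ht hx)).clm_apply hv'.fst).clm_apply hw'.fst |>.add
        (hv'.snd.mul hw'.snd)).congr_of_eventuallyEq ?_ ?_
    · filter_upwards [hc.eventually_source ht hx] with r hr using
        tractorH_eq_coneH h.leviCivita hr _ _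
    · exact tractorH_eq_coneH h.leviCivita hx _ _
  · have hx := mem_chart_source E (c t)
    have hxt := (chartAt E (c t)).map_source hx
    have h1 := (h.chart (c t)).hasFDerivAt_coneH (c := fun r ↦ chartAt E (c t) (c r)) (p := t) hxt rfl
      (hasDerivAt_chartAt_comp (hc.mdifferentiableAt ht htS) hx).hasFDerivAt
      (hv.hasDerivAt t ht htS (c t) hx).hasFDerivAt (hw.hasDerivAt t ht htS (c t) hx).hasFDerivAt 1
    refine (h1.1.hasDerivAt.congr_of_eventuallyEq ?_).congr_deriv ?_
    · filter_upwards [Ioo_subset_nhds_Icc ht (hc.eventually_source ⟨ht.1.le, ht.2.le⟩ hx)] with r hr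
        using tractorH_eq_coneH h.leviCivita hr _ _
    · refine h1.2.trans ?_
      simp [coneH]

/-- The factor q glues the local forms along the curve: near each time t, q times the form at the
moving point is a constant multiple of the single parallel form around c(t). Its value on parallel
fields is therefore constant. -/
theorem IsParallelField.localForm_eq (hc : PiecewiseC1 E S c) (𝒜 : VolumeAtlas g nabla k m) {v : Fin m → ∀ t, Tractor E (c t)}
    (hv : ∀ i, IsParallelField g nabla S c (v i)) {q : ℝ → ℂ}
    (hq : ∀ t ∈ Set.Icc (0 : ℝ) 1, ∀ᶠ r in 𝓝[Set.Icc 0 1] t,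
        q r • 𝒜.localForm (c r) (c r) = q t • 𝒜.localForm (c t) (c r)) :
    q 1 * 𝒜.localForm (c 1) (c 1) (fun i ↦ v i 1) =
      q 0 * 𝒜.localForm (c 0) (c 0) (fun i ↦ v i 0) := by
  have hq' : ∀ t ∈ Set.Icc (0 : ℝ) 1, ∀ᶠ r in 𝓝[Set.Icc 0 1] t,
      q r * 𝒜.localForm (c r) (c r) (fun i ↦ v i r) = q t * 𝒜.form (c t) (chartAt E (c t) (c r))
        (fun i ↦ pairCoord nabla g (c t) (c r) (v i r)) := by
    intro t ht
    filter_upwards [hq t ht] with r hr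
    exact DFunLike.congr_fun hr _
  refine eq_of_hasDerivAt_zero_off_finset (S := S)
    (φ := fun t ↦ q t * 𝒜.localForm (c t) (c t) (fun i ↦ v i t))
    (fun t ht ↦ ?_) (fun t ht htS ↦ ?_)
  · have hx := mem_chart_source E (c t)
    have hL := 𝒜.isLocalVolume (c t)
    have h1 : ContinuousWithinAt (fun r ↦ (chartAt E (c t) (c r),
        fun i ↦ pairCoord nabla g (c t) (c r) (v i r))) (Set.Icc 0 1) t :=
      (hc.continuousWithinAt_chartAt ht hx).prodMk (continuousWithinAt_pi.2 fun i ↦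
        (hv i).continuousWithinAt t ht (c t) hx)
    have h2 := (hL.parallel.smooth.contDiffAt ((hL.isOpen.prod isOpen_univ).mem_nhds
      (x := (chartAt E (c t) (c t), fun i ↦ pairCoord nabla g (c t) (c t) (v i t)))
      ⟨𝒜.mem_domain (c t), trivial⟩)).continuousAt
    exact (continuousWithinAt_const.mul (ContinuousAt.comp_continuousWithinAt (f := fun r ↦
      (chartAt E (c t) (c r), fun i ↦ pairCoord nabla g (c t) (c r) (v i r))) h2
        h1)).congr_of_eventuallyEq (hq' t ht) ((hq' t ht).self_of_nhdsWithin ht)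
  · have hx := mem_chart_source E (c t)
    have hL := 𝒜.isLocalVolume (c t)
    have h1 := hL.parallel.hasFDerivAt_comp hL.isOpen (c := fun r ↦ chartAt E (c t) (c r)) (p := t)
      (𝒜.mem_domain (c t))
      (hasDerivAt_chartAt_comp (hc.mdifferentiableAt ht htS) hx).hasFDerivAt
      (hasFDerivAt_pi.2 fun i ↦ ((hv i).hasDerivAt t ht htS (c t) hx).hasFDerivAt) 1
    refine ((h1.1.hasDerivAt.const_mul (q t)).congr_of_eventuallyEq
      (Ioo_subset_nhds_Icc ht (hq' t ⟨ht.1.le, ht.2.le⟩))).congr_deriv ?_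
    refine mul_eq_zero_of_right _ (h1.2.trans (Finset.sum_eq_zero fun i _ ↦ ?_))
    -- The i-th entry is v' + A v, which is zero by the transport equation.
    refine AlternatingMap.map_coord_zero _ i ?_
    simp

end Holonomy

/-! ### Signature of the cone metric -/

section Signature

/-- A diagonal basis with arbitrary index types determines the signature. -/
theorem hasSignature_of_basis {V ι κ : Type*} [AddCommGroup V] [Module ℝ V] [Fintype ι] [Fintype κ]
    [DecidableEq ι] [DecidableEq κ] {B : V → V → ℝ} {r s : ℕ} (b : Basis (ι ⊕ κ) ℝ V)
    (hr : Fintype.card ι = r) (hs : Fintype.card κ = s)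
    (h : ∀ i j, B (b i) (b j) = if i = j then Sum.elim (fun _ ↦ 1) (fun _ ↦ -1) i else 0) :
    HasSignature B r s := by
  refine ⟨b.reindex (Equiv.sumCongr (Fintype.equivFinOfCardEq hr) (Fintype.equivFinOfCardEq hs)),
    fun i j ↦ ?_⟩
  rw [Basis.reindex_apply, Basis.reindex_apply, h]
  simp only [EmbeddingLike.apply_eq_iff_eq]
  congr 1
  rcases i with i | i <;> rfl

theorem HasSignature.finrank_eq {V : Type*} [AddCommGroup V] [Module ℝ V] {B : V → V → ℝ} {r s : ℕ}
    (h : HasSignature B r s) : finrank ℝ V = r + s := by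
  obtain ⟨b, -⟩ := h
  rw [finrank_eq_card_basis b, Fintype.card_sum, Fintype.card_fin, Fintype.card_fin]

/-- Adding a positive definite line to a bilinear form. -/
theorem HasSignature.prod_real {V W : Type*} [AddCommGroup V] [Module ℝ V] [AddCommGroup W]
    [Module ℝ W] {B : V → V → ℝ} {C : W → W → ℝ} {r s : ℕ} (h : HasSignature B r s)
    (e : W ≃ₗ[ℝ] V × ℝ) (h0 : ∀ v, B v 0 = 0) (h0' : ∀ v, B 0 v = 0)
    (hC : ∀ x y, C x y = B (e x).1 (e y).1 + (e x).2 * (e y).2) : HasSignature C (r + 1) s := by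
  obtain ⟨b, hb⟩ := h
  -- The new basis vector has square +1, so the reindexing moves it from the end to the positive
  -- block.
  let σ : (Fin r ⊕ Fin s) ⊕ Unit ≃ (Fin r ⊕ Unit) ⊕ Fin s :=
    (Equiv.sumAssoc _ _ _).trans ((Equiv.sumCongr (Equiv.refl _) (Equiv.sumComm _ _)).trans
      (Equiv.sumAssoc _ _ _).symm)
  refine hasSignature_of_basis (((b.prod (Basis.singleton Unit ℝ)).map e.symm).reindex σ)
    (by simp) (by simp) fun i j ↦ ?_
  have h1 : ∀ i j : (Fin r ⊕ Fin s) ⊕ Unit,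
      C (((b.prod (Basis.singleton Unit ℝ)).map e.symm) i)
        (((b.prod (Basis.singleton Unit ℝ)).map e.symm) j) =
      if i = j then Sum.elim (Sum.elim (fun _ ↦ 1) (fun _ ↦ -1)) (fun _ ↦ 1) i else 0 := by
    intro i j
    rw [hC, Basis.map_apply, Basis.map_apply, LinearEquiv.apply_symm_apply,
      LinearEquiv.apply_symm_apply]
    rcases i with i | i <;> rcases j with j | j <;>
      simp [h0, h0', hb]
  rw [Basis.reindex_apply, Basis.reindex_apply, h1]
  simp only [EmbeddingLike.apply_eq_iff_eq]
  congr 1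
  rcases i with (i | i) | i <;> rfl

end Signature

/-! ### Parallelism for the whole projective class, and special unitary holonomy -/

section Main

variable {E : Type*} [NormedAddCommGroup E] [NormedSpace ℝ E] [FiniteDimensional ℝ E]
variable {M : Type*} [TopologicalSpace M] [T2Space M] [ChartedSpace E M] [IsManifold 𝓘(ℝ, E) ∞ M]
variable {nabla nabla' : Connection E M} {g : PseudoRiemannianMetric E M} {k : ∀ y : M, Tan E y}

theorem IsSasakiEinstein.isHermitianStructure (h : IsSasakiEinstein g nabla k) {p q : ℕ}
    (hp : 1 ≤ p)
    (hsig : ∀ x : M, HasSignature (fun v w ↦ g.inner x v w) (2 * p - 1) (2 * q)) :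
    IsHermitianStructure p q (tractorJ nabla g k) (tractorH nabla g) where
  smooth_J _ hs x := smoothTractorAt_tractorJ h (hs x)
  smooth_h _ _ hs ht x := contMDiffAt_tractorH h (hs x) (ht x)
  J_sq _ u := tractorJ_tractorJ h u
  symm _ u w := tractorH_symm u w
  signature x := by
    have h1 := (hsig x).prod_real (C := fun u w ↦ tractorH nabla g x u w) (split nabla g x)
      (fun v ↦ map_zero _) (fun v ↦ by simp) (fun u w ↦ rfl)
    rwa [show 2 * p - 1 + 1 = 2 * p by omega] at h1
  hermitian _ u w := tractorH_tractorJ h u w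

theorem IsSasakiEinstein.parallelEnd (h : IsSasakiEinstein g nabla k)
    (h' : nabla' ∈ projectiveClass nabla) : ParallelEnd nabla' (tractorJ nabla g k) := by
  intro s hs x v
  have hs' : SmoothTractorAt s x := hs x
  have hT := h.leviCivita.toIsTorsionFreeAffine
  rw [tractorDeriv_projective h.two_le hT h' (smoothTractorAt_tractorJ h hs').diffTractorAt,
    tractorDeriv_projective h.two_le hT h' hs'.diffTractorAt,
    tractorDeriv_tractorJ h hs'.diffTractorAt]

theorem IsSasakiEinstein.parallelBilin (h : IsSasakiEinstein g nabla k)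
    (h' : nabla' ∈ projectiveClass nabla) : ParallelBilin nabla' (tractorH nabla g) := by
  intro s t hs ht x v
  have hs' : SmoothTractorAt s x := hs x
  have ht' : SmoothTractorAt t x := ht x
  have hT := h.leviCivita.toIsTorsionFreeAffine
  rw [tractorDeriv_projective h.two_le hT h' hs'.diffTractorAt,
    tractorDeriv_projective h.two_le hT h' ht'.diffTractorAt,
    mvfderiv_tractorH h hs'.diffTractorAt ht'.diffTractorAt]

theorem mvfderiv_const_mul_of_eventually {F f : M → ℂ} {y : M} {c : ℂ}
    (hf : MDifferentiableAt 𝓘(ℝ, E) 𝓘(ℝ, ℂ) f y) (h : ∀ᶠ z in 𝓝 y, F z = c * f z) (v : Tan E y) :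
    mvfderiv 𝓘(ℝ, E) F y v = c * mvfderiv 𝓘(ℝ, E) f y v := by
  have hy := mem_chart_source E y
  have hd := differentiableAt_comp_chart_symm hy hf
  have h1 : F ∘ (chartAt E y).symm =ᶠ[𝓝 (chartAt E y y)]
      fun z ↦ c * (f ∘ (chartAt E y).symm) z := by
    have h2 := ((chartAt E y).continuousAt_symm ((chartAt E y).map_source hy)).tendsto
    rw [(chartAt E y).left_inv hy] at h2
    exact h2.eventually h
  have h3 := hd.hasFDerivAt.const_mul c
  rw [mvfderiv_eq_fderiv hy (mdifferentiableAt_of_comp_chart_symm hy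
    (h1.differentiableAt_iff.2 h3.differentiableAt)), mvfderiv_eq_fderiv hy hf, h1.fderiv_eq,
    h3.fderiv]
  rfl

/-- Near each point the global form is a nonzero constant multiple of a local parallel volume form.
All the required properties are local and invariant under such multiples. -/
theorem VolumeAtlas.exists_parallel_volume [SimplyConnectedSpace M] {m : ℕ}
    (𝒜 : VolumeAtlas g nabla k m) : ∃ Ψ : ∀ x : M, Tractor E x [⋀^Fin m]→ₗ[ℝ] ℂ,
      IsComplexVolumeForm (tractorJ nabla g k) Ψ ∧
        ∀ nabla' ∈ projectiveClass nabla, ParallelForm nabla' Ψ := by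
  obtain ⟨Ψ, hΨ⟩ := 𝒜.exists_global
  have h := 𝒜.sasakiEinstein
  have hsm : ∀ (s : Fin m → ∀ x : M, Tractor E x), (∀ i, SmoothTractor (s i)) → ∀ x,
      ContMDiffAt 𝓘(ℝ, E) 𝓘(ℝ, ℂ) ∞ (fun y ↦ 𝒜.localForm x y (fun i ↦ s i y)) x :=
    fun s hs x ↦ contMDiffAt_pullForm h (𝒜.isLocalVolume x).isOpen (𝒜.isLocalVolume x).parallel
      (𝒜.mem_source x).1 (𝒜.mem_source x).2 fun i ↦ hs i x
  refine ⟨Ψ, ⟨fun s hs x ↦ ?_, fun x ↦ ?_, fun x ↦ ?_⟩, fun nabla' h' s hs x v ↦ ?_⟩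
  · obtain ⟨c, -, hc⟩ := hΨ x
    refine ((contDiff_const.mul contDiff_id : ContDiff ℝ ∞ fun z : ℂ ↦ c * z).contMDiff.contMDiffAt.comp
      x (hsm s hs x)).congr_of_eventuallyEq ?_
    filter_upwards [hc] with y hy
    rw [hy]
    rfl
  · obtain ⟨c, -, hc⟩ := hΨ x
    intro u i
    rw [hc.self_of_nhds, AlternatingMap.smul_apply, AlternatingMap.smul_apply,
      VolumeAtlas.isComplexForm_localForm (𝒜.mem_source x), smul_eq_mul, smul_eq_mul]
    ring
  · obtain ⟨c, hc0, hc⟩ := hΨ x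
    rw [hc.self_of_nhds]
    exact smul_ne_zero hc0 (VolumeAtlas.localForm_ne_zero (𝒜.mem_source x))
  · obtain ⟨c, -, hc⟩ := hΨ x
    have hs' : ∀ i, DiffTractorAt (s i) x := fun i ↦ SmoothTractorAt.diffTractorAt (hs i x)
    rw [mvfderiv_const_mul_of_eventually ((hsm s hs x).mdifferentiableAt (by simp))
      (c := c) (hc.mono fun y hy ↦ by rw [hy]; rfl)]
    have h1 := mvfderiv_pullForm h (𝒜.isLocalVolume x).isOpen (𝒜.isLocalVolume x).parallel
      (𝒜.mem_source x).1 (𝒜.mem_source x).2 hs' v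
    refine (congrArg (c * ·) h1).trans ?_
    rw [Finset.mul_sum]
    refine Finset.sum_congr rfl fun i _ ↦ ?_
    rw [hc.self_of_nhds, tractorDeriv_projective h.two_le h.leviCivita.toIsTorsionFreeAffine h'
      (hs' i)]
    rfl

theorem exists_eq_mk {y : M} (p : TotalSpace (E × ℝ) (Tractor E : M → Type _)) (h : p.proj = y) :
    ∃ v : Tractor E y, p = TotalSpace.mk' (E × ℝ) y v := by
  subst h
  exact ⟨p.2, rfl⟩

/-- The end points of the loop equal x only propositionally, so tractors at the end times are
compared with tractors at x by heterogeneous equality. This and the next two lemmas carry h, J and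
the local forms across. -/
theorem tractorH_heq {x y : M} (hy : y = x) {v w : Tractor E y} {v' w' : Tractor E x}
    (hv : HEq v v') (hw : HEq w w') : tractorH nabla g y v w = tractorH nabla g x v' w' := by
  subst hy
  rw [eq_of_heq hv, eq_of_heq hw]

theorem tractorJ_heq {x y : M} (hy : y = x) {v : Tractor E y} {v' : Tractor E x}
    (hv : HEq v v') : HEq (tractorJ nabla g k y v) (tractorJ nabla g k x v') := by
  subst hy
  rw [eq_of_heq hv]

theorem VolumeAtlas.localForm_heq {m : ℕ} (𝒜 : VolumeAtlas g nabla k m) {x y : M} (hy : y = x)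
    {v : Fin m → Tractor E y} {v' : Fin m → Tractor E x} (hv : ∀ i, HEq (v i) (v' i)) :
    𝒜.localForm y y v = 𝒜.localForm x x v' := by
  subst hy
  rw [funext fun i ↦ eq_of_heq (hv i)]

/-- Each condition is a conservation law for h, for J or for the glued volume form, read off at the
two ends of the loop. Closedness of the lifted factor q is what gives determinant 1. -/
theorem VolumeAtlas.isSpecialUnitary {m : ℕ} (𝒜 : VolumeAtlas g nabla k m)
    (h' : nabla' ∈ projectiveClass nabla) {x : M} {A : Tractor E x →ₗ[ℝ] Tractor E x}
    (hA : A ∈ restrictedHolonomy nabla' x) :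
    IsSpecialUnitary m (tractorJ nabla g k x) (tractorH nabla g x) A := by
  have h := 𝒜.sasakiEinstein
  obtain ⟨c, S, hhom, hc, hV⟩ := hA
  -- One parallel field is selected for each initial value; uniqueness of parallel transport is
  -- never needed.
  have hV' : ∀ u : Tractor E x, ∃ v : ∀ t, Tractor E (c.extend t),
      IsParallelField g nabla S c.extend v ∧ HEq (v 0) u ∧ HEq (v 1) (A u) := by
    intro u
    obtain ⟨V, hVc, hVp, hV0, hV1⟩ := hV u
    choose v hv using fun t ↦ exists_eq_mk (V t) (hVc t)
    obtain rfl : V = fun t ↦ TotalSpace.mk' (E × ℝ) (c.extend t) (v t) := funext hv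
    exact ⟨v, hVp.isParallelField h h' hc, (TotalSpace.mk.inj hV0).2, (TotalSpace.mk.inj hV1).2⟩
  choose v hv hv0 hv1 using hV'
  have e0 : c.extend 0 = x := c.extend_zero
  have e1 : c.extend 1 = x := c.extend_one
  have hunit : ∀ u w, tractorH nabla g x (A u) (A w) = tractorH nabla g x u w := by
    intro u w
    have h1 := (hv u).tractorH_eq h hc (hv w)
    rwa [tractorH_heq e0 (hv0 u) (hv0 w), tractorH_heq e1 (hv1 u) (hv1 w)] at h1
  -- The selected field for J u need not a priori be J applied to the selected field for u, so
  -- complex linearity is obtained from h. Both J A u and A J u have pairing h(w, J u) with A w. As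
  -- A is onto and h is nondegenerate, they coincide.
  have hJ : ∀ u w, tractorH nabla g x (A w) (tractorJ nabla g k x (A u)) =
      tractorH nabla g x w (tractorJ nabla g k x u) := by
    intro u w
    have h1 := (hv w).tractorH_eq h hc ((hv u).tractorJ h hc)
    rwa [tractorH_heq e0 (hv0 w) (tractorJ_heq e0 (hv0 u)),
      tractorH_heq e1 (hv1 w) (tractorJ_heq e1 (hv1 u))] at h1
  have hsurj : Function.Surjective A := by
    have : FiniteDimensional ℝ (Tan E x × ℝ) := inferInstanceAs (FiniteDimensional ℝ (E × ℝ))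
    have : FiniteDimensional ℝ (Tractor E x) := Module.Finite.equiv (split nabla g x).symm
    refine LinearMap.injective_iff_surjective.1 ((injective_iff_map_eq_zero A).2 fun u hu ↦ ?_)
    refine tractorH_nondegenerate (nabla := nabla) (g := g) u fun w ↦ ?_
    rw [← hunit, hu, map_zero]
  refine ⟨fun u ↦ ?_, hunit, fun Ψ hΨ u ↦ ?_⟩
  · refine sub_eq_zero.1 (tractorH_nondegenerate (nabla := nabla) (g := g) _ fun w ↦ ?_)
    obtain ⟨w, rfl⟩ := hsurj w
    rw [map_sub, hunit, hJ, sub_self]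
  · obtain ⟨q, hq01, hq0, hq⟩ := 𝒜.exists_lift c hhom
    have h1 := IsParallelField.localForm_eq hc 𝒜 (fun i ↦ hv (u i)) hq
    rw [𝒜.localForm_heq e0 fun i ↦ hv0 (u i), 𝒜.localForm_heq e1 fun i ↦ hv1 (u i), hq01] at h1
    -- Complex forms of top degree on one fibre form a line, so invariance of the local parallel
    -- form is enough.
    obtain ⟨a, rfl⟩ := h.exists_smul_pullForm 𝒜.finrank_eq (𝒜.isLocalVolume x) (𝒜.mem_source x) hΨ
    exact congrArg (a * ·) (mul_left_cancel₀ (hq0 1) h1)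

end Main

end ProjTractor

theorem theoremA
    {E : Type*} [NormedAddCommGroup E] [NormedSpace ℝ E] [FiniteDimensional ℝ E]
    {M : Type*} [TopologicalSpace M] [T2Space M] [SecondCountableTopology M]
    [ChartedSpace E M] [IsManifold 𝓘(ℝ, E) ∞ M]
    (hdim : 2 ≤ finrank ℝ E) (p q : ℕ) (hp : 1 ≤ p)
    (g : PseudoRiemannianMetric E M)
    (hsig : ∀ x : M, HasSignature (fun v w ↦ g.inner x v w) (2 * p - 1) (2 * q))
    (nabla : Connection E M) (hLC : IsLeviCivita g nabla)
    (k : ∀ x : M, Tan E x) (hSasaki : IsSasaki g nabla k) (hEinstein : IsEinstein g nabla) :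
    ∃ (J : ∀ x : M, Tractor E x →ₗ[ℝ] Tractor E x)
      (h : ∀ x : M, Tractor E x →ₗ[ℝ] Tractor E x →ₗ[ℝ] ℝ),
      IsHermitianStructure p q J h ∧
      (∀ nabla' ∈ projectiveClass nabla, ParallelEnd nabla' J ∧ ParallelBilin nabla' h) ∧
      (SimplyConnectedSpace M →
        ∃ Ψ : ∀ x : M, Tractor E x [⋀^Fin (p + q)]→ₗ[ℝ] ℂ,
          IsComplexVolumeForm J Ψ ∧ ∀ nabla' ∈ projectiveClass nabla, ParallelForm nabla' Ψ) ∧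
      (∀ nabla' ∈ projectiveClass nabla, ∀ x : M, ∀ A ∈ restrictedHolonomy nabla' x,
        IsSpecialUnitary (p + q) (J x) (h x) A) := by
  have hS : IsSasakiEinstein g nabla k := ⟨hLC, hSasaki, hEinstein, hdim⟩
  -- The identity N + 1 = 2(p + q) is read off from the signature at a point, so a point of M is
  -- required.
  have hA : ∀ _ : M, Nonempty (VolumeAtlas g nabla k (p + q)) := fun x ↦ by
    have h1 : finrank ℝ E = 2 * p - 1 + 2 * q := (hsig x).finrank_eq
    exact hS.nonempty_volumeAtlas (by omega)
  refine ⟨tractorJ nabla g k, tractorH nabla g, hS.isHermitianStructure hp hsig,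
    fun nabla' h' ↦ ⟨hS.parallelEnd h', hS.parallelBilin h'⟩, fun hM ↦ ?_,
    fun nabla' h' x A hx ↦ ?_⟩
  · obtain ⟨x⟩ : Nonempty M := inferInstance
    obtain ⟨𝒜⟩ := hA x
    exact 𝒜.exists_parallel_volume
  · obtain ⟨𝒜⟩ := hA x
    exact 𝒜.isSpecialUnitary h' hx
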